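/- **Theorem 3.1 (Spectral triple).** Let $c$ be a positive integer, $\mu,\nu\in\mathbb R$, $\mathbb T=\mathbb R/\mathbb Z$, $e(t)=e^{2\pi i t}$. Let $\mathcal A$ be the unital $*$-algebra of smooth elements of the dense subalgebra $D_0$ of the quantum Heisenberg manifold $D^{c}_{-\mu,-\nu}$: the functions $\Phi:\mathbb R\times\mathbb T\times\mathbb Z\to\mathbb C$ that are smooth in $(x,y)$, vanish for all but finitely many $p$, and satisfy $$\Phi(x+k,y,p)=e(ckp(y+p\nu))\,\Phi(x,y,p)\qquad(k\in\mathbb Z),$$ with $$(\Phi*\Psi)(x,y,p)=\sum_{q\in\mathbb Z}\Phi(x,y,q)\Psi(x+2q\mu,y+2q\nu,p-q),\qquad \Phi^*(x,y,p)=\overline{\Phi(x+2p\mu,y+2p\nu,-p)},$$ and unit $\delta_0(p)$. Let $\mathcal H=L^2([0,1]\times\mathbb T\times\mathbb Z)$. For $a\in\mathcal A$ and $\xi\in\mathcal H$ put $$(\tilde\pi(a)\xi)(x,y,p)=\sum_{q\in\mathbb Z}a(x-2p\mu,y-2p\nu,q)\,\xi(x,y,p-q),$$ and let $\tilde\pi(a)$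 act on $\mathcal H\otimes\mathbb C^2$ by $\tilde\pi(a)(\xi\otimes u)=(\tilde\pi(a)\xi)\otimes u$. Let $$D(\Phi\otimes u)=\sum_{j=X,Y,Z} i\,\tilde\delta_j(\Phi)\otimes\sigma_j(u),$$ where $\sigma_X=\begin{pmatrix}0&1\\1&0\end{pmatrix}$, $\sigma_Y=\begin{pmatrix}0&-i\\i&0\end{pmatrix}$, $\sigma_Z=\begin{pmatrix}1&0\\0&-1\end{pmatrix}$ and $$\tilde\delta_X\Phi=2\pi i c p(x-p\mu)\Phi-\partial_y\Phi,\qquad \tilde\delta_Y\Phi=-\partial_x\Phi,\qquad \tilde\delta_Z\Phi=2\pi i p\,\Phi$$ (weak derivatives on $(0,1)\times\mathbb T$). The domain of $D$ consists of all $\Phi\in L^2([0,1]\times\mathbb T\times\mathbb Z;\mathbb C^2)=\mathcal H\otimes\mathbb C^2$ such that 1. $\Phi(\cdot,\cdot,p)\in H^1([0,1]\times\mathbb T)$ for all $p\in\mathbb Z$; 2. $\Phi(0,y,p)=\overline{e}(cp(y-p\nu))\,\Phi(1,y,p)$ in the sense of traces, for all $p\in\mathbb Z$; 3. $p\Phi$,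 $\partial_x\Phi$ and $\partial_y(e(\lfloor cp^2\mu\rfloor y)\Phi)$ are square integrable on $[0,1]\times\mathbb T\times\mathbb Z$. Then these formulas define an operator $D$ on $\mathcal H\otimes\mathbb C^2$ and a faithful unital $*$-representation $\tilde\pi$ of $\mathcal A$ by bounded operators on $\mathcal H\otimes\mathbb C^2$, and $(\mathcal A,\mathcal H\otimes\mathbb C^2,D)$ is an odd spectral triple of dimension $3$: * $D$ is densely defined and self-adjoint; * for every $a\in\mathcal A$, $\tilde\pi(a)$ maps the domain of $D$ into itself and $[D,\tilde\pi(a)]$ is bounded on it; * $(D-\lambda)^{-1}$ is a compact operator for every $\lambda\in\mathbb C\setminus\mathbb R$; * the operator $|D|^{-3}$, defined to be zero on $\ker D$ and the inverse of $|D|^3$ on the range of $|D|^3$, is compact, and its non-zero eigenvalues $\mu_1\ge\mu_2\ge\cdots$ (with multiplicity) satisfy $\mu_m\le C m^{-1}$ for a constant $C$. In particular $|D|^{-3}\in\mathcal L^{(1,\infty)}$, that is, $\sum_{m\le N}\mu_m=O(\log N)$. -/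

import Mathlib

open MeasureTheory ComplexConjugate
open scoped ContDiff InnerProductSpace ENNReal

noncomputable section

namespace QHM

/-! ## The algebra of smooth functions in the quantum Heisenberg manifold -/

/-- The smooth elements of the algebra `D₀` dense in `D^c_{μν}`: functions `Φ(x, y, p)` on
`ℝ × 𝕋 × ℤ`, smooth in `(x, y)`, supported on finitely many `p`, and fixed by the action
`(ρ_k Φ)(x, y, p) = conj (e(ckp(y - pν))) Φ(x + k, y, p)` of `ℤ`.
Here `𝕋 = ℝ/ℤ` and `fourier n (y - θ) = e(n(y - θ))` with `e(t) = exp(2πit)`.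
(Such functions are automatically bounded; `μ` enters through the product.) -/
def smoothElements (c : ℕ) (_μ ν : ℝ) : Submodule ℂ (ℝ → UnitAddCircle → ℤ → ℂ) where
  carrier := {Φ |
    (∀ p : ℤ, ContDiff ℝ ∞ fun z : ℝ × ℝ => Φ z.1 (z.2 : UnitAddCircle) p) ∧
    {p : ℤ | ∃ x y, Φ x y p ≠ 0}.Finite ∧
    ∀ (k : ℤ) (x : ℝ) (y : UnitAddCircle) (p : ℤ),
      conj (fourier (c * k * p) (y - ((p * ν : ℝ) : UnitAddCircle))) * Φ (x + k) y p = Φ x y p}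
  add_mem' := by
    rintro a b ⟨ha, ha', ha''⟩ ⟨hb, hb', hb''⟩
    refine ⟨fun p => (ha p).add (hb p), (ha'.union hb').subset ?_, fun k x y p => ?_⟩
    · rintro p ⟨x, y, h⟩
      by_contra hc
      simp only [Set.mem_union, Set.mem_ofPred_eq, not_or, not_exists, not_not] at hc
      exact h (by simp [hc.1 x y, hc.2 x y])
    · simp only [Pi.add_apply]
      rw [mul_add, ha'', hb'']
  zero_mem' := by
    refine ⟨fun p => contDiff_const, by simp, fun k x y p => by simp⟩
  smul_mem' := by
    rintro r a ⟨ha, ha', ha''⟩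
    refine ⟨fun p => contDiff_const.mul (ha p), ha'.subset ?_, fun k x y p => ?_⟩
    · rintro p ⟨x, y, h⟩
      exact ⟨x, y, fun h0 => h (by simp [h0])⟩
    · simp only [Pi.smul_apply, smul_eq_mul]
      rw [mul_left_comm, ha'']

/-- The algebra `𝒜` of smooth elements of `D₀ ⊂ D^c_{μν}`. -/
abbrev Smooth (c : ℕ) (μ ν : ℝ) : Type := ↥(smoothElements c μ ν)

/-- The product
`(Φ * Ψ)(x, y, p) = ∑_q Φ(x, y, q) Ψ(x - 2qμ, y - 2qν, p - q)`; the sum is finite on `D₀`. -/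
def convFun (μ ν : ℝ) (a b : ℝ → UnitAddCircle → ℤ → ℂ) : ℝ → UnitAddCircle → ℤ → ℂ :=
  fun x y p => ∑ᶠ q : ℤ,
    a x y q * b (x - 2 * q * μ) (y - ((2 * q * ν : ℝ) : UnitAddCircle)) (p - q)

/-- The involution `Φ*(x, y, p) = conj Φ(x - 2pμ, y - 2pν, -p)`. -/
def starFun (μ ν : ℝ) (a : ℝ → UnitAddCircle → ℤ → ℂ) : ℝ → UnitAddCircle → ℤ → ℂ :=
  fun x y p => conj (a (x - 2 * p * μ) (y - ((2 * p * ν : ℝ) : UnitAddCircle)) (-p))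

/-- The unit `δ₀(p)`. -/
def oneFun : ℝ → UnitAddCircle → ℤ → ℂ := fun _ _ p => if p = 0 then 1 else 0

theorem fourier_mul_fourier (m n k : ℤ) (u v w : UnitAddCircle) (h : m • u + n • v = k • w) :
    (fourier m u * fourier n v : ℂ) = fourier k w := by
  simp only [fourier_apply]
  rw [← Circle.coe_mul, ← AddCircle.toCircle_add, h]

theorem conj_fourier_mul_self (m : ℤ) (u : UnitAddCircle) :
    (conj (fourier m u) * fourier m u : ℂ) = 1 := by
  rw [← fourier_neg, ← fourier_add]
  simp

theorem coe_int_mul (q : ℤ) (ν : ℝ) :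
    ((q * ν : ℝ) : UnitAddCircle) = q • (ν : UnitAddCircle) := by
  rw [← AddCircle.coe_zsmul, zsmul_eq_mul]

theorem coe_two_mul (q : ℤ) (ν : ℝ) :
    ((2 * q * ν : ℝ) : UnitAddCircle) = (2 * q) • (ν : UnitAddCircle) := by
  rw [← AddCircle.coe_zsmul, zsmul_eq_mul]
  push_cast
  rfl

section algebra

variable {c : ℕ} {μ ν : ℝ}

theorem Smooth.shift (a : Smooth c μ ν) (k : ℤ) (x : ℝ) (y : UnitAddCircle) (p : ℤ) :
    a.1 (x + k) y p = fourier (c * k * p) (y - ((p * ν : ℝ) : UnitAddCircle)) * a.1 x y p := by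
  rw [← a.2.2.2 k x y p, ← mul_assoc, mul_comm (fourier _ _), conj_fourier_mul_self, one_mul]

/-- The finitely many `p` at which `a` is nonzero. -/
def Smooth.supp (a : Smooth c μ ν) : Finset ℤ := a.2.2.1.toFinset

theorem Smooth.eq_zero_of_notMem (a : Smooth c μ ν) {p : ℤ} (hp : p ∉ a.supp) (x y) :
    a.1 x y p = 0 := by
  by_contra h
  exact hp (by simpa [Smooth.supp] using ⟨x, y, h⟩)

theorem convFun_eq_sum (a : Smooth c μ ν) (b : ℝ → UnitAddCircle → ℤ → ℂ) (s : Finset ℤ)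
    (hs : a.supp ⊆ s) (x y p) :
    convFun μ ν a.1 b x y p = ∑ q ∈ s,
      a.1 x y q * b (x - 2 * q * μ) (y - ((2 * q * ν : ℝ) : UnitAddCircle)) (p - q) := by
  refine finsum_eq_sum_of_support_subset _ fun q hq => ?_
  by_contra h
  exact hq (by simp [a.eq_zero_of_notMem (fun h' => h (hs h'))])

theorem contDiff_translate (b : Smooth c μ ν) (s t : ℝ) (p : ℤ) :
    ContDiff ℝ ∞ fun z : ℝ × ℝ =>
      b.1 (z.1 - s) ((z.2 : UnitAddCircle) - (t : UnitAddCircle)) p := by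
  have h := (b.2.1 p).comp (f := fun z : ℝ × ℝ => (z.1 - s, z.2 - t)) (by fun_prop)
  simpa [Function.comp_def] using h

instance : Mul (Smooth c μ ν) where
  mul a b := ⟨convFun μ ν a.1 b.1, by
    refine ⟨fun p => ?_, ?_, fun k x y p => ?_⟩
    · simp only [convFun_eq_sum a b.1 a.supp subset_rfl]
      exact ContDiff.sum fun q _ => (a.2.1 q).mul (contDiff_translate b _ _ _)
    · refine ((a.supp ×ˢ b.supp).image fun z => z.1 + z.2).finite_toSet.subset ?_
      rintro p ⟨x, y, h⟩
      rw [convFun_eq_sum a b.1 a.supp subset_rfl] at h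
      obtain ⟨q, hq, hne⟩ := Finset.exists_ne_zero_of_sum_ne_zero h
      have hb : p - q ∈ b.supp := by
        by_contra hb
        exact hne (by simp [b.eq_zero_of_notMem hb])
      simp only [Finset.coe_image, Set.mem_image, Finset.mem_coe, Finset.mem_product]
      exact ⟨(q, p - q), ⟨hq, hb⟩, by ring⟩
    · simp only [convFun_eq_sum a b.1 a.supp subset_rfl, Finset.mul_sum]
      refine Finset.sum_congr rfl fun q _ => ?_
      rw [show x + (k : ℝ) - 2 * q * μ = x - 2 * q * μ + k by ring, a.shift, b.shift]
      have := fourier_mul_fourier (c * k * q) (c * k * (p - q)) (c * k * p)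
        (y - ((q * ν : ℝ) : UnitAddCircle))
        (y - ((2 * q * ν : ℝ) : UnitAddCircle) - (((p - q : ℤ) * ν : ℝ) : UnitAddCircle))
        (y - ((p * ν : ℝ) : UnitAddCircle)) (by
          simp only [coe_int_mul, coe_two_mul]
          module)
      have h1 := conj_fourier_mul_self (c * k * p) (y - ((p * ν : ℝ) : UnitAddCircle))
      rw [← this] at h1 ⊢
      linear_combination (a.1 x y q * b.1 (x - 2 * q * μ)
        (y - ((2 * q * ν : ℝ) : UnitAddCircle)) (p - q)) * h1⟩

instance : One (Smooth c μ ν) where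
  one := ⟨oneFun, by
    refine ⟨fun p => contDiff_const, (Set.finite_singleton 0).subset ?_, fun k x y p => ?_⟩
    · rintro p ⟨x, y, h⟩
      by_contra hp
      exact h (if_neg hp)
    · by_cases hp : p = 0
      · subst hp
        simp [oneFun]
      · simp [oneFun, hp]⟩

instance : Star (Smooth c μ ν) where
  star a := ⟨starFun μ ν a.1, by
    refine ⟨fun p => ?_, (a.supp.image fun q => -q).finite_toSet.subset ?_,
      fun k x y p => ?_⟩
    · exact Complex.conjCLE.contDiff.comp (contDiff_translate a _ _ _)
    · rintro p ⟨x, y, h⟩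
      simp only [Finset.coe_image, Set.mem_image, Finset.mem_coe]
      refine ⟨-p, ?_, by ring⟩
      by_contra hp
      exact h (by simp [starFun, a.eq_zero_of_notMem hp])
    · simp only [starFun]
      rw [show x + (k : ℝ) - 2 * p * μ = x - 2 * p * μ + k by ring, a.shift, ← map_mul,
        ← mul_assoc, fourier_mul_fourier _ _ 0 _ _ 0 (by
          simp only [coe_int_mul, coe_two_mul]
          module)]
      simp⟩

theorem Smooth.mul_apply (a b : Smooth c μ ν) : (a * b).1 = convFun μ ν a.1 b.1 := rfl
theorem Smooth.one_apply : (1 : Smooth c μ ν).1 = oneFun := rfl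
theorem Smooth.star_apply (a : Smooth c μ ν) : (star a).1 = starFun μ ν a.1 := rfl

theorem Smooth.ext_fun {a b : Smooth c μ ν} (h : ∀ x y p, a.1 x y p = b.1 x y p) : a = b :=
  Subtype.ext (funext fun x => funext fun y => funext fun p => h x y p)

theorem Smooth.mul_assoc_aux (a b d : Smooth c μ ν) : a * b * d = a * (b * d) := by
  refine Smooth.ext_fun fun x y p => ?_
  let S : Finset ℤ := (a.supp ×ˢ b.supp).image fun z => z.1 + z.2
  have hS : (a * b).supp ⊆ S := by
    intro s hs
    obtain ⟨x, y, h⟩ : ∃ x y, (a * b).1 x y s ≠ 0 := by simpa [Smooth.supp] using hs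
    rw [Smooth.mul_apply, convFun_eq_sum a b.1 a.supp subset_rfl] at h
    obtain ⟨q, hq, hne⟩ := Finset.exists_ne_zero_of_sum_ne_zero h
    have hb : s - q ∈ b.supp := by
      by_contra hb
      exact hne (by simp [b.eq_zero_of_notMem hb])
    exact Finset.mem_image.2 ⟨(q, s - q), Finset.mem_product.2 ⟨hq, hb⟩, by simp⟩
  rw [Smooth.mul_apply (a * b), Smooth.mul_apply a (b * d), convFun_eq_sum (a * b) d.1 S hS,
    convFun_eq_sum a (b * d).1 a.supp subset_rfl]
  simp only [Smooth.mul_apply, convFun_eq_sum a b.1 a.supp subset_rfl,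
    convFun_eq_sum b d.1 b.supp subset_rfl, Finset.sum_mul, Finset.mul_sum]
  rw [Finset.sum_comm]
  refine Finset.sum_congr rfl fun q hq => ?_
  have h1 : ∑ s ∈ S, a.1 x y q *
        b.1 (x - 2 * q * μ) (y - ((2 * q * ν : ℝ) : UnitAddCircle)) (s - q) *
        d.1 (x - 2 * s * μ) (y - ((2 * s * ν : ℝ) : UnitAddCircle)) (p - s) =
      ∑ s ∈ b.supp.image (fun r => q + r), a.1 x y q *
        b.1 (x - 2 * q * μ) (y - ((2 * q * ν : ℝ) : UnitAddCircle)) (s - q) *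
        d.1 (x - 2 * s * μ) (y - ((2 * s * ν : ℝ) : UnitAddCircle)) (p - s) := by
    symm
    refine Finset.sum_subset ?_ ?_
    · intro s hs
      obtain ⟨r, hr, rfl⟩ := Finset.mem_image.1 hs
      exact Finset.mem_image.2 ⟨(q, r), Finset.mem_product.2 ⟨hq, hr⟩, rfl⟩
    · intro s _ hs
      have hb : s - q ∉ b.supp := fun h =>
        hs (Finset.mem_image.2 ⟨s - q, h, by ring⟩)
      simp [b.eq_zero_of_notMem hb]
  rw [h1, Finset.sum_image (by intro r _ r' _ h; simpa using h)]
  refine Finset.sum_congr rfl fun r _ => ?_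
  rw [show x - 2 * q * μ - 2 * r * μ = x - 2 * ((q + r : ℤ) : ℝ) * μ by push_cast; ring,
    show y - ((2 * q * ν : ℝ) : UnitAddCircle) - ((2 * r * ν : ℝ) : UnitAddCircle) =
      y - ((2 * (q + r : ℤ) * ν : ℝ) : UnitAddCircle) by
        simp only [coe_two_mul]; module,
    show p - q - r = p - (q + r) by ring, show q + r - q = r by ring]
  ring

theorem Smooth.one_mul_aux (a : Smooth c μ ν) : 1 * a = a := by
  refine Smooth.ext_fun fun x y p => ?_
  rw [Smooth.mul_apply, convFun, finsum_eq_single _ (0 : ℤ)]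
  · simp [Smooth.one_apply, oneFun]
  · intro q hq
    simp [Smooth.one_apply, oneFun, hq]

theorem Smooth.mul_one_aux (a : Smooth c μ ν) : a * 1 = a := by
  refine Smooth.ext_fun fun x y p => ?_
  rw [Smooth.mul_apply, convFun, finsum_eq_single _ p]
  · simp [Smooth.one_apply, oneFun]
  · intro q hq
    simp [Smooth.one_apply, oneFun, sub_eq_zero, Ne.symm hq]

theorem Smooth.add_mul_aux (a b d : Smooth c μ ν) : (a + b) * d = a * d + b * d := by
  refine Smooth.ext_fun fun x y p => ?_
  have hs : (a + b).supp ⊆ a.supp ∪ b.supp := by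
    intro s hs
    by_contra h
    obtain ⟨x, y, h'⟩ : ∃ x y, (a + b).1 x y s ≠ 0 := by simpa [Smooth.supp] using hs
    rw [Finset.mem_union, not_or] at h
    exact h' (by simp [a.eq_zero_of_notMem h.1, b.eq_zero_of_notMem h.2])
  change convFun μ ν (a + b).1 d.1 x y p = convFun μ ν a.1 d.1 x y p + convFun μ ν b.1 d.1 x y p
  rw [convFun_eq_sum _ _ _ hs, convFun_eq_sum _ _ _ Finset.subset_union_left,
    convFun_eq_sum b _ _ Finset.subset_union_right, ← Finset.sum_add_distrib]
  exact Finset.sum_congr rfl fun q _ => add_mul _ _ _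

theorem Smooth.mul_add_aux (a b d : Smooth c μ ν) : a * (b + d) = a * b + a * d := by
  refine Smooth.ext_fun fun x y p => ?_
  change convFun μ ν a.1 (b + d).1 x y p = convFun μ ν a.1 b.1 x y p + convFun μ ν a.1 d.1 x y p
  simp only [convFun_eq_sum a _ a.supp subset_rfl, ← Finset.sum_add_distrib]
  exact Finset.sum_congr rfl fun q _ => mul_add _ _ _

instance : Ring (Smooth c μ ν) :=
  { (inferInstance : AddCommGroup (Smooth c μ ν)),
    (inferInstance : Mul (Smooth c μ ν)),
    (inferInstance : One (Smooth c μ ν)) with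
    mul_assoc := Smooth.mul_assoc_aux
    one_mul := Smooth.one_mul_aux
    mul_one := Smooth.mul_one_aux
    left_distrib := Smooth.mul_add_aux
    right_distrib := Smooth.add_mul_aux
    zero_mul := fun a => by
      have h := Smooth.add_mul_aux 0 0 a
      rw [add_zero] at h
      exact left_eq_add.1 h
    mul_zero := fun a => by
      have h := Smooth.mul_add_aux a 0 0
      rw [add_zero] at h
      exact left_eq_add.1 h }

instance : Algebra ℂ (Smooth c μ ν) :=
  Algebra.ofModule
    (fun r a b => by
      refine Smooth.ext_fun fun x y p => ?_
      change convFun μ ν (r • a).1 b.1 x y p = r * convFun μ ν a.1 b.1 x y p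
      have hs : (r • a).supp ⊆ a.supp := by
        intro s hs
        by_contra h
        obtain ⟨x, y, h'⟩ : ∃ x y, (r • a).1 x y s ≠ 0 := by simpa [Smooth.supp] using hs
        exact h' (by simp [a.eq_zero_of_notMem h])
      rw [convFun_eq_sum _ _ _ hs, convFun_eq_sum a _ _ subset_rfl, Finset.mul_sum]
      exact Finset.sum_congr rfl fun q _ => mul_assoc _ _ _)
    (fun r a b => by
      refine Smooth.ext_fun fun x y p => ?_
      change convFun μ ν a.1 (r • b).1 x y p = r * convFun μ ν a.1 b.1 x y p
      rw [convFun_eq_sum a _ _ subset_rfl, convFun_eq_sum a _ _ subset_rfl, Finset.mul_sum]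
      exact Finset.sum_congr rfl fun q _ => mul_left_comm _ _ _)

instance : StarRing (Smooth c μ ν) where
  star_involutive a := by
    refine Smooth.ext_fun fun x y p => ?_
    simp only [Smooth.star_apply, starFun, Complex.conj_conj, neg_neg]
    rw [show x - 2 * p * μ - 2 * ((-p : ℤ) : ℝ) * μ = x by push_cast; ring,
      show y - ((2 * p * ν : ℝ) : UnitAddCircle) - ((2 * (-p : ℤ) * ν : ℝ) : UnitAddCircle) = y by
        simp only [coe_two_mul]; module]
  star_mul a b := by
    refine Smooth.ext_fun fun x y p => ?_
    simp only [Smooth.star_apply, Smooth.mul_apply, starFun]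
    rw [convFun_eq_sum a _ _ subset_rfl, convFun,
      finsum_eq_sum_of_support_subset (s := a.supp.image fun q => q + p), Finset.sum_image
        (by intro r _ r' _ h; simpa using h), map_sum]
    · refine Finset.sum_congr rfl fun q _ => ?_
      simp only [starFun]
      rw [map_mul, mul_comm,
        show x - 2 * ((q + p : ℤ) : ℝ) * μ - 2 * ((p - (q + p) : ℤ) : ℝ) * μ = x - 2 * p * μ by
          push_cast; ring,
        show x - 2 * p * μ - 2 * q * μ = x - 2 * ((q + p : ℤ) : ℝ) * μ by push_cast; ring,
        show y - ((2 * (q + p : ℤ) * ν : ℝ) : UnitAddCircle) -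
            ((2 * (p - (q + p) : ℤ) * ν : ℝ) : UnitAddCircle) =
            y - ((2 * p * ν : ℝ) : UnitAddCircle) by
          simp only [coe_two_mul]; module,
        show y - ((2 * p * ν : ℝ) : UnitAddCircle) - ((2 * q * ν : ℝ) : UnitAddCircle) =
            y - ((2 * (q + p : ℤ) * ν : ℝ) : UnitAddCircle) by
          simp only [coe_two_mul]; module,
        show -(p - (q + p)) = q by ring, show -p - q = -(q + p) by ring]
    · intro r hr
      by_contra h
      have h' : -(p - r) ∉ a.supp := fun h' =>
        h (Finset.mem_coe.2 (Finset.mem_image.2 ⟨-(p - r), h', by ring⟩))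
      exact hr (by simp only [starFun, a.eq_zero_of_notMem h', map_zero, mul_zero])
  star_add a b := by
    refine Smooth.ext_fun fun x y p => ?_
    exact map_add _ _ _

instance : StarModule ℂ (Smooth c μ ν) where
  star_smul r a := by
    refine Smooth.ext_fun fun x y p => ?_
    exact map_mul _ _ _

end algebra

/-! ## The Hilbert space and the representation -/

/-- The spin space `ℂ²`. -/
abbrev Spin : Type := EuclideanSpace ℂ (Fin 2)

/-- The measure on `[0,1] × 𝕋`. -/
def cylMeasure : Measure (ℝ × UnitAddCircle) := (volume.restrict (Set.Icc (0 : ℝ) 1)).prod volume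

/-- The measure on `[0,1] × 𝕋 × ℤ`. -/
def hilbMeasure : Measure (ℝ × UnitAddCircle × ℤ) :=
  (volume.restrict (Set.Icc (0 : ℝ) 1)).prod ((volume : Measure UnitAddCircle).prod Measure.count)

/-- The Hilbert space `L²([0,1] × 𝕋 × ℤ) ⊗ ℂ² = L²([0,1] × 𝕋 × ℤ; ℂ²)`. -/
abbrev Hilb : Type := Lp Spin 2 hilbMeasure

/-- `π̃` is given by
`(π̃(a) ξ)(x, y, p) = ∑_q a(x - 2pμ, y - 2pν, q) ξ(x, y, p - q)` on `L²([0,1] × 𝕋 × ℤ; ℂ²)`. -/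
def IsPiTilde (μ ν : ℝ) {c : ℕ} {μ' ν' : ℝ} (π : Smooth c μ' ν' → (Hilb →L[ℂ] Hilb)) : Prop :=
  ∀ (a : Smooth c μ' ν') (ξ : Hilb), (π a ξ : ℝ × UnitAddCircle × ℤ → Spin) =ᵐ[hilbMeasure]
    fun w => ∑ᶠ q : ℤ,
      a.1 (w.1 - 2 * w.2.2 * μ) (w.2.1 - ((2 * w.2.2 * ν : ℝ) : UnitAddCircle)) q •
        ξ (w.1, w.2.1, w.2.2 - q)

/-! ## The Sobolev space `H¹([0,1] × 𝕋)` and boundary values -/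

section sobolev

/-- Smooth functions on `ℝ × 𝕋`. -/
def IsSmoothFun (φ : ℝ × UnitAddCircle → ℂ) : Prop :=
  ContDiff ℝ ∞ fun z : ℝ × ℝ => φ (z.1, (z.2 : UnitAddCircle))

/-- `∂φ/∂x`. -/
def dx (φ : ℝ × UnitAddCircle → ℂ) (z : ℝ × UnitAddCircle) : ℂ :=
  deriv (fun s : ℝ => φ (s, z.2)) z.1

/-- `∂φ/∂y`. -/
def dy (φ : ℝ × UnitAddCircle → ℂ) (z : ℝ × UnitAddCircle) : ℂ :=
  deriv (fun t : ℝ => φ (z.1, z.2 + (t : UnitAddCircle))) 0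

/-- Test functions: smooth functions supported in `(0,1) × 𝕋`. The support is compact: it is
closed in `ℝ × 𝕋` and contained in the compact set `[0,1] × 𝕋`. -/
def IsTestFun (φ : ℝ × UnitAddCircle → ℂ) : Prop :=
  IsSmoothFun φ ∧ tsupport φ ⊆ Set.Ioo (0 : ℝ) 1 ×ˢ Set.univ

/-- `g ∈ L²` is the weak derivative `∂f/∂x` of `f` on `(0,1) × 𝕋`. -/
def HasWeakDx (f g : ℝ × UnitAddCircle → Spin) : Prop :=
  MemLp g 2 cylMeasure ∧ ∀ φ, IsTestFun φ →
    ∫ z, dx φ z • f z ∂cylMeasure = -∫ z, φ z • g z ∂cylMeasure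

/-- `g ∈ L²` is the weak derivative `∂f/∂y` of `f` on `(0,1) × 𝕋`. -/
def HasWeakDy (f g : ℝ × UnitAddCircle → Spin) : Prop :=
  MemLp g 2 cylMeasure ∧ ∀ φ, IsTestFun φ →
    ∫ z, dy φ z • f z ∂cylMeasure = -∫ z, φ z • g z ∂cylMeasure

/-- `f ∈ H¹([0,1] × 𝕋)`. -/
def MemH1 (f : ℝ × UnitAddCircle → Spin) : Prop :=
  MemLp f 2 cylMeasure ∧ (∃ g, HasWeakDx f g) ∧ ∃ g, HasWeakDy f g

/-- The functions `u₀, u₁ ∈ L²(𝕋)` are the boundary values (traces) of `f ∈ H¹([0,1] × 𝕋)` on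
`{0} × 𝕋` and `{1} × 𝕋`: they are the functions for which the Gauss-Green formula
`∫ (∂φ/∂x) f + φ (∂f/∂x) = ∫ φ(1,y) u₁(y) dy - ∫ φ(0,y) u₀(y) dy`
holds for all `φ` smooth up to the boundary. -/
def HasTraces (f : ℝ × UnitAddCircle → Spin) (u₀ u₁ : UnitAddCircle → Spin) : Prop :=
  MemLp u₀ 2 volume ∧ MemLp u₁ 2 volume ∧ ∃ g, HasWeakDx f g ∧ ∀ φ, IsSmoothFun φ →
    ∫ z, (dx φ z • f z + φ z • g z) ∂cylMeasure =
      ∫ y, φ (1, y) • u₁ y - ∫ y, φ (0, y) • u₀ y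

end sobolev

/-! ## The Dirac operator -/

/-- The function `Φ(·, ·, p)`. -/
def slice (Φ : ℝ × UnitAddCircle × ℤ → Spin) (p : ℤ) : ℝ × UnitAddCircle → Spin :=
  fun z => Φ (z.1, z.2, p)

/-- The domain of the Dirac operator. -/
structure MemDomain (c : ℕ) (μ ν : ℝ) (Φ : Hilb) : Prop where
  /-- `Φ(·, ·, p) ∈ H¹([0,1] × 𝕋)` for all `p`. -/
  sobolev : ∀ p, MemH1 (slice Φ p)
  /-- `Φ(0, y, p) = conj (e(cp(y - pν))) Φ(1, y, p)` in the sense of traces. -/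
  boundary : ∀ p : ℤ, ∃ u₀ u₁, HasTraces (slice Φ p) u₀ u₁ ∧
    ∀ᵐ y, u₀ y =
      (conj (fourier (c * p) (y - ((p * ν : ℝ) : UnitAddCircle))) : ℂ) • u₁ y
  /-- `pΦ` is square integrable. -/
  growth : MemLp (fun w => (w.2.2 : ℂ) • Φ w) 2 hilbMeasure
  /-- `∂Φ/∂x` is square integrable on `[0,1] × 𝕋 × ℤ`. -/
  growth_dx : ∃ G : Hilb, ∀ p, HasWeakDx (slice Φ p) (slice G p)
  /-- `∂/∂y (e(⌊cp²μ⌋y) Φ)` is square integrable on `[0,1] × 𝕋 × ℤ`. -/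
  growth_dy : ∃ G : Hilb, ∀ p : ℤ,
    HasWeakDy (fun z => (fourier ⌊c * (p : ℝ) ^ 2 * μ⌋ z.2 : ℂ) • slice Φ p z) (slice G p)

/-- The Pauli matrices. -/
def sigmaX : Matrix (Fin 2) (Fin 2) ℂ := !![0, 1; 1, 0]
/-- The Pauli matrices. -/
def sigmaY : Matrix (Fin 2) (Fin 2) ℂ := !![0, -Complex.I; Complex.I, 0]
/-- The Pauli matrices. -/
def sigmaZ : Matrix (Fin 2) (Fin 2) ℂ := !![1, 0; 0, -1]

/-- The action of a matrix on `ℂ²`. -/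
def act (σ : Matrix (Fin 2) (Fin 2) ℂ) (v : Spin) : Spin := WithLp.toLp 2 (σ.mulVec v.ofLp)

/-- `δ_X Φ = 2πicp(x - pμ)Φ - ∂Φ/∂y`, where `Φy` stands for `∂Φ/∂y`. -/
def deltaX (c : ℕ) (μ : ℝ) (Φ Φy : ℝ × UnitAddCircle × ℤ → Spin)
    (w : ℝ × UnitAddCircle × ℤ) : Spin :=
  (2 * Real.pi * Complex.I * c * w.2.2 * (w.1 - w.2.2 * μ) : ℂ) • Φ w - Φy w

/-- `δ_Y Φ = -∂Φ/∂x`, where `Φx` stands for `∂Φ/∂x`. -/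
def deltaY (Φx : ℝ × UnitAddCircle × ℤ → Spin) (w : ℝ × UnitAddCircle × ℤ) : Spin := -Φx w

/-- `δ_Z Φ = 2πipΦ`. -/
def deltaZ (Φ : ℝ × UnitAddCircle × ℤ → Spin) (w : ℝ × UnitAddCircle × ℤ) : Spin :=
  (2 * Real.pi * Complex.I * w.2.2 : ℂ) • Φ w

/-- `D` is the Dirac operator `∑_j i δ_j ⊗ σ_j` with domain `MemDomain`. This determines `D`. -/
def IsDirac (c : ℕ) (μ ν : ℝ) (D : Hilb →ₗ.[ℂ] Hilb) : Prop :=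
  (∀ Φ : Hilb, Φ ∈ D.domain ↔ MemDomain c μ ν Φ) ∧
  ∀ (Φ : D.domain) (Φx Φy : ℝ × UnitAddCircle × ℤ → Spin),
    (∀ p, HasWeakDx (slice (Φ : Hilb) p) (slice Φx p)) →
    (∀ p, HasWeakDy (slice (Φ : Hilb) p) (slice Φy p)) →
    (D Φ : ℝ × UnitAddCircle × ℤ → Spin) =ᵐ[hilbMeasure] fun w =>
      Complex.I • (act sigmaX (deltaX c μ (Φ : Hilb) Φy w) + act sigmaY (deltaY Φx w) +
        act sigmaZ (deltaZ (Φ : Hilb) w))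

end QHM

/-! ## Spectral triples -/

section spectral

variable {H : Type*} [NormedAddCommGroup H] [InnerProductSpace ℂ H] [CompleteSpace H]

/-- `R` is the (bounded, everywhere defined) inverse of `D - z`. -/
def IsResolventAt (D : H →ₗ.[ℂ] H) (z : ℂ) (R : H →L[ℂ] H) : Prop :=
  (∀ ξ, ∃ h : R ξ ∈ D.domain, D ⟨R ξ, h⟩ - z • R ξ = ξ) ∧
  ∀ ξ : D.domain, R (D ξ - z • (ξ : H)) = ξ

/-- `(A, H, D)` is an odd spectral triple, where the unital involutive algebra `A` is viewed as an
algebra of operators on `H` through the faithful representation `π`. -/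
structure IsOddSpectralTriple {A : Type*} [Ring A] [StarRing A] [Algebra ℂ A]
    (π : A →⋆ₐ[ℂ] (H →L[ℂ] H)) (D : H →ₗ.[ℂ] H) : Prop where
  faithful : Function.Injective π
  dense : Dense (D.domain : Set H)
  selfAdjoint : IsSelfAdjoint D
  /-- Each `a` preserves the domain of `D`, and `[D, a]` is bounded. -/
  commutator : ∀ a : A, ∃ hdom : ∀ ξ : D.domain, π a ξ ∈ D.domain, ∃ C : ℝ,
    ∀ ξ : D.domain, ‖D ⟨π a ξ, hdom ξ⟩ - π a (D ξ)‖ ≤ C * ‖(ξ : H)‖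
  /-- `(D - z)⁻¹` exists and is compact for `z ∈ ℂ \ ℝ`. -/
  compact_resolvent : ∀ z : ℂ, z.im ≠ 0 →
    ∃ R : H →L[ℂ] H, IsResolventAt D z R ∧ IsCompactOperator R

/-- `PowRel T n x y` means `x ∈ dom Tⁿ` and `Tⁿ x = y`. -/
def PowRel (T : H →ₗ.[ℂ] H) : ℕ → H → H → Prop
  | 0, x, y => y = x
  | n + 1, x, y => ∃ z, PowRel T n x z ∧ (z, y) ∈ T.graph

/-- `P = |D|`: the positive self-adjoint operator with `P² = D²`, domains included. -/
def IsAbsOf (D P : H →ₗ.[ℂ] H) : Prop :=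
  Dense (P.domain : Set H) ∧ IsSelfAdjoint P ∧
  (∀ ξ : P.domain, 0 ≤ (⟪(ξ : H), P ξ⟫_ℂ).re) ∧
  ∀ x y, PowRel P 2 x y ↔ PowRel D 2 x y

/-- `K = |D|⁻ⁿ`: the bounded operator that is zero on `ker D` and inverts `|D|ⁿ` (restricted to the
orthogonal complement of `ker D`) on the range of `|D|ⁿ`. -/
def IsAbsNegPow (D : H →ₗ.[ℂ] H) (n : ℕ) (K : H →L[ℂ] H) : Prop :=
  (∀ k : H, (k, (0 : H)) ∈ D.graph → K k = 0) ∧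
  ∃ P : H →ₗ.[ℂ] H, IsAbsOf D P ∧ ∀ x y, PowRel P n x y →
    (∀ k : H, (k, (0 : H)) ∈ D.graph → ⟪k, x⟫_ℂ = 0) → K y = x

/-- `s 0 ≥ s 1 ≥ ⋯` are the non-zero eigenvalues of the positive compact operator `K`, with
multiplicities and followed by zeros if there are only finitely many of them. -/
def IsEigenvalueSeq (K : H →L[ℂ] H) (s : ℕ → ℝ) : Prop :=
  Antitone s ∧ (∀ m, 0 ≤ s m) ∧ ∃ e : {m : ℕ // 0 < s m} → H, Orthonormal ℂ e ∧
    (∀ m, K (e m) = (s m : ℂ) • e m) ∧ ∀ x, (∀ m, ⟪e m, x⟫_ℂ = 0) → K x = 0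

/-- A spectral triple with Dirac operator `D` has dimension `n > 0`: the operator `|D|⁻ⁿ` is compact
and its eigenvalues satisfy `μ_m ≤ C / m` for `m = 1, 2, …`. -/
def HasSpectralDimension (D : H →ₗ.[ℂ] H) (n : ℕ) : Prop :=
  0 < n ∧ ∃ K : H →L[ℂ] H, IsAbsNegPow D n K ∧ IsCompactOperator K ∧
    ∃ s, IsEigenvalueSeq K s ∧ ∃ C : ℝ, ∀ m : ℕ, s m ≤ C / (m + 1)

/-- The positive operator `K` lies in `𝓛^(1,∞)`: it is compact and the sum of its `N` largest
eigenvalues is `O(log N)`. -/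
def MemL1Infty (K : H →L[ℂ] H) : Prop :=
  IsCompactOperator K ∧ ∃ s, IsEigenvalueSeq K s ∧ ∃ C : ℝ, ∀ N : ℕ, 2 ≤ N →
    ∑ m ∈ Finset.range N, s m ≤ C * Real.log N

end spectral

end

/-!
The idea of the proof is to diagonalize the Dirac operator. For `p ≠ 0` the boundary condition makes
the slice of `p` the space of sections of a line bundle of degree `cp` over the torus, on which
`M = 2πcp(x - pμ) + i ∂/∂y` and `∂/∂x` satisfy the commutation relation of a Landau Hamiltonian:
with `ε` the sign of `p`, the operators `εM + ∂/∂x` and `εM - ∂/∂x` are the annihilation and creation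
operators of a harmonic oscillator of frequency `κ = 2πc|p|`. The theta functions
`∑_l conj (e(cp²νl)) h(x - l - θ) e((j + cpl)y)`, whose profiles `h` are the Hermite functions of that
frequency, are an orthonormal basis on which these operators act as ladders, with `c|p|` functions in
each level; for `p = 0` the characters of the torus play this role (`Mode.basis`). In this basis the
operator `D = -(σ_X M + i σ_Y ∂/∂x + 2π σ_Z p)` splits into Hermitian blocks of size two with
eigenvalues `±λ`, where `λ² = 4π²p² + 4πc|p|k` for levels `k`, and `λ² = 4π²(n² + m²)` for `p = 0`.

An operator with such blocks on its maximal domain is self-adjoint; since `D²` and `|D|` are diagonal,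
`(D - z)⁻¹ = (D + z)(D² - z²)⁻¹` and `|D|⁻³` are explicit, and they are compact because `λ` tends to
infinity (`BlockData`). At most `O(R³)` modes have `λ ≤ R` (`card_lam_le`), so the `m`-th eigenvalue
of `|D|⁻³` is `O(1 / m)`, and the partial sums are `O(log N)`.

It remains to see that the maximal domain is the one described by Sobolev spaces and traces
(`memDomain_iff`). A function in `H¹` with the twisted periodicity is one whose weak derivative can be
tested against all smooth functions with the dual periodicity, not only those of compact support
(`WeakQP`). The truncated theta functions are smooth but not periodic; in the limit their boundary
terms telescope, which turns weak derivatives into relations between coefficients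
(`WeakDom.coefDom`). Conversely, Parseval's identity and the adjointness of annihilation and creation
turn these relations into weak derivatives (`CoefDom.weakDom`).

Finally, `π̃(a)` is a finite sum of multiplication operators composed with shifts in `p`. The
commutators of `M`, `∂/∂x` and `p` with `π̃(a)` are `π̃` of derivations of `a`, which are again
elements of the algebra, so `[D, π̃(a)]` is bounded (`WeakDom.piOp`). Faithfulness holds since an
element with `π̃(a) = 0` vanishes almost everywhere on a fundamental domain, hence everywhere by
continuity and quasi-periodicity.
-/

noncomputable section

/-! ### Operators that are block diagonal in a Hilbert basis -/

namespace QHM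

open Filter Topology

/-- The matrix of a formally self-adjoint operator `b i ↦ α i • b i + conj (β i) • b (τ i)` whose
blocks are spanned by `b i` and `b (τ i)`; the conditions on `α` make its square the diagonal
matrix with entries `α i ^ 2 + ‖β i‖ ^ 2`. -/
structure BlockData (I : Type*) where
  /-- The diagonal entries. -/
  α : I → ℝ
  /-- The off-diagonal entries. -/
  β : I → ℂ
  /-- The involution that pairs the indices of a block. -/
  τ : I → I
  invol : ∀ i, τ (τ i) = i
  herm : ∀ i, β (τ i) = conj (β i)
  cancel : ∀ i, (α i + α (τ i)) * β i = 0
  sq_eq : ∀ i, α (τ i) ^ 2 = α i ^ 2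

namespace BlockData

variable {I : Type*} (B : BlockData I)

/-- The absolute value of the two eigenvalues of the block of `i`. -/
def lam (i : I) : ℝ := √(B.α i ^ 2 + ‖B.β i‖ ^ 2)

theorem lam_nonneg (i : I) : 0 ≤ B.lam i := Real.sqrt_nonneg _

theorem lam_sq (i : I) : B.lam i ^ 2 = B.α i ^ 2 + ‖B.β i‖ ^ 2 := Real.sq_sqrt (by positivity)

theorem norm_β_τ (i : I) : ‖B.β (B.τ i)‖ = ‖B.β i‖ := by rw [B.herm]; simp

theorem lam_τ (i : I) : B.lam (B.τ i) = B.lam i := by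
  rw [lam, lam, B.sq_eq, B.norm_β_τ]

theorem abs_α_le (i : I) : |B.α i| ≤ B.lam i :=
  Real.abs_le_sqrt (by nlinarith [sq_nonneg ‖B.β i‖])

theorem norm_β_le (i : I) : ‖B.β i‖ ≤ B.lam i :=
  Real.le_sqrt_of_sq_le (by nlinarith [sq_nonneg (B.α i)])

theorem β_mul_β_τ (i : I) : B.β i * B.β (B.τ i) = (‖B.β i‖ : ℂ) ^ 2 := by
  rw [B.herm, Complex.mul_conj']

theorem lam_sq_complex (i : I) : ((B.lam i : ℂ)) ^ 2 = (B.α i : ℂ) ^ 2 + (‖B.β i‖ : ℂ) ^ 2 := by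
  exact_mod_cast B.lam_sq i

/-- The action of the matrix on sequences of coefficients. -/
def seq (f : I → ℂ) (i : I) : ℂ := B.α i * f i + B.β i * f (B.τ i)

theorem seq_seq (f : I → ℂ) (i : I) : B.seq (B.seq f) i = (B.lam i : ℂ) ^ 2 * f i := by
  have h1 := B.cancel i
  have h1 : ((B.α i : ℂ) + B.α (B.τ i)) * B.β i = 0 := by exact_mod_cast h1
  have h2 := B.β_mul_β_τ i
  rw [B.lam_sq_complex]
  simp only [seq, B.invol]
  linear_combination (f (B.τ i)) * h1 + f i * h2

/-- The diagonal matrix with entries `lam i`. -/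
def abs : BlockData I where
  α := B.lam
  β := 0
  τ := id
  invol _ := rfl
  herm _ := by simp
  cancel _ := by simp
  sq_eq _ := rfl

theorem abs_seq (f : I → ℂ) (i : I) : B.abs.seq f i = B.lam i * f i := by
  simp [abs, seq]

theorem abs_lam (i : I) : B.abs.lam i = B.lam i := by
  simp [abs, lam, add_nonneg, sq_nonneg]

variable {H : Type*} [NormedAddCommGroup H] [InnerProductSpace ℂ H] (b : HilbertBasis I ℂ H)

theorem ext_coef {x y : H} (h : ∀ i, ⟪b i, x⟫_ℂ = ⟪b i, y⟫_ℂ) : x = y :=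
  b.repr.injective (Subtype.ext (funext fun i => by
    simpa [HilbertBasis.repr_apply_apply] using h i))

theorem memℓp_coef (x : H) : Memℓp (fun i => ⟪b i, x⟫_ℂ) 2 := by
  rw [show (fun i => ⟪b i, x⟫_ℂ) = b.repr x from funext fun i => (b.repr_apply_apply x i).symm]
  exact lp.memℓp (b.repr x)

theorem exists_coef {f : I → ℂ} (hf : Memℓp f 2) : ∃ x : H, ∀ i, ⟪b i, x⟫_ℂ = f i :=
  ⟨b.repr.symm ⟨f, hf⟩, fun i => by rw [← b.repr_apply_apply]; simp⟩

theorem norm_sq_eq_tsum (x : H) : HasSum (fun i => ‖⟪b i, x⟫_ℂ‖ ^ 2) (‖x‖ ^ 2) := by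
  have h := lp.hasSum_norm (p := 2) (by norm_num) (b.repr x)
  simpa [HilbertBasis.repr_apply_apply] using h

/-- The graph of the operator with matrix `B` in the basis `b`. -/
def graph : Submodule ℂ (H × H) where
  carrier := {z | ∀ i, ⟪b i, z.2⟫_ℂ = B.seq (fun i => ⟪b i, z.1⟫_ℂ) i}
  add_mem' := by
    intro z w hz hw i
    simp only [Prod.snd_add, Prod.fst_add, inner_add_right, hz i, hw i, seq]
    ring
  zero_mem' := by intro i; simp [seq]
  smul_mem' := by
    intro r z hz i
    simp only [Prod.smul_snd, Prod.smul_fst, inner_smul_right, hz i, seq]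
    ring

theorem mem_graph {x y : H} :
    (x, y) ∈ B.graph b ↔ ∀ i, ⟪b i, y⟫_ℂ = B.seq (fun i => ⟪b i, x⟫_ℂ) i := Iff.rfl

/-- The self-adjoint operator with matrix `B` in the basis `b`, on its maximal domain. -/
def op : H →ₗ.[ℂ] H := (B.graph b).toLinearPMap

theorem op_graph : (B.op b).graph = B.graph b := by
  refine Submodule.toLinearPMap_graph_eq _ ?_
  rintro ⟨x, y⟩ h (rfl : x = 0)
  exact ext_coef b fun i => by rw [(B.mem_graph b).1 h i]; simp [seq]

theorem mem_op_graph {x y : H} :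
    (x, y) ∈ (B.op b).graph ↔ ∀ i, ⟪b i, y⟫_ℂ = B.seq (fun i => ⟪b i, x⟫_ℂ) i := by
  rw [op_graph]; rfl

theorem coef_op (x : (B.op b).domain) (i : I) :
    ⟪b i, B.op b x⟫_ℂ = B.seq (fun i => ⟪b i, (x : H)⟫_ℂ) i :=
  (B.mem_op_graph b).1 ((B.op b).mem_graph x) i

theorem mem_op_domain {x : H} :
    x ∈ (B.op b).domain ↔ ∃ y : H, ∀ i, ⟪b i, y⟫_ℂ = B.seq (fun i => ⟪b i, x⟫_ℂ) i := by
  rw [LinearPMap.mem_domain_iff]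
  exact exists_congr fun y => B.mem_op_graph b

theorem inner_basis [DecidableEq I] (i j : I) : ⟪b i, b j⟫_ℂ = if i = j then 1 else 0 :=
  orthonormal_iff_ite.1 b.orthonormal i j

theorem τ_injective : Function.Injective B.τ := fun i j h => by
  rw [← B.invol i, h, B.invol]

theorem basis_mem_graph (i : I) :
    (b i, (B.α i : ℂ) • b i + conj (B.β i) • b (B.τ i)) ∈ (B.op b).graph := by
  classical
  rw [mem_op_graph]
  intro j
  simp only [seq, inner_add_right, inner_smul_right, inner_basis]
  by_cases h1 : j = i
  · subst h1
    by_cases h2 : j = B.τ j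
    · simp [← h2, show conj (B.β j) = B.β j by rw [← B.herm, ← h2]]
    · simp [h2, Ne.symm h2]
  · by_cases h2 : j = B.τ i
    · subst h2
      simp [B.invol, h1, B.herm]
    · have : B.τ j ≠ i := fun h => h2 (by rw [← h, B.invol])
      simp [h1, h2, this]

theorem basis_mem_domain (i : I) : b i ∈ (B.op b).domain :=
  (LinearPMap.mem_domain_iff).2 ⟨_, B.basis_mem_graph b i⟩

theorem op_dense : Dense ((B.op b).domain : Set H) := by
  have h : Submodule.span ℂ (Set.range b) ≤ (B.op b).domain := by
    rw [Submodule.span_le]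
    rintro _ ⟨i, rfl⟩
    exact B.basis_mem_domain b i
  have h2 : Dense ((Submodule.span ℂ (Set.range b) : Submodule ℂ H) : Set H) :=
    Submodule.dense_iff_topologicalClosure_eq_top.2 b.dense_span
  exact h2.mono h

theorem hasSum_inner (x y : H) :
    HasSum (fun i => conj ⟪b i, x⟫_ℂ * ⟪b i, y⟫_ℂ) ⟪x, y⟫_ℂ := by
  simpa using b.hasSum_inner_mul_inner x y

theorem lam_mul_norm_coef_le {x y : H} (h : (x, y) ∈ (B.op b).graph) (i : I) :
    B.lam i * ‖⟪b i, x⟫_ℂ‖ ≤ ‖⟪b i, y⟫_ℂ‖ + ‖⟪b (B.τ i), y⟫_ℂ‖ := by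
  rw [mem_op_graph] at h
  rcases (B.lam_nonneg i).eq_or_lt with h0 | h0
  · rw [← h0, zero_mul]; positivity
  refine le_of_mul_le_mul_left ?_ h0
  have key := B.seq_seq (fun i => ⟪b i, x⟫_ℂ) i
  rw [show B.seq (fun i => ⟪b i, x⟫_ℂ) = fun i => ⟪b i, y⟫_ℂ from
    funext fun i => (h i).symm] at key
  have hh : B.lam i * (B.lam i * ‖⟪b i, x⟫_ℂ‖) = ‖B.seq (fun i => ⟪b i, y⟫_ℂ) i‖ := by
    rw [key, norm_mul, norm_pow, Complex.norm_real, Real.norm_eq_abs, abs_of_pos h0]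
    ring
  rw [hh]
  refine (norm_add_le _ _).trans ?_
  rw [norm_mul, norm_mul, Complex.norm_real, Real.norm_eq_abs, mul_add]
  gcongr
  · exact B.abs_α_le i
  · exact B.norm_β_le i

theorem memℓp_of_norm_le {f : I → ℂ} (y : H)
    (h : ∀ i, ‖f i‖ ≤ ‖⟪b i, y⟫_ℂ‖ + ‖⟪b (B.τ i), y⟫_ℂ‖) : Memℓp f 2 := by
  have hs := ((memℓp_coef b y).summable (by norm_num))
  have hs2 := hs.comp_injective B.τ_injective
  refine memℓp_gen (Summable.of_nonneg_of_le (fun i => by positivity) (fun i => ?_)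
    ((hs.add hs2).mul_left 2))
  simp only [ENNReal.toReal_ofNat, Real.rpow_ofNat, Function.comp_apply]
  nlinarith [sq_nonneg (‖⟪b i, y⟫_ℂ‖ - ‖⟪b (B.τ i), y⟫_ℂ‖), norm_nonneg (f i), h i]

theorem memℓp_lam_mul {x y : H} (h : (x, y) ∈ (B.op b).graph) :
    Memℓp (fun i => (B.lam i : ℂ) * ⟪b i, x⟫_ℂ) 2 :=
  B.memℓp_of_norm_le b y fun i => by
    rw [norm_mul, Complex.norm_real, Real.norm_eq_abs, abs_of_nonneg (B.lam_nonneg i)]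
    exact B.lam_mul_norm_coef_le b h i

theorem op_symmetric {x x' y y' : H} (hx : (x, x') ∈ (B.op b).graph)
    (hy : (y, y') ∈ (B.op b).graph) : ⟪x', y⟫_ℂ = ⟪x, y'⟫_ℂ := by
  have hb : Memℓp (fun i => B.β i * ⟪b (B.τ i), y⟫_ℂ) 2 := by
    refine B.memℓp_of_norm_le b y' fun i => ?_
    have h := B.lam_mul_norm_coef_le b hy (B.τ i)
    rw [B.invol, B.lam_τ, add_comm] at h
    rw [norm_mul]
    exact (mul_le_mul_of_nonneg_right (B.norm_β_le i) (norm_nonneg _)).trans h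
  rw [mem_op_graph] at hx hy
  have e : ∀ i, conj ⟪b i, x⟫_ℂ * ⟪b i, y'⟫_ℂ - conj ⟪b i, x'⟫_ℂ * ⟪b i, y⟫_ℂ =
      conj ⟪b i, x⟫_ℂ * (B.β i * ⟪b (B.τ i), y⟫_ℂ) -
      conj ⟪b (B.τ i), x⟫_ℂ * (B.β (B.τ i) * ⟪b i, y⟫_ℂ) := by
    intro i
    rw [hx, hy, B.herm]
    simp only [seq, map_add, map_mul, Complex.conj_ofReal]
    ring
  -- The two sums of off-diagonal terms are exchanged by the involution.
  have h1 : Summable fun i => conj ⟪b i, x⟫_ℂ * (B.β i * ⟪b (B.τ i), y⟫_ℂ) := by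
    obtain ⟨w, hw⟩ := exists_coef b hb
    have := (hasSum_inner b x w).summable
    simpa only [hw] using this
  have h2 := (Equiv.ofBijective B.τ (Function.Involutive.bijective B.invol)).hasSum_iff.2 h1.hasSum
  have h3 := h1.hasSum.sub h2
  have h4 := (hasSum_inner b x y').sub (hasSum_inner b x' y)
  simp only [e] at h4
  have h5 := h4.unique (by simpa [Function.comp_def, B.invol] using h3)
  exact (sub_eq_zero.1 h5).symm

theorem op_isSelfAdjoint [CompleteSpace H] : IsSelfAdjoint (B.op b) := by
  rw [LinearPMap.isSelfAdjoint_def]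
  refine LinearPMap.eq_of_eq_graph ?_
  rw [LinearPMap.adjoint_graph_eq_graph_adjoint (B.op_dense b)]
  ext ⟨x, y⟩
  rw [Submodule.mem_adjoint_iff]
  constructor
  · intro h
    rw [mem_op_graph]
    intro i
    have := h _ _ (B.basis_mem_graph b i)
    simp only [inner_add_left, inner_smul_left, Complex.conj_ofReal, Complex.conj_conj] at this
    rw [seq, ← sub_eq_zero.1 this]
  · intro h u v huv
    rw [B.op_symmetric b huv h, sub_self]

theorem powRel_one {T : H →ₗ.[ℂ] H} {x y : H} : PowRel T 1 x y ↔ (x, y) ∈ T.graph := by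
  simp [PowRel]

theorem powRel_two_op {x y : H} :
    PowRel (B.op b) 2 x y ↔ ∀ i, ⟪b i, y⟫_ℂ = (B.lam i : ℂ) ^ 2 * ⟪b i, x⟫_ℂ := by
  constructor
  · rintro ⟨z, hz, hy⟩ i
    rw [powRel_one, mem_op_graph] at hz
    rw [mem_op_graph] at hy
    rw [hy i, ← B.seq_seq (fun i => ⟪b i, x⟫_ℂ),
      show B.seq (fun i => ⟪b i, x⟫_ℂ) = fun i => ⟪b i, z⟫_ℂ from funext fun i => (hz i).symm]
  · intro h
    have hm : Memℓp (B.seq fun i => ⟪b i, x⟫_ℂ) 2 := by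
      have hx := ((memℓp_coef b x).summable (by norm_num))
      have hy := ((memℓp_coef b y).summable (by norm_num))
      have hs := hx.add hy
      have hs2 := hs.comp_injective B.τ_injective
      refine memℓp_gen (Summable.of_nonneg_of_le (fun i => by positivity) (fun i => ?_)
        ((hs.add hs2).mul_left 4))
      simp only [ENNReal.toReal_ofNat, Real.rpow_ofNat, Function.comp_apply, h, norm_mul, norm_pow,
        Complex.norm_real, Real.norm_eq_abs, B.lam_τ, abs_of_nonneg (B.lam_nonneg _)]
      have h1 : ‖B.seq (fun i => ⟪b i, x⟫_ℂ) i‖ ≤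
          B.lam i * (‖⟪b i, x⟫_ℂ‖ + ‖⟪b (B.τ i), x⟫_ℂ‖) := by
        refine (norm_add_le _ _).trans ?_
        rw [norm_mul, norm_mul, Complex.norm_real, Real.norm_eq_abs]
        have := B.abs_α_le i
        have := B.norm_β_le i
        nlinarith [norm_nonneg ⟪b i, x⟫_ℂ, norm_nonneg ⟪b (B.τ i), x⟫_ℂ]
      have h2 := pow_le_pow_left₀ (norm_nonneg _) h1 2
      refine h2.trans ?_
      have h3 : B.lam i ^ 2 ≤ 1 + (B.lam i ^ 2) ^ 2 := by
        nlinarith [sq_nonneg (B.lam i ^ 2 - 1), sq_nonneg (B.lam i)]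
      have h4 := sq_nonneg (‖⟪b i, x⟫_ℂ‖ - ‖⟪b (B.τ i), x⟫_ℂ‖)
      have h5 : (‖⟪b i, x⟫_ℂ‖ + ‖⟪b (B.τ i), x⟫_ℂ‖) ^ 2 ≤
        4 * (‖⟪b i, x⟫_ℂ‖ ^ 2 + ‖⟪b (B.τ i), x⟫_ℂ‖ ^ 2) := by
        nlinarith [sq_nonneg (‖⟪b i, x⟫_ℂ‖ + ‖⟪b (B.τ i), x⟫_ℂ‖)]
      rw [mul_pow]
      calc _ ≤ (1 + (B.lam i ^ 2) ^ 2) * (4 * (‖⟪b i, x⟫_ℂ‖ ^ 2 + ‖⟪b (B.τ i), x⟫_ℂ‖ ^ 2)) := by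
            gcongr
        _ = _ := by ring
    obtain ⟨z, hz⟩ := exists_coef b hm
    refine ⟨z, powRel_one.2 ((B.mem_op_graph b).2 hz), (B.mem_op_graph b).2 fun i => ?_⟩
    rw [h, ← B.seq_seq (fun i => ⟪b i, x⟫_ℂ),
      show B.seq (fun i => ⟪b i, x⟫_ℂ) = fun i => ⟪b i, z⟫_ℂ from funext fun i => (hz i).symm]

theorem isAbsOf [CompleteSpace H] : IsAbsOf (B.op b) (B.abs.op b) := by
  refine ⟨B.abs.op_dense b, B.abs.op_isSelfAdjoint b, fun ξ => ?_, fun x y => ?_⟩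
  · have h := (hasSum_inner b (ξ : H) (B.abs.op b ξ))
    refine (Complex.hasSum_re h).nonneg fun i => ?_
    rw [coef_op, abs_seq]
    have : conj ⟪b i, (ξ : H)⟫_ℂ * ((B.lam i : ℂ) * ⟪b i, (ξ : H)⟫_ℂ) =
        ((B.lam i * ‖⟪b i, (ξ : H)⟫_ℂ‖ ^ 2 : ℝ) : ℂ) := by
      push_cast
      rw [← Complex.conj_mul']
      ring
    rw [this, Complex.ofReal_re]
    have := B.lam_nonneg i
    positivity
  · rw [powRel_two_op, powRel_two_op]
    simp only [abs_lam]

/-- Diagonal operators with entries tending to zero exist and are compact. -/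
theorem exists_diag [CompleteSpace H] {u : I → ℂ} (hu : Tendsto u cofinite (𝓝 0)) :
    ∃ T : H →L[ℂ] H, IsCompactOperator T ∧ ∀ x i, ⟪b i, T x⟫_ℂ = u i * ⟪b i, x⟫_ℂ := by
  classical
  have key : ∀ v : I → ℂ, ∀ C : ℝ, 0 ≤ C → (∀ i, ‖v i‖ ≤ C) →
      ∃ T : H →L[ℂ] H, ‖T‖ ≤ C ∧ ∀ x i, ⟪b i, T x⟫_ℂ = v i * ⟪b i, x⟫_ℂ := by
    intro v C hC hv
    have hle : ∀ (x : H) i, ‖v i * ⟪b i, x⟫_ℂ‖ ≤ C * ‖⟪b i, x⟫_ℂ‖ := fun x i => by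
      rw [norm_mul]; exact mul_le_mul_of_nonneg_right (hv i) (norm_nonneg _)
    have hm : ∀ x : H, Memℓp (fun i => v i * ⟪b i, x⟫_ℂ) 2 := by
      intro x
      refine memℓp_gen (Summable.of_nonneg_of_le (fun i => by positivity) (fun i => ?_)
        (((memℓp_coef b x).summable (by norm_num)).mul_left (C ^ 2)))
      simp only [ENNReal.toReal_ofNat, Real.rpow_ofNat]
      rw [← mul_pow]
      exact pow_le_pow_left₀ (norm_nonneg _) (hle x i) 2
    choose T hT using fun x => exists_coef b (hm x)
    refine ⟨LinearMap.mkContinuous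
      { toFun := T
        map_add' := fun x y => ext_coef b fun i => by
          simp only [inner_add_right, hT, mul_add]
        map_smul' := fun r x => ext_coef b fun i => by
          simp only [inner_smul_right, hT, RingHom.id_apply]; ring } C fun x => ?_, ?_, hT⟩
    · refine le_of_sq_le_sq ?_ (by positivity)
      rw [mul_pow]
      refine hasSum_le (fun i => ?_) (norm_sq_eq_tsum b _) ((norm_sq_eq_tsum b x).mul_left (C ^ 2))
      simp only [LinearMap.coe_mk, AddHom.coe_mk]
      rw [hT, ← mul_pow]
      exact pow_le_pow_left₀ (norm_nonneg _) (hle x i) 2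
    · exact LinearMap.mkContinuous_norm_le _ hC _
  have hfin : ∀ ε > 0, {i | ε ≤ ‖u i‖}.Finite := by
    intro ε hε
    have := hu.norm.eventually (gt_mem_nhds (show ‖(0 : ℂ)‖ < ε by simpa using hε))
    simpa [Filter.eventually_cofinite] using this
  obtain ⟨C, hC0, hC⟩ : ∃ C : ℝ, 0 ≤ C ∧ ∀ i, ‖u i‖ ≤ C := by
    obtain ⟨M, hM⟩ := ((hfin 1 one_pos).image fun i => ‖u i‖).bddAbove
    refine ⟨max M 1, by positivity, fun i => ?_⟩
    by_cases h : 1 ≤ ‖u i‖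
    · exact (hM ⟨i, h, rfl⟩).trans (le_max_left _ _)
    · exact (not_le.1 h).le.trans (le_max_right _ _)
  obtain ⟨T, -, hT⟩ := key u C hC0 hC
  refine ⟨T, ?_, hT⟩
  -- `T` is the norm limit of its finite truncations.
  let F : ℕ → H →L[ℂ] H := fun n =>
    ∑ i ∈ (hfin (1 / (n + 1 : ℝ)) (by positivity)).toFinset, u i • (innerSL ℂ (b i)).smulRight (b i)
  have hF : ∀ n x i, ⟪b i, F n x⟫_ℂ =
      if i ∈ (hfin (1 / (n + 1 : ℝ)) (by positivity)).toFinset then u i * ⟪b i, x⟫_ℂ else 0 := by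
    intro n x i
    simp only [F, sum_apply, inner_sum, smul_apply,
      ContinuousLinearMap.smulRight_apply, inner_smul_right, inner_basis, innerSL_apply_apply,
      mul_ite, mul_one, mul_zero, Finset.sum_ite_eq]
  refine isCompactOperator_of_tendsto (l := atTop) (F := F) ?_ (Eventually.of_forall fun n => ?_)
  · rw [tendsto_iff_norm_sub_tendsto_zero]
    refine squeeze_zero (fun n => norm_nonneg _) (fun n => ?_)
      (tendsto_one_div_add_atTop_nhds_zero_nat)
    obtain ⟨S, hS1, hS2⟩ := key
      (fun i => if i ∈ (hfin (1 / (n + 1 : ℝ)) (by positivity)).toFinset then 0 else - u i)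
      (1 / (n + 1 : ℝ)) (by positivity) (fun i => by
        split_ifs with h
        · simp only [norm_zero]; positivity
        · rw [norm_neg]; simp at h; simpa using h.le)
    have : F n - T = S := by
      ext x
      refine ext_coef b fun i => ?_
      rw [sub_apply, inner_sub_right, hF, hT, hS2]
      split_ifs <;> ring
    rw [this]
    exact hS1
  · simp only [F]
    have hcomp : ∀ s : Finset I, IsCompactOperator
        (∑ i ∈ s, u i • (innerSL ℂ (b i)).smulRight (b i) : H →L[ℂ] H) := by
      intro s
      induction s using Finset.induction_on with
      | empty => simpa using isCompactOperator_zero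
      | insert i s hi ih =>
        rw [Finset.sum_insert hi]
        refine IsCompactOperator.add ?_ ih
        have h1 : IsCompactOperator (innerSL ℂ (b i) : H →L[ℂ] ℂ) :=
          (isCompactOperator_of_locallyCompactSpace_dom
            (ContinuousLinearMap.id ℂ ℂ : ℂ →L[ℂ] ℂ)).comp_clm (innerSL ℂ (b i))
        have h2 := h1.clm_comp ((u i) • (ContinuousLinearMap.toSpanSingleton ℂ (b i)))
        convert h2 using 1
        ext x
        simp [smul_smul]
    exact hcomp _

theorem exists_perm [CompleteSpace H] :
    ∃ S : H →L[ℂ] H, ∀ x i, ⟪b i, S x⟫_ℂ = ⟪b (B.τ i), x⟫_ℂ := by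
  let b' : HilbertBasis I ℂ H := HilbertBasis.mk (v := fun i => b (B.τ i))
    (b.orthonormal.comp B.τ B.τ_injective) (by
      rw [show (Set.range fun i => b (B.τ i)) = Set.range b from
        (Function.Involutive.surjective B.invol).range_comp b]
      exact b.dense_span.ge)
  refine ⟨((b'.repr.trans b.repr.symm).toContinuousLinearEquiv : H →L[ℂ] H), fun x i => ?_⟩
  rw [← b.repr_apply_apply]
  simp [b', HilbertBasis.repr_apply_apply, HilbertBasis.coe_mk]

theorem sq_sub_ne_zero {z : ℂ} (hz : z.im ≠ 0) (t : ℝ) : (t : ℂ) ^ 2 - z ^ 2 ≠ 0 := by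
  intro h
  have h' : ((t : ℂ) - z) * (t + z) = 0 := by linear_combination h
  rcases mul_eq_zero.1 h' with h1 | h1
  · exact hz (by simpa using congrArg Complex.im h1)
  · exact hz (by simpa using congrArg Complex.im h1)

/-- `(D - z)⁻¹ = (D + z)(D² - z²)⁻¹`, and `D²` is diagonal with entries tending to infinity. -/
theorem exists_resolvent [CompleteSpace H] (hlam : Tendsto B.lam cofinite atTop) {z : ℂ}
    (hz : z.im ≠ 0) : ∃ R : H →L[ℂ] H, IsResolventAt (B.op b) z R ∧ IsCompactOperator R := by
  have hbound : ∀ w : I → ℂ, (∀ i, ‖w i‖ ≤ B.lam i + ‖z‖) →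
      Tendsto (fun i => w i / ((B.lam i : ℂ) ^ 2 - z ^ 2)) cofinite (𝓝 0) := by
    intro w hw
    have h0 : Tendsto (fun i => (B.lam i - ‖z‖)⁻¹) cofinite (𝓝 0) :=
      tendsto_inv_atTop_zero.comp (tendsto_atTop_add_const_right _ _ hlam)
    refine squeeze_zero_norm' ?_ h0
    filter_upwards [hlam.eventually_gt_atTop ‖z‖] with i hi
    rw [norm_div]
    have h1 : (B.lam i - ‖z‖) * (B.lam i + ‖z‖) ≤ ‖(B.lam i : ℂ) ^ 2 - z ^ 2‖ := by
      have := norm_sub_norm_le ((B.lam i : ℂ) ^ 2) (z ^ 2)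
      rw [norm_pow, norm_pow, Complex.norm_real, Real.norm_eq_abs, sq_abs] at this
      linarith
    have h2 : 0 < B.lam i - ‖z‖ := by linarith
    have h3 : 0 < B.lam i + ‖z‖ := by linarith [norm_nonneg z]
    rw [div_le_iff₀ (by nlinarith), inv_mul_eq_div, le_div_iff₀ h2]
    nlinarith [hw i]
  obtain ⟨S, hS⟩ := B.exists_perm b
  obtain ⟨T₁, hc₁, hT₁⟩ := exists_diag b (hbound (fun i => B.α i + z) (fun i => by
    refine (norm_add_le _ _).trans (add_le_add_left ?_ _)
    rw [Complex.norm_real]; exact B.abs_α_le i))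
  obtain ⟨T₂, hc₂, hT₂⟩ := exists_diag b (hbound B.β (fun i => by
    have := B.norm_β_le i
    linarith [norm_nonneg z]))
  have hR : ∀ x i, ⟪b i, (T₁ + T₂.comp S) x⟫_ℂ =
      ((B.α i + z) * ⟪b i, x⟫_ℂ + B.β i * ⟪b (B.τ i), x⟫_ℂ) / ((B.lam i : ℂ) ^ 2 - z ^ 2) := by
    intro x i
    rw [add_apply, inner_add_right, hT₁, ContinuousLinearMap.comp_apply, hT₂,
      hS]
    ring
  refine ⟨T₁ + T₂.comp S, ⟨fun ξ => ?_, fun ξ => ?_⟩, hc₁.add (hc₂.comp_clm S)⟩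
  · have hmem : ((T₁ + T₂.comp S) ξ, ξ + z • (T₁ + T₂.comp S) ξ) ∈ (B.op b).graph := by
      rw [mem_op_graph]
      intro i
      have hne := sq_sub_ne_zero hz (B.lam i)
      simp only [inner_add_right, inner_smul_right, hR, seq, B.lam_τ, B.invol]
      have h1 : ((B.α i : ℂ) + B.α (B.τ i)) * B.β i = 0 := by exact_mod_cast B.cancel i
      have h2 := B.β_mul_β_τ i
      have h3 := B.lam_sq_complex i
      field_simp
      linear_combination (-⟪b (B.τ i), ξ⟫_ℂ) * h1 - ⟪b i, ξ⟫_ℂ * h2 + ⟪b i, ξ⟫_ℂ * h3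
    obtain ⟨h, he⟩ := (LinearPMap.mem_graph_iff' _).1 hmem |>.imp fun y hy => hy
    have he := Prod.ext_iff.1 he
    simp only at he
    have hd : (T₁ + T₂.comp S) ξ ∈ (B.op b).domain := he.1 ▸ h.2
    refine ⟨hd, ?_⟩
    have : h = ⟨_, hd⟩ := Subtype.ext he.1
    rw [← this, he.2]
    abel
  · refine ext_coef b fun i => ?_
    have hne := sq_sub_ne_zero hz (B.lam i)
    rw [hR]
    simp only [inner_sub_right, inner_smul_right, coef_op, seq, B.invol]
    rw [div_eq_iff hne]
    have h1 : ((B.α i : ℂ) + B.α (B.τ i)) * B.β i = 0 := by exact_mod_cast B.cancel i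
    have h2 := B.β_mul_β_τ i
    have h3 := B.lam_sq_complex i
    linear_combination ⟪b (B.τ i), (ξ : H)⟫_ℂ * h1 + ⟪b i, (ξ : H)⟫_ℂ * h2 - ⟪b i, (ξ : H)⟫_ℂ * h3

end BlockData

end QHM

/-! ### Eigenvalue sequences and spectral dimension -/

namespace QHM

open Filter Topology

/-- The positive values of a function that is large only finitely often can be listed in
decreasing order: the number of predecessors of an index, for a linear order that refines the
order of the values, embeds the index set into `ℕ`. -/
theorem exists_antitone_enum {I : Type*} (κ : I → ℝ) (hfin : ∀ t > 0, {i | t ≤ κ i}.Finite)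
    (hinf : {i | 0 < κ i}.Infinite) :
    ∃ σ : ℕ → I, Function.Injective σ ∧ Antitone (κ ∘ σ) ∧ (∀ m, 0 < κ (σ m)) ∧
      ∀ i, 0 < κ i → i ∈ Set.range σ := by
  classical
  let P : I → Set I := fun i => {j | κ i < κ j ∨ (κ j = κ i ∧ WellOrderingRel j i)}
  let J := {i // 0 < κ i}
  have : Infinite J := hinf.to_subtype
  have hP : ∀ i : J, (P i).Finite := fun i => (hfin _ i.2).subset (by
    rintro j (h | h)
    · exact h.le
    · exact h.1.ge)
  let rank : J → ℕ := fun i => (P i).ncard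
  have hlt : ∀ i j : J, (j : I) ∈ P i → rank j < rank i := by
    intro i j hij
    refine Set.ncard_lt_ncard ⟨?_, fun h => ?_⟩ (hP i)
    · rintro k (hk | hk)
      · rcases hij with h | h
        · exact Or.inl (h.trans hk)
        · exact Or.inl (h.1 ▸ hk)
      · rcases hij with h | h
        · exact Or.inl (hk.1 ▸ h)
        · exact Or.inr ⟨hk.1.trans h.1, _root_.trans hk.2 h.2⟩
    · rcases h hij with h | h
      · exact lt_irrefl _ h
      · exact irrefl _ h.2
  have hinj : Function.Injective rank := by
    intro i j h
    by_contra hne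
    rcases lt_trichotomy (κ i) (κ j) with h1 | h1 | h1
    · exact absurd (hlt i j (Or.inl h1)) (by omega)
    · rcases trichotomous_of WellOrderingRel (i : I) (j : I) with h2 | h2 | h2
      · exact absurd (hlt j i (Or.inr ⟨h1, h2⟩)) (by omega)
      · exact hne (Subtype.ext h2)
      · exact absurd (hlt i j (Or.inr ⟨h1.symm, h2⟩)) (by omega)
    · exact absurd (hlt j i (Or.inl h1)) (by omega)
  have : Infinite (Set.range rank) := (Set.infinite_range_of_injective hinj).to_subtype
  let e := Nat.Subtype.orderIsoOfNat (Set.range rank)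
  let f : ℕ → J := fun m => (e m).2.choose
  have hf : ∀ m, rank (f m) = e m := fun m => (e m).2.choose_spec
  refine ⟨fun m => f m, fun m n h => ?_, fun m n hmn => ?_, fun m => (f m).2, fun i hi => ?_⟩
  · have : f m = f n := Subtype.ext h
    exact e.injective (Subtype.ext (by rw [← hf, ← hf, this]))
  · by_contra hlt'
    have h1 := hlt (f m) (f n) (Or.inl (not_le.1 hlt'))
    rw [hf, hf] at h1
    exact absurd (e.monotone hmn) (not_le.2 h1)
  · refine ⟨e.symm ⟨rank ⟨i, hi⟩, ⟨_, rfl⟩⟩, ?_⟩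
    have := hinj (a₁ := f (e.symm ⟨rank ⟨i, hi⟩, ⟨_, rfl⟩⟩)) (a₂ := ⟨i, hi⟩) (by rw [hf]; simp)
    exact congrArg Subtype.val this

namespace BlockData

variable {I : Type*} (B : BlockData I) {H : Type*} [NormedAddCommGroup H] [InnerProductSpace ℂ H]
  [CompleteSpace H] (b : HilbertBasis I ℂ H)

theorem isAbsNegPow {n : ℕ} {K : H →L[ℂ] H} (hn : n ≠ 0)
    (hK : ∀ x i, ⟪b i, K x⟫_ℂ = (((B.lam i ^ n)⁻¹ : ℝ) : ℂ) * ⟪b i, x⟫_ℂ) :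
    IsAbsNegPow (B.op b) n K := by
  refine ⟨fun k hk => ?_, B.abs.op b, B.isAbsOf b, fun x y hxy hx => ?_⟩
  · refine ext_coef b fun i => ?_
    rw [hK, inner_zero_right]
    have h2 : PowRel (B.op b) 2 k 0 :=
      ⟨0, powRel_one.2 hk, (B.op b).graph.zero_mem⟩
    have h3 := (B.powRel_two_op b).1 h2 i
    rw [inner_zero_right] at h3
    rcases mul_eq_zero.1 h3.symm with h | h
    · have : B.lam i = 0 := by simpa using h
      simp [this, hn]
    · rw [h, mul_zero]
  · have hpow : ∀ (n : ℕ) (x y : H), PowRel (B.abs.op b) n x y →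
        ∀ i, ⟪b i, y⟫_ℂ = (B.lam i : ℂ) ^ n * ⟪b i, x⟫_ℂ := by
      intro n
      induction n with
      | zero => rintro x y (rfl : y = x) i; simp
      | succ n ih =>
        rintro x y ⟨z, hz, hy⟩ i
        rw [(B.abs.mem_op_graph b).1 hy i, abs_seq, ih x z hz i]
        ring
    refine ext_coef b fun i => ?_
    rw [hK, hpow n x y hxy]
    by_cases h0 : B.lam i = 0
    · have hker : (b i, (0 : H)) ∈ (B.op b).graph := by
        have h1 : B.α i = 0 := by simpa [h0] using B.abs_α_le i
        have h2 : B.β i = 0 := by simpa [h0] using B.norm_β_le i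
        simpa [h1, h2] using B.basis_mem_graph b i
      rw [hx _ hker]
      simp
    · have : (B.lam i : ℂ) ≠ 0 := by exact_mod_cast h0
      push_cast
      field_simp

/-- If the number of `i` with `lam i ≤ R` grows at most like `R ^ n`, then `lam i ^ (-n)` are the
eigenvalues of a compact operator `|D|⁻ⁿ` and the `m`-th largest one is `O(1 / m)`. -/
theorem exists_absNegPow [Infinite I] {n : ℕ} (hn : n ≠ 0) {C : ℝ}
    (hcount : ∀ R : ℝ, 1 ≤ R → ∀ F : Finset I, (∀ i ∈ F, B.lam i ≤ R) → F.card ≤ C * R ^ n) :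
    Tendsto B.lam cofinite atTop ∧ ∃ K : H →L[ℂ] H, IsAbsNegPow (B.op b) n K ∧
      IsCompactOperator K ∧ ∃ s, IsEigenvalueSeq K s ∧ ∃ C : ℝ, ∀ m : ℕ, s m ≤ C / (m + 1) := by
  have hfinle : ∀ R : ℝ, {i | B.lam i ≤ R}.Finite := by
    intro R
    by_contra hinf
    obtain ⟨N, hN⟩ := exists_nat_gt (C * (max R 1) ^ n)
    obtain ⟨F, hF, hcard⟩ := Set.Infinite.exists_subset_card_eq hinf N
    have := hcount (max R 1) (le_max_right _ _) F fun i hi => (hF hi).trans (le_max_left _ _)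
    rw [hcard] at this
    linarith
  have hlam : Tendsto B.lam cofinite atTop := by
    refine tendsto_atTop.2 fun R => ?_
    rw [eventually_cofinite]
    exact (hfinle R).subset fun i hi => (not_le.1 hi).le
  refine ⟨hlam, ?_⟩
  let κ : I → ℝ := fun i => (B.lam i ^ n)⁻¹
  have hκ : Tendsto κ cofinite (𝓝 0) :=
    tendsto_inv_atTop_zero.comp ((tendsto_pow_atTop hn).comp hlam)
  have hκ0 : ∀ i, 0 ≤ κ i := fun i => inv_nonneg.2 (pow_nonneg (B.lam_nonneg i) n)
  have hκpos : ∀ i, 0 < κ i ↔ 0 < B.lam i := by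
    intro i
    constructor
    · intro h
      by_contra h0
      have : B.lam i = 0 := le_antisymm (not_lt.1 h0) (B.lam_nonneg i)
      simp [κ, this, hn] at h
    · intro h
      exact inv_pos.2 (pow_pos h n)
  have hinf : {i | 0 < κ i}.Infinite := by
    intro hf
    have h1 := (hf.union (hfinle 0))
    refine Set.infinite_univ (h1.subset fun i _ => ?_)
    rcases (B.lam_nonneg i).eq_or_lt with h | h
    · exact Or.inr h.ge
    · exact Or.inl ((hκpos i).2 h)
  have hfinκ : ∀ t > 0, {i | t ≤ κ i}.Finite := by
    intro t ht
    have := hκ.eventually (gt_mem_nhds ht)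
    simpa [eventually_cofinite] using this
  obtain ⟨σ, hσ, hanti, hσpos, hrange⟩ := exists_antitone_enum κ hfinκ hinf
  have hκc : Tendsto (fun i => ((κ i : ℝ) : ℂ)) cofinite (𝓝 0) := by
    have := (Complex.continuous_ofReal.tendsto 0).comp hκ
    simpa [Function.comp_def] using this
  obtain ⟨K, hKc, hK⟩ := exists_diag b hκc
  refine ⟨K, B.isAbsNegPow b hn hK, hKc, κ ∘ σ, ⟨hanti, fun m => hκ0 _, fun m => b (σ m),
    b.orthonormal.comp _ (hσ.comp Subtype.val_injective), fun m => ?_, fun x hx => ?_⟩, ?_⟩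
  · classical
    refine ext_coef b fun i => ?_
    rw [hK, inner_smul_right, inner_basis]
    split_ifs with h
    · simp [h]
    · simp
  · refine ext_coef b fun i => ?_
    rw [hK, inner_zero_right]
    rcases (hκ0 i).eq_or_lt with h | h
    · rw [← h]; simp
    · obtain ⟨m, rfl⟩ := hrange i h
      rw [hx ⟨m, hσpos m⟩, mul_zero]
  · have hC0 : 0 ≤ C := by
      have := hcount 1 le_rfl ∅ (by simp)
      simpa using this
    refine ⟨C * (1 + κ (σ 0)), fun m => ?_⟩
    rw [le_div_iff₀ (by positivity)]
    have hle : ∀ k ≤ m, B.lam (σ k) ≤ B.lam (σ m) := by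
      intro k hk
      have h1 : κ (σ m) ≤ κ (σ k) := hanti hk
      have h2 := (inv_le_inv₀ (pow_pos ((hκpos _).1 (hσpos m)) n)
        (pow_pos ((hκpos _).1 (hσpos k)) n)).1 h1
      exact (pow_le_pow_iff_left₀ (B.lam_nonneg _) (B.lam_nonneg _) hn).1 h2
    have hc := hcount (max 1 (B.lam (σ m))) (le_max_left _ _)
      ((Finset.range (m + 1)).map ⟨σ, hσ⟩) (by
        intro i hi
        simp only [Finset.mem_map, Finset.mem_range, Function.Embedding.coeFn_mk] at hi
        obtain ⟨k, hk, rfl⟩ := hi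
        exact (hle k (by omega)).trans (le_max_right _ _))
    rw [Finset.card_map, Finset.card_range] at hc
    push_cast at hc
    have hpos := hσpos m
    have h0 : κ (σ m) ≤ κ (σ 0) := hanti (Nat.zero_le m)
    have hprod : κ (σ m) * max 1 (B.lam (σ m)) ^ n ≤ 1 + κ (σ 0) := by
      rcases max_choice 1 (B.lam (σ m)) with h | h
      · rw [h, one_pow]; linarith
      · rw [h, show κ (σ m) = (B.lam (σ m) ^ n)⁻¹ from rfl,
          inv_mul_cancel₀ (pow_pos ((hκpos _).1 (hσpos m)) n).ne']
        linarith [hκ0 (σ 0)]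
    calc κ (σ m) * (m + 1) ≤ κ (σ m) * (C * max 1 (B.lam (σ m)) ^ n) := by gcongr
      _ = C * (κ (σ m) * max 1 (B.lam (σ m)) ^ n) := by ring
      _ ≤ _ := by gcongr

end BlockData

/-- Eigenvalues `μ_m = O(1/m)` have partial sums bounded by a multiple of the harmonic numbers. -/
theorem memL1Infty_of_le {H : Type*} [NormedAddCommGroup H] [InnerProductSpace ℂ H]
    {K : H →L[ℂ] H} (hK : IsCompactOperator K) {s : ℕ → ℝ} (hs : IsEigenvalueSeq K s) {C : ℝ}
    (hC : ∀ m : ℕ, s m ≤ C / (m + 1)) : MemL1Infty K := by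
  refine ⟨hK, s, hs, C * (1 / Real.log 2 + 1), fun N hN => ?_⟩
  have hC0 : 0 ≤ C := by simpa using (hs.2.1 0).trans (hC 0)
  have h1 : ∑ m ∈ Finset.range N, s m ≤ C * (harmonic N : ℝ) := by
    rw [harmonic, Rat.cast_sum, Finset.mul_sum]
    refine Finset.sum_le_sum fun m _ => (hC m).trans (le_of_eq ?_)
    push_cast
    rw [div_eq_mul_inv]
  have h2 := harmonic_le_one_add_log N
  have hlog2 : 0 < Real.log 2 := Real.log_pos one_lt_two
  have h3 : Real.log 2 ≤ Real.log N := Real.log_le_log two_pos (by exact_mod_cast hN)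
  have h4 : 1 ≤ 1 / Real.log 2 * Real.log N := by
    rw [one_div, inv_mul_eq_div, le_div_iff₀ hlog2]
    linarith
  calc _ ≤ C * (harmonic N : ℝ) := h1
    _ ≤ C * (1 / Real.log 2 * Real.log N + Real.log N) := by gcongr; linarith
    _ = _ := by ring

end QHM

/-! ### Smooth functions on the cylinder -/

namespace QHM

open Filter Topology

instance : IsProbabilityMeasure (volume : Measure UnitAddCircle) := ⟨UnitAddCircle.measure_univ⟩

instance : IsProbabilityMeasure (volume.restrict (Set.Icc (0 : ℝ) 1)) := ⟨by simp⟩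

instance : IsProbabilityMeasure cylMeasure := by
  unfold cylMeasure; infer_instance

theorem isOpenQuotientMap_cyl :
    IsOpenQuotientMap (Prod.map id (fun t : ℝ => (t : UnitAddCircle)) : ℝ × ℝ → _) :=
  IsOpenQuotientMap.id.prodMap QuotientAddGroup.isOpenQuotientMap_mk

namespace IsSmoothFun

variable {φ ψ : ℝ × UnitAddCircle → ℂ}

theorem continuous (hφ : IsSmoothFun φ) : Continuous φ :=
  isOpenQuotientMap_cyl.continuous_comp_iff.1 (ContDiff.continuous hφ)

theorem hasDerivAt_dx (hφ : IsSmoothFun φ) (x : ℝ) (y : UnitAddCircle) :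
    HasDerivAt (fun s => φ (s, y)) (dx φ (x, y)) x := by
  induction y using QuotientAddGroup.induction_on with
  | H t =>
    have h : Differentiable ℝ fun s : ℝ => φ (s, (t : UnitAddCircle)) :=
      (ContDiff.comp hφ (f := fun s : ℝ => (s, t)) (by fun_prop)).differentiable (by simp)
    exact (h x).hasDerivAt

theorem hasDerivAt_dy (hφ : IsSmoothFun φ) (x t : ℝ) :
    HasDerivAt (fun s : ℝ => φ (x, (s : UnitAddCircle))) (dy φ (x, (t : UnitAddCircle))) t := by
  have h : Differentiable ℝ fun s : ℝ => φ (x, (s : UnitAddCircle)) :=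
    (ContDiff.comp hφ (f := fun s : ℝ => (x, s)) (by fun_prop)).differentiable (by simp)
  have h2 : dy φ (x, (t : UnitAddCircle)) = deriv (fun s : ℝ => φ (x, (s : UnitAddCircle))) t := by
    have := deriv_comp_const_add (fun s : ℝ => φ (x, (s : UnitAddCircle))) t 0
    rw [add_zero] at this
    rw [← this, dy]
    simp
  rw [h2]
  exact (h t).hasDerivAt

theorem hasDerivAt_dy' (hφ : IsSmoothFun φ) (x : ℝ) (y : UnitAddCircle) :
    HasDerivAt (fun s : ℝ => φ (x, y + (s : UnitAddCircle))) (dy φ (x, y)) 0 := by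
  induction y using QuotientAddGroup.induction_on with
  | H t =>
    have h := hφ.hasDerivAt_dy x (t + 0)
    have := h.comp_const_add t 0
    simpa using this

protected theorem dx (hφ : IsSmoothFun φ) : IsSmoothFun (dx φ) := by
  have h : (fun z : ℝ × ℝ => dx φ (z.1, (z.2 : UnitAddCircle))) = fun z =>
      fderiv ℝ (fun z : ℝ × ℝ => φ (z.1, (z.2 : UnitAddCircle))) z (1, 0) := by
    ext z
    have h1 := (ContDiff.differentiable hφ (by simp) z).hasFDerivAt
    have h2 := h1.comp_hasDerivAt (f := fun s : ℝ => (s, z.2)) z.1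
      ((hasDerivAt_id z.1).prodMk (hasDerivAt_const z.1 z.2))
    exact (hφ.hasDerivAt_dx z.1 z.2).unique h2
  rw [IsSmoothFun, h]
  exact (ContDiff.fderiv_right (m := ∞) hφ (by simp)).clm_apply contDiff_const

protected theorem dy (hφ : IsSmoothFun φ) : IsSmoothFun (dy φ) := by
  have h : (fun z : ℝ × ℝ => dy φ (z.1, (z.2 : UnitAddCircle))) = fun z =>
      fderiv ℝ (fun z : ℝ × ℝ => φ (z.1, (z.2 : UnitAddCircle))) z (0, 1) := by
    ext z
    have h1 := (ContDiff.differentiable hφ (by simp) z).hasFDerivAt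
    have h2 := h1.comp_hasDerivAt (f := fun s : ℝ => (z.1, s)) z.2
      ((hasDerivAt_const z.2 z.1).prodMk (hasDerivAt_id z.2))
    exact (hφ.hasDerivAt_dy z.1 z.2).unique h2
  rw [IsSmoothFun, h]
  exact (ContDiff.fderiv_right (m := ∞) hφ (by simp)).clm_apply contDiff_const

theorem mul (hφ : IsSmoothFun φ) (hψ : IsSmoothFun ψ) : IsSmoothFun fun z => φ z * ψ z :=
  ContDiff.mul hφ hψ

theorem add (hφ : IsSmoothFun φ) (hψ : IsSmoothFun ψ) : IsSmoothFun fun z => φ z + ψ z :=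
  ContDiff.add hφ hψ

theorem sub (hφ : IsSmoothFun φ) (hψ : IsSmoothFun ψ) : IsSmoothFun fun z => φ z - ψ z :=
  ContDiff.sub hφ hψ

theorem star (hφ : IsSmoothFun φ) : IsSmoothFun fun z => conj (φ z) :=
  Complex.conjCLE.contDiff.comp hφ

theorem of_fst {g : ℝ → ℂ} (hg : ContDiff ℝ ∞ g) : IsSmoothFun fun z => g z.1 :=
  hg.comp contDiff_fst

theorem const (c : ℂ) : IsSmoothFun fun _ => c := contDiff_const

theorem _root_.QHM.contDiff_fourier (n : ℤ) :
    ContDiff ℝ ∞ fun t : ℝ => (fourier n (t : UnitAddCircle) : ℂ) := by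
  have : (fun t : ℝ => (fourier n (t : UnitAddCircle) : ℂ)) =
      fun t : ℝ => Complex.exp (2 * Real.pi * Complex.I * n * t) := by
    ext t; simp
  rw [this]
  exact (contDiff_const.mul Complex.ofRealCLM.contDiff).cexp

theorem fourier (n : ℤ) : IsSmoothFun fun z => (fourier n z.2 : ℂ) :=
  (contDiff_fourier n).comp contDiff_snd

theorem translate (hφ : IsSmoothFun φ) (s t : ℝ) :
    IsSmoothFun fun z => φ (z.1 - s, z.2 - (t : UnitAddCircle)) := by
  have h := ContDiff.comp hφ (f := fun z : ℝ × ℝ => (z.1 - s, z.2 - t)) (by fun_prop)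
  simpa [Function.comp_def, IsSmoothFun] using h

/-- The restriction of a smooth function to the circle over `s`, extended to be constant in `x`. -/
theorem slice_fst (hφ : IsSmoothFun φ) (s : ℝ) : IsSmoothFun fun z => φ (s, z.2) :=
  ContDiff.comp hφ (f := fun z : ℝ × ℝ => (s, z.2)) (by fun_prop)

theorem dx_mul (hφ : IsSmoothFun φ) (hψ : IsSmoothFun ψ) (z : ℝ × UnitAddCircle) :
    QHM.dx (fun z => φ z * ψ z) z = QHM.dx φ z * ψ z + φ z * QHM.dx ψ z :=
  ((hφ.hasDerivAt_dx z.1 z.2).mul (hψ.hasDerivAt_dx z.1 z.2)).deriv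

theorem dy_mul (hφ : IsSmoothFun φ) (hψ : IsSmoothFun ψ) (z : ℝ × UnitAddCircle) :
    QHM.dy (fun z => φ z * ψ z) z = QHM.dy φ z * ψ z + φ z * QHM.dy ψ z := by
  have := ((hφ.hasDerivAt_dy' z.1 z.2).mul (hψ.hasDerivAt_dy' z.1 z.2)).deriv
  simp only [AddCircle.coe_zero, add_zero] at this
  exact this

theorem dx_sub (hφ : IsSmoothFun φ) (hψ : IsSmoothFun ψ) (z : ℝ × UnitAddCircle) :
    QHM.dx (fun z => φ z - ψ z) z = QHM.dx φ z - QHM.dx ψ z :=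
  ((hφ.hasDerivAt_dx z.1 z.2).sub (hψ.hasDerivAt_dx z.1 z.2)).deriv

theorem dx_conj (hφ : IsSmoothFun φ) (z : ℝ × UnitAddCircle) :
    QHM.dx (fun z => conj (φ z)) z = conj (QHM.dx φ z) :=
  (Complex.conjCLE.hasFDerivAt.comp_hasDerivAt z.1 (hφ.hasDerivAt_dx z.1 z.2)).deriv

theorem dy_conj (hφ : IsSmoothFun φ) (z : ℝ × UnitAddCircle) :
    QHM.dy (fun z => conj (φ z)) z = conj (QHM.dy φ z) :=
  (Complex.conjCLE.hasFDerivAt.comp_hasDerivAt (0 : ℝ) (hφ.hasDerivAt_dy' z.1 z.2)).deriv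

theorem bounded (hφ : IsSmoothFun φ) :
    ∃ C : ℝ, 0 ≤ C ∧ ∀ z, z.1 ∈ Set.Icc (0 : ℝ) 1 → ‖φ z‖ ≤ C := by
  have hc : IsCompact (Set.Icc (0 : ℝ) 1 ×ˢ (Set.univ : Set UnitAddCircle)) :=
    isCompact_Icc.prod isCompact_univ
  obtain ⟨C, hC⟩ := hc.exists_bound_of_continuousOn hφ.continuous.continuousOn
  exact ⟨max C 0, le_max_right _ _, fun z hz => (hC z ⟨hz, trivial⟩).trans (le_max_left _ _)⟩

end IsSmoothFun

theorem dx_of_snd (g : UnitAddCircle → ℂ) (z : ℝ × UnitAddCircle) :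
    dx (fun z => g z.2) z = 0 := by simp [dx]

theorem dy_of_fst (g : ℝ → ℂ) (z : ℝ × UnitAddCircle) :
    dy (fun z => g z.1) z = 0 := by simp [dy]

theorem dy_fourier (n : ℤ) (z : ℝ × UnitAddCircle) :
    dy (fun z => (fourier n z.2 : ℂ)) z = 2 * Real.pi * Complex.I * n * fourier n z.2 := by
  obtain ⟨x, y⟩ := z
  induction y using QuotientAddGroup.induction_on with
  | H t =>
    have h1 := (IsSmoothFun.fourier n).hasDerivAt_dy x t
    have h2 := hasDerivAt_fourier (T := 1) n t
    rw [h1.unique h2]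
    simp

theorem ae_cyl_mem : ∀ᵐ z ∂cylMeasure, z.1 ∈ Set.Icc (0 : ℝ) 1 := by
  have h : ∀ᵐ x : ℝ ∂(volume.restrict (Set.Icc (0 : ℝ) 1)), x ∈ Set.Icc (0 : ℝ) 1 :=
    ae_restrict_mem measurableSet_Icc
  exact Measure.quasiMeasurePreserving_fst.ae h

theorem ae_cyl_mem_Ioo : ∀ᵐ z ∂cylMeasure, z.1 ∈ Set.Ioo (0 : ℝ) 1 := by
  have h : ∀ᵐ x : ℝ ∂(volume.restrict (Set.Icc (0 : ℝ) 1)), x ∈ Set.Ioo (0 : ℝ) 1 := by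
    rw [← restrict_Ioo_eq_restrict_Icc]
    exact ae_restrict_mem measurableSet_Ioo
  exact Measure.quasiMeasurePreserving_fst.ae h

theorem IsSmoothFun.memLp_top {φ : ℝ × UnitAddCircle → ℂ} (hφ : IsSmoothFun φ) :
    MemLp φ ∞ cylMeasure := by
  obtain ⟨C, -, hC⟩ := hφ.bounded
  exact memLp_top_of_bound hφ.continuous.aestronglyMeasurable C
    (ae_cyl_mem.mono fun z hz => hC z hz)

theorem IsSmoothFun.memLp {φ : ℝ × UnitAddCircle → ℂ} (hφ : IsSmoothFun φ) (p : ℝ≥0∞) :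
    MemLp φ p cylMeasure :=
  hφ.memLp_top.mono_exponent le_top

theorem IsSmoothFun.integrable {φ : ℝ × UnitAddCircle → ℂ} (hφ : IsSmoothFun φ) :
    Integrable φ cylMeasure := memLp_one_iff_integrable.1 (hφ.memLp 1)

section

variable {E : Type*} [NormedAddCommGroup E] {f : ℝ × UnitAddCircle → E}

theorem integrable_of_memLp (hf : MemLp f 2 cylMeasure) : Integrable f cylMeasure :=
  hf.integrable (by norm_num)

variable [NormedSpace ℂ E]

theorem memLp_smul_smooth (hf : MemLp f 2 cylMeasure) {φ : ℝ × UnitAddCircle → ℂ}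
    (hφ : IsSmoothFun φ) : MemLp (fun z => φ z • f z) 2 cylMeasure :=
  hf.smul hφ.memLp_top

theorem integrable_smul_smooth (hf : MemLp f 2 cylMeasure) {φ : ℝ × UnitAddCircle → ℂ}
    (hφ : IsSmoothFun φ) : Integrable (fun z => φ z • f z) cylMeasure :=
  integrable_of_memLp (memLp_smul_smooth hf hφ)

end

theorem integral_cyl_eq {E : Type*} [NormedAddCommGroup E] [NormedSpace ℝ E]
    {f : ℝ × UnitAddCircle → E} (hf : Integrable f cylMeasure) :
    ∫ z, f z ∂cylMeasure = ∫ y : UnitAddCircle, ∫ x in Set.Icc (0 : ℝ) 1, f (x, y) :=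
  integral_prod_symm f hf

theorem integral_dx {φ : ℝ × UnitAddCircle → ℂ} (hφ : IsSmoothFun φ) :
    ∫ z, dx φ z ∂cylMeasure = (∫ y, φ (1, y)) - ∫ y, φ (0, y) := by
  have hi : ∀ s : ℝ, Integrable (fun y : UnitAddCircle => φ (s, y)) := fun s =>
    Continuous.integrable_of_hasCompactSupport
      (hφ.continuous.comp (Continuous.prodMk_right s)) (HasCompactSupport.of_compactSpace _)
  rw [integral_cyl_eq hφ.dx.integrable, ← integral_sub (hi 1) (hi 0)]
  congr 1
  ext y
  rw [integral_Icc_eq_integral_Ioc, ← intervalIntegral.integral_of_le zero_le_one]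
  refine intervalIntegral.integral_eq_sub_of_hasDerivAt (fun x _ => hφ.hasDerivAt_dx x y) ?_
  exact Continuous.intervalIntegrable (hφ.dx.continuous.comp (Continuous.prodMk_left y)) _ _

theorem integral_dy {φ : ℝ × UnitAddCircle → ℂ} (hφ : IsSmoothFun φ) :
    ∫ z, dy φ z ∂cylMeasure = 0 := by
  have h : ∫ z, dy φ z ∂cylMeasure =
      ∫ x in Set.Icc (0 : ℝ) 1, ∫ y : UnitAddCircle, dy φ (x, y) :=
    integral_prod _ hφ.dy.integrable
  rw [h]
  refine integral_eq_zero_of_ae (Eventually.of_forall fun x => ?_)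
  simp only [Pi.zero_apply]
  rw [← UnitAddCircle.intervalIntegral_preimage 0 (fun y => dy φ (x, y))]
  rw [intervalIntegral.integral_eq_sub_of_hasDerivAt (fun t _ => hφ.hasDerivAt_dy x t)]
  · simp [AddCircle.coe_period]
  · exact Continuous.intervalIntegrable
      ((hφ.dy.continuous.comp (Continuous.prodMk_right x)).comp continuous_quotient_mk') _ _

end QHM

/-! ### Slices of the Hilbert space and fibrewise Fourier coefficients -/

namespace QHM

open Filter Topology

/-- The inclusion of the slice `ℝ × 𝕋 × {p}`. -/
def incl (p : ℤ) (z : ℝ × UnitAddCircle) : ℝ × UnitAddCircle × ℤ := (z.1, z.2, p)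

theorem measurableEmbedding_incl (p : ℤ) : MeasurableEmbedding (incl p) :=
  MeasurableEquiv.prodAssoc.measurableEmbedding.comp (measurableEmbedding_prod_mk_right p)

theorem measurableSet_slice (p : ℤ) :
    MeasurableSet {w : ℝ × UnitAddCircle × ℤ | w.2.2 = p} :=
  (measurable_snd.comp measurable_snd) (measurableSet_singleton p)

theorem hilbMeasure_restrict (p : ℤ) :
    hilbMeasure.restrict {w | w.2.2 = p} = cylMeasure.map (incl p) := by
  have h1 : {w : ℝ × UnitAddCircle × ℤ | w.2.2 = p} = Set.univ ×ˢ (Set.univ ×ˢ {p}) := by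
    ext; simp
  have h2 : (Measure.count : Measure ℤ).restrict {p} = Measure.dirac p := by
    rw [Measure.restrict_singleton]; simp
  rw [h1, hilbMeasure, ← Measure.prod_restrict, ← Measure.prod_restrict, h2,
    Measure.restrict_univ, Measure.restrict_univ, Measure.prod_dirac, cylMeasure]
  have := Measure.map_prod_map (volume.restrict (Set.Icc (0 : ℝ) 1))
    (volume : Measure UnitAddCircle) measurable_id
    (measurable_prodMk_right (y := p) : Measurable fun y : UnitAddCircle => (y, p))
  rw [Measure.map_id] at this
  rw [this]
  rfl

theorem ae_hilb_iff {P : ℝ × UnitAddCircle × ℤ → Prop} :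
    (∀ᵐ w ∂hilbMeasure, P w) ↔ ∀ p, ∀ᵐ z ∂cylMeasure, P (incl p z) := by
  have h : (⋃ p : ℤ, {w : ℝ × UnitAddCircle × ℤ | w.2.2 = p}) = Set.univ := by
    ext w; simp
  rw [← Measure.restrict_univ (μ := hilbMeasure), ← h, ae_restrict_iUnion_iff]
  refine forall_congr' fun p => ?_
  rw [hilbMeasure_restrict, (measurableEmbedding_incl p).ae_map_iff]

theorem memLp_slice {f : ℝ × UnitAddCircle × ℤ → Spin} (hf : MemLp f 2 hilbMeasure) (p : ℤ) :
    MemLp (slice f p) 2 cylMeasure := by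
  have h := hf.restrict {w | w.2.2 = p}
  rw [hilbMeasure_restrict, (measurableEmbedding_incl p).memLp_map_measure_iff] at h
  exact h

theorem Hilb.memLp_slice (Φ : Hilb) (p : ℤ) : MemLp (slice Φ p) 2 cylMeasure :=
  QHM.memLp_slice (Lp.memLp Φ) p

theorem hilb_ext {Φ Ψ : Hilb} (h : ∀ p, slice Φ p =ᵐ[cylMeasure] slice Ψ p) : Φ = Ψ :=
  Lp.ext (ae_hilb_iff.2 h)

theorem slice_congr {f g : ℝ × UnitAddCircle × ℤ → Spin} (h : f =ᵐ[hilbMeasure] g) (p : ℤ) :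
    slice f p =ᵐ[cylMeasure] slice g p := ae_hilb_iff.1 h p

theorem memLp_indicator_slice {p : ℤ} {f : ℝ × UnitAddCircle → Spin} (hf : MemLp f 2 cylMeasure) :
    MemLp ({w : ℝ × UnitAddCircle × ℤ | w.2.2 = p}.indicator fun w => f (w.1, w.2.1)) 2
      hilbMeasure := by
  rw [memLp_indicator_iff_restrict (measurableSet_slice p), hilbMeasure_restrict,
    (measurableEmbedding_incl p).memLp_map_measure_iff]
  exact hf

/-- The element of the Hilbert space that is `f` on the slice of `p` and zero elsewhere. -/
def ofSlice (p : ℤ) (f : ℝ × UnitAddCircle → Spin) (hf : MemLp f 2 cylMeasure) : Hilb :=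
  (memLp_indicator_slice (p := p) hf).toLp

theorem slice_ofSlice {p : ℤ} {f : ℝ × UnitAddCircle → Spin} (hf : MemLp f 2 cylMeasure) (q : ℤ) :
    slice (ofSlice p f hf) q =ᵐ[cylMeasure] if q = p then f else 0 := by
  refine (slice_congr (MemLp.coeFn_toLp _) q).trans (Eventually.of_forall fun z => ?_)
  by_cases h : q = p <;> simp [slice, h]

theorem inner_ofSlice {p : ℤ} {f : ℝ × UnitAddCircle → Spin} (hf : MemLp f 2 cylMeasure)
    (Φ : Hilb) : ⟪ofSlice p f hf, Φ⟫_ℂ = ∫ z, ⟪f z, slice Φ p z⟫_ℂ ∂cylMeasure := by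
  rw [L2.inner_def]
  have h : (fun w => ⟪ofSlice p f hf w, Φ w⟫_ℂ) =ᵐ[hilbMeasure]
      {w : ℝ × UnitAddCircle × ℤ | w.2.2 = p}.indicator fun w => ⟪f (w.1, w.2.1), Φ w⟫_ℂ := by
    filter_upwards [MemLp.coeFn_toLp (memLp_indicator_slice (p := p) hf)] with w hw
    rw [ofSlice, hw]
    by_cases h : w.2.2 = p <;> simp [h]
  rw [integral_congr_ae h, integral_indicator (measurableSet_slice p), hilbMeasure_restrict,
    (measurableEmbedding_incl p).integral_map]
  rfl

section fourier

theorem norm_fourier (n : ℤ) (y : UnitAddCircle) : ‖(fourier n y : ℂ)‖ = 1 := Circle.norm_coe _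

theorem integrable_smul_of_norm_le {X E : Type*} [MeasurableSpace X] {m : Measure X}
    [NormedAddCommGroup E] [NormedSpace ℂ E] {u : X → E} (hu : Integrable u m) {g : X → ℂ}
    (hg : AEStronglyMeasurable g m) {C : ℝ} (hC : ∀ x, ‖g x‖ ≤ C) :
    Integrable (fun x => g x • u x) m :=
  hu.bdd_smul C hg (Eventually.of_forall hC)

theorem memLp_smul_of_norm_le {X E : Type*} [MeasurableSpace X] {m : Measure X}
    [NormedAddCommGroup E] [NormedSpace ℂ E] {u : X → E} {q : ℝ≥0∞} (hu : MemLp u q m) {g : X → ℂ}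
    (hg : AEStronglyMeasurable g m) {C : ℝ} (hC : ∀ x, ‖g x‖ ≤ C) :
    MemLp (fun x => g x • u x) q m :=
  hu.smul (memLp_top_of_bound hg C (Eventually.of_forall hC))

/-- Integration along a factor of total mass one is bounded in `L²` (Jensen's inequality). -/
theorem memLp_integral_snd {X Y E : Type*} [MeasurableSpace X] [MeasurableSpace Y] {m : Measure X}
    {m' : Measure Y} [SFinite m] [IsProbabilityMeasure m'] [NormedAddCommGroup E] [NormedSpace ℝ E]
    {f : X × Y → E} (hf : MemLp f 2 (m.prod m')) : MemLp (fun x => ∫ y, f (x, y) ∂m') 2 m := by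
  have hsq := (memLp_two_iff_integrable_sq_norm hf.1).1 hf
  have hm : AEStronglyMeasurable (fun x => ∫ y, f (x, y) ∂m') m := hf.1.integral_prod_right'
  rw [memLp_two_iff_integrable_sq_norm hm]
  refine hsq.integral_prod_left.mono' (hm.norm.pow 2) ?_
  filter_upwards [hsq.prod_right_ae, hf.1.prodMk_left] with x hx hx'
  rw [Real.norm_of_nonneg (by positivity)]
  have hL : MemLp (fun y => f (x, y)) 2 m' := (memLp_two_iff_integrable_sq_norm hx').2 hx
  have h1 : ‖∫ y, f (x, y) ∂m'‖ ≤ ∫ y, ‖f (x, y)‖ ∂m' := norm_integral_le_integral_norm _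
  refine (pow_le_pow_left₀ (norm_nonneg _) h1 2).trans ?_
  exact (Even.convexOn_pow (n := 2) even_two).map_integral_le (continuous_pow 2).continuousOn
    isClosed_univ (by simp) (hL.norm.integrable (by norm_num)) hx

theorem volume_eq_haarAddCircle :
    (volume : Measure UnitAddCircle) = AddCircle.haarAddCircle := by
  simpa using AddCircle.volume_eq_smul_haarAddCircle (T := 1)

theorem ae_eq_zero_of_fourierCoeff {v : UnitAddCircle → ℂ}
    (hv : MemLp v 2 AddCircle.haarAddCircle) (h : ∀ n : ℤ, fourierCoeff v n = 0) :
    v =ᵐ[AddCircle.haarAddCircle] 0 := by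
  have h1 : fourierBasis.repr hv.toLp = 0 := by
    refine lp.ext (funext fun n => ?_)
    rw [fourierBasis_repr, fourierCoeff_congr_ae hv.coeFn_toLp, h]
    rfl
  have h0 : hv.toLp = 0 := (map_eq_zero_iff _ fourierBasis.repr.injective).1 h1
  have h2 := hv.coeFn_toLp
  rw [h0] at h2
  exact h2.symm.trans (Lp.coeFn_zero _ _ _)

theorem ae_eq_zero_of_fourier {u : UnitAddCircle → Spin} (hu : MemLp u 2 volume)
    (h : ∀ n : ℤ, ∫ y : UnitAddCircle, (fourier n y : ℂ) • u y = 0) : u =ᵐ[volume] 0 := by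
  have hu1 : Integrable u := hu.integrable (by norm_num)
  have hi : ∀ n : ℤ, Integrable (fun y : UnitAddCircle => (fourier n y : ℂ) • u y) := fun n =>
    integrable_smul_of_norm_le hu1 (fourier n).continuous.aestronglyMeasurable
      fun y => (norm_fourier n y).le
  have key : ∀ s : Fin 2, (fun y => u y s) =ᵐ[volume] 0 := by
    intro s
    have hs : MemLp (fun y => u y s) 2 AddCircle.haarAddCircle := by
      rw [← volume_eq_haarAddCircle]
      exact (EuclideanSpace.proj s : Spin →L[ℂ] ℂ).comp_memLp' hu
    have hn : ∀ n : ℤ, fourierCoeff (fun y => u y s) n = 0 := by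
      intro n
      have h1 := ContinuousLinearMap.integral_comp_comm
        (EuclideanSpace.proj s : Spin →L[ℂ] ℂ) (hi (-n))
      rw [h, map_zero] at h1
      rw [fourierCoeff, ← volume_eq_haarAddCircle]
      exact h1
    rw [volume_eq_haarAddCircle]
    exact ae_eq_zero_of_fourierCoeff hs hn
  filter_upwards [key 0, key 1] with y h0 h1
  refine PiLp.ext fun s => ?_
  rcases Fin.exists_fin_two.1 ⟨s, rfl⟩ with rfl | rfl
  · exact h0
  · exact h1

/-- The Fourier coefficients of `f` on the circles `{x} × 𝕋`. -/
def fibreCoeff (n : ℤ) (f : ℝ × UnitAddCircle → Spin) (x : ℝ) : Spin :=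
  ∫ y, (fourier (-n) y : ℂ) • f (x, y)

theorem norm_fibreCoeff_le (n : ℤ) (f : ℝ × UnitAddCircle → Spin) (x : ℝ) :
    ‖fibreCoeff n f x‖ ≤ ∫ y, ‖f (x, y)‖ := by
  refine (norm_integral_le_integral_norm _).trans (le_of_eq ?_)
  simp only [norm_smul, norm_fourier, one_mul]

theorem integral_smul_fibreCoeff {f : ℝ × UnitAddCircle → Spin} (hf : Integrable f cylMeasure)
    {g : ℝ → ℂ} (hg : Continuous g) (n : ℤ) :
    ∫ z, (g z.1 * fourier (-n) z.2 : ℂ) • f z ∂cylMeasure =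
      ∫ x in Set.Icc (0 : ℝ) 1, g x • fibreCoeff n f x := by
  obtain ⟨C, hC⟩ := isCompact_Icc.exists_bound_of_continuousOn (s := Set.Icc (0 : ℝ) 1)
    hg.continuousOn
  have hi : Integrable (fun z => (g z.1 * fourier (-n) z.2 : ℂ) • f z) cylMeasure := by
    refine hf.bdd_smul C (Continuous.aestronglyMeasurable
      (f := fun z : ℝ × UnitAddCircle => (g z.1 * fourier (-n) z.2 : ℂ)) (by fun_prop)) ?_
    filter_upwards [ae_cyl_mem] with z hz
    rw [norm_mul, norm_fourier, mul_one]
    exact hC _ hz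
  rw [cylMeasure, integral_prod _ hi]
  simp only [fibreCoeff, mul_smul, integral_smul]

theorem integrable_fibreCoeff {f : ℝ × UnitAddCircle → Spin} (hf : Integrable f cylMeasure)
    (n : ℤ) : Integrable (fibreCoeff n f) (volume.restrict (Set.Icc (0 : ℝ) 1)) := by
  have hi : Integrable (fun z => (fourier (-n) z.2 : ℂ) • f z) cylMeasure :=
    hf.bdd_smul 1 (Continuous.aestronglyMeasurable (by fun_prop))
      (Eventually.of_forall fun y => (norm_fourier _ _).le)
  exact hi.integral_prod_left

theorem memLp_fibreCoeff {f : ℝ × UnitAddCircle → Spin} (hf : MemLp f 2 cylMeasure) (n : ℤ) :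
    MemLp (fibreCoeff n f) 2 (volume.restrict (Set.Icc (0 : ℝ) 1)) :=
  memLp_integral_snd (f := fun z => (fourier (-n) z.2 : ℂ) • f z)
    (memLp_smul_smooth hf (IsSmoothFun.fourier (-n)))

theorem ae_eq_zero_of_fibreCoeff {f : ℝ × UnitAddCircle → Spin} (hf : MemLp f 2 cylMeasure)
    (h : ∀ n : ℤ, ∀ᵐ x ∂(volume.restrict (Set.Icc (0 : ℝ) 1)), fibreCoeff n f x = 0) :
    f =ᵐ[cylMeasure] 0 := by
  have h1 := ((memLp_two_iff_integrable_sq_norm hf.1).1 hf).prod_right_ae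
  have h2 := hf.1.prodMk_left
  have h3 : ∀ᵐ x ∂(volume.restrict (Set.Icc (0 : ℝ) 1)), ∀ᵐ y : UnitAddCircle,
      f (x, y) = 0 := by
    filter_upwards [h1, h2, ae_all_iff.2 h] with x hx1 hx2 hx3
    refine ae_eq_zero_of_fourier ((memLp_two_iff_integrable_sq_norm hx2).2 hx1) fun n => ?_
    have := hx3 (-n)
    rwa [fibreCoeff, neg_neg] at this
  have h4 : ∀ᵐ x ∂(volume.restrict (Set.Icc (0 : ℝ) 1)), ∀ᵐ y : UnitAddCircle,
      f (x, y) = hf.1.mk f (x, y) := Measure.ae_ae_of_ae_prod hf.1.ae_eq_mk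
  have h5 : ∀ᵐ z ∂cylMeasure, hf.1.mk f z = 0 := by
    refine (Measure.ae_prod_iff_ae_ae
      (hf.1.stronglyMeasurable_mk.measurable (measurableSet_singleton 0))).2 ?_
    filter_upwards [h3, h4] with x hx hx'
    filter_upwards [hx, hx'] with y hy hy'
    exact hy'.symm.trans hy
  filter_upwards [h5, hf.1.ae_eq_mk] with z hz hz'
  rw [hz', hz]
  rfl

/-- Test functions `χ(x) e(ny)` separate the elements of `L²`. -/
theorem ae_eq_zero_of_test {f : ℝ × UnitAddCircle → Spin} (hf : MemLp f 2 cylMeasure)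
    (h : ∀ φ, IsTestFun φ → ∫ z, φ z • f z ∂cylMeasure = 0) : f =ᵐ[cylMeasure] 0 := by
  have hf1 := integrable_of_memLp hf
  refine ae_eq_zero_of_fibreCoeff hf fun n => ?_
  have hi := integrable_fibreCoeff hf1 n
  have h0 := isOpen_Ioo.ae_eq_zero_of_integral_contDiff_smul_eq_zero
    (U := Set.Ioo (0 : ℝ) 1) (hi.locallyIntegrable.locallyIntegrableOn _) (fun χ h1 h2 h3 => ?_)
  · rw [← restrict_Ioo_eq_restrict_Icc] at h0 ⊢
    filter_upwards [h0, ae_restrict_mem measurableSet_Ioo] with x hx hx'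
    exact hx hx'
  · have ht : IsTestFun fun z => (χ z.1 : ℂ) * fourier (-n) z.2 := by
      refine ⟨(IsSmoothFun.of_fst (Complex.ofRealCLM.contDiff.comp h1)).mul
        (IsSmoothFun.fourier _), ?_⟩
      have : tsupport (fun z : ℝ × UnitAddCircle => (χ z.1 : ℂ) * (fourier (-n) z.2 : ℂ)) ⊆
          Prod.fst ⁻¹' tsupport χ := by
        refine closure_minimal ?_ ((isClosed_tsupport χ).preimage continuous_fst)
        intro z hz
        refine subset_tsupport _ fun h0 => hz ?_
        simp [h0]
      exact fun z hz => ⟨h3 (this hz), trivial⟩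
    have := h _ ht
    rw [integral_smul_fibreCoeff hf1 (g := fun x => (χ x : ℂ))
      (Complex.continuous_ofReal.comp h1.continuous)] at this
    simpa using this

end fourier

end QHM

/-! ### Weak derivatives and boundary values -/

namespace QHM

open Filter Topology

section cutoff

/-- Cutoff functions on `(0, 1)`, equal to one except within `O(1 / m)` of the end points. -/
def cutoff (m : ℕ) (x : ℝ) : ℝ :=
  Real.smoothTransition ((m + 1) * x - 1) * Real.smoothTransition ((m + 1) * (1 - x) - 1)

theorem contDiff_cutoff (m : ℕ) : ContDiff ℝ ∞ (cutoff m) := by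
  have h : ContDiff ℝ ∞ Real.smoothTransition := Real.smoothTransition.contDiff
  exact (h.comp (by fun_prop)).mul (h.comp (by fun_prop))

theorem norm_cutoff_le (m : ℕ) (x : ℝ) : ‖(cutoff m x : ℂ)‖ ≤ 1 := by
  rw [Complex.norm_real, Real.norm_eq_abs, cutoff, abs_of_nonneg (mul_nonneg
    (Real.smoothTransition.nonneg _) (Real.smoothTransition.nonneg _))]
  exact mul_le_one₀ (Real.smoothTransition.le_one _) (Real.smoothTransition.nonneg _)
    (Real.smoothTransition.le_one _)

theorem tsupport_cutoff (m : ℕ) : tsupport (cutoff m) ⊆ Set.Ioo 0 1 := by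
  have h : tsupport (cutoff m) ⊆ Set.Icc (1 / (m + 1 : ℝ)) (1 - 1 / (m + 1 : ℝ)) := by
    refine closure_minimal (fun x hx => ?_) isClosed_Icc
    have hm : (0 : ℝ) < m + 1 := by positivity
    constructor
    · by_contra h
      rw [not_le, lt_div_iff₀ hm] at h
      exact hx (by rw [cutoff, Real.smoothTransition.zero_of_nonpos (by linarith), zero_mul])
    · by_contra h
      have : 1 - x < 1 / (m + 1 : ℝ) := by linarith
      rw [lt_div_iff₀ hm] at this
      exact hx (by rw [cutoff, mul_comm, Real.smoothTransition.zero_of_nonpos (by linarith),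
        zero_mul])
  have hm : (0 : ℝ) < 1 / (m + 1 : ℝ) := by positivity
  exact h.trans fun x hx => ⟨hm.trans_le hx.1, by linarith [hx.2]⟩

theorem eventually_cutoff {x : ℝ} (hx : x ∈ Set.Ioo (0 : ℝ) 1) :
    ∀ᶠ m in atTop, cutoff m x = 1 ∧ deriv (cutoff m) x = 0 := by
  obtain ⟨N, hN⟩ := exists_nat_gt (max (2 / x) (2 / (1 - x)))
  have h1 : 0 < 1 - x := by linarith [hx.2]
  have hN1 := (le_max_left _ _).trans_lt hN
  have hN2 := (le_max_right _ _).trans_lt hN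
  rw [div_lt_iff₀ hx.1] at hN1
  rw [div_lt_iff₀ h1] at hN2
  filter_upwards [eventually_ge_atTop N] with m hm
  have hm' : (N : ℝ) ≤ m := by exact_mod_cast hm
  have hN3 : (N : ℝ) * x ≤ m * x := mul_le_mul_of_nonneg_right hm' hx.1.le
  have hN4 : (N : ℝ) * (1 - x) ≤ m * (1 - x) := mul_le_mul_of_nonneg_right hm' h1.le
  have hev : cutoff m =ᶠ[𝓝 x] fun _ => 1 := by
    have e1 : ∀ᶠ t in 𝓝 x, 2 < (m + 1 : ℝ) * t :=
      Continuous.continuousAt (by fun_prop : Continuous fun t => (m + 1 : ℝ) * t)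
        |>.eventually_const_lt (by linarith [hx.1])
    have e2 : ∀ᶠ t in 𝓝 x, 2 < (m + 1 : ℝ) * (1 - t) :=
      Continuous.continuousAt (by fun_prop : Continuous fun t => (m + 1 : ℝ) * (1 - t))
        |>.eventually_const_lt (by linarith)
    filter_upwards [e1, e2] with t ht1 ht2
    rw [cutoff, Real.smoothTransition.one_of_one_le (by linarith),
      Real.smoothTransition.one_of_one_le (by linarith), one_mul]
  exact ⟨hev.eq_of_nhds, by rw [hev.deriv_eq]; simp⟩

theorem exists_deriv_smoothTransition_bound :
    ∃ C : ℝ, 0 ≤ C ∧ ∀ t, |deriv Real.smoothTransition (t - 1)| * |t| ≤ C := by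
  have hc : Continuous fun t => |deriv Real.smoothTransition (t - 1)| * |t| :=
    ((Real.smoothTransition.contDiff (n := 1)).continuous_deriv (by norm_num) |>.comp
      (continuous_id.sub continuous_const)).abs.mul continuous_abs
  obtain ⟨C, hC⟩ := (isCompact_Icc (a := (0 : ℝ)) (b := 2)).exists_bound_of_continuousOn
    hc.continuousOn
  refine ⟨max C 0, le_max_right _ _, fun t => ?_⟩
  by_cases ht : t ∈ Set.Icc (0 : ℝ) 2
  · exact ((le_abs_self _).trans (hC t ht)).trans (le_max_left _ _)
  · have h0 : deriv Real.smoothTransition (t - 1) = 0 := by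
      rw [Set.mem_Icc, not_and_or, not_le, not_le] at ht
      rcases ht with ht | ht
      · have : Real.smoothTransition =ᶠ[𝓝 (t - 1)] fun _ => 0 := by
          filter_upwards [eventually_lt_nhds (show t - 1 < 0 by linarith)] with s hs
          exact Real.smoothTransition.zero_of_nonpos hs.le
        rw [this.deriv_eq]; simp
      · have : Real.smoothTransition =ᶠ[𝓝 (t - 1)] fun _ => 1 := by
          filter_upwards [eventually_gt_nhds (show 1 < t - 1 by linarith)] with s hs
          exact Real.smoothTransition.one_of_one_le hs.le
        rw [this.deriv_eq]; simp
    rw [h0, abs_zero, zero_mul]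
    exact le_max_right _ _

theorem exists_deriv_cutoff_bound :
    ∃ C : ℝ, 0 ≤ C ∧ ∀ m, ∀ x ∈ Set.Ioo (0 : ℝ) 1, |deriv (cutoff m) x| * (x * (1 - x)) ≤ C := by
  obtain ⟨C, hC0, hC⟩ := exists_deriv_smoothTransition_bound
  refine ⟨C + C, by positivity, fun m x hx => ?_⟩
  have hd : ∀ t, HasDerivAt Real.smoothTransition (deriv Real.smoothTransition t) t := fun t =>
    ((Real.smoothTransition.contDiff (n := 1)).differentiable (by simp) t).hasDerivAt
  have h1 : HasDerivAt (fun x : ℝ => (m + 1) * x - 1) (m + 1 : ℝ) x := by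
    simpa using ((hasDerivAt_id x).const_mul (m + 1 : ℝ)).sub_const 1
  have h2 : HasDerivAt (fun x : ℝ => (m + 1) * (1 - x) - 1) (-(m + 1) : ℝ) x := by
    simpa using (((hasDerivAt_id x).const_sub 1).const_mul (m + 1 : ℝ)).sub_const 1
  have h := (((hd _).comp x h1).mul ((hd _).comp x h2)).deriv
  have h' : deriv (cutoff m) x = _ := h
  have hx1 : 0 < 1 - x := by linarith [hx.2]
  have b1 := hC ((m + 1) * x)
  have b2 := hC ((m + 1) * (1 - x))
  rw [abs_of_pos (mul_pos (by positivity) hx.1)] at b1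
  rw [abs_of_pos (mul_pos (by positivity) hx1)] at b2
  have s1 := Real.smoothTransition.le_one ((m + 1) * x - 1)
  have s2 := Real.smoothTransition.le_one ((m + 1) * (1 - x) - 1)
  have s3 := Real.smoothTransition.nonneg ((m + 1) * x - 1)
  have s4 := Real.smoothTransition.nonneg ((m + 1) * (1 - x) - 1)
  rw [h']
  simp only [Function.comp_apply]
  set a := deriv Real.smoothTransition ((m + 1) * x - 1)
  set b := deriv Real.smoothTransition ((m + 1) * (1 - x) - 1)
  set u := Real.smoothTransition ((m + 1) * x - 1)
  set v := Real.smoothTransition ((m + 1) * (1 - x) - 1)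
  have hm : (0 : ℝ) < m + 1 := by positivity
  have habs : |a * (m + 1) * v + u * (b * -(m + 1))| ≤ |a| * (m + 1) + |b| * (m + 1) := by
    refine (abs_add_le _ _).trans ?_
    simp only [abs_mul, abs_neg, abs_of_pos hm, abs_of_nonneg s3, abs_of_nonneg s4]
    have e1 : |a| * (m + 1) * v ≤ |a| * (m + 1) := mul_le_of_le_one_right (by positivity) s2
    have e2 : u * (|b| * (m + 1)) ≤ |b| * (m + 1) := mul_le_of_le_one_left (by positivity) s1
    linarith
  calc _ ≤ (|a| * (m + 1) + |b| * (m + 1)) * (x * (1 - x)) := by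
        gcongr
        exact (mul_pos hx.1 hx1).le
    _ = |a| * ((m + 1) * x) * (1 - x) + |b| * ((m + 1) * (1 - x)) * x := by ring
    _ ≤ C * 1 + C * 1 := add_le_add (mul_le_mul b1 (by linarith [hx.1]) hx1.le hC0)
        (mul_le_mul b2 hx.2.le hx.1.le hC0)
    _ = _ := by ring

end cutoff

theorem isSmoothFun_cutoff (m : ℕ) : IsSmoothFun fun z => (cutoff m z.1 : ℂ) :=
  IsSmoothFun.of_fst (g := fun x => (cutoff m x : ℂ))
    (Complex.ofRealCLM.contDiff.comp (contDiff_cutoff m))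

theorem dx_cutoff (m : ℕ) (z : ℝ × UnitAddCircle) :
    dx (fun z => (cutoff m z.1 : ℂ)) z = ((deriv (cutoff m) z.1 : ℝ) : ℂ) :=
  (((contDiff_cutoff m).differentiable (by simp) z.1).hasDerivAt.ofReal_comp).deriv

theorem isTestFun_cutoff_mul {ψ : ℝ × UnitAddCircle → ℂ} (hψ : IsSmoothFun ψ) (m : ℕ) :
    IsTestFun fun z => (cutoff m z.1 : ℂ) * ψ z := by
  refine ⟨(isSmoothFun_cutoff m).mul hψ, ?_⟩
  have : tsupport (fun z : ℝ × UnitAddCircle => (cutoff m z.1 : ℂ) * ψ z) ⊆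
      Prod.fst ⁻¹' tsupport (cutoff m) := by
    refine closure_minimal ?_ ((isClosed_tsupport _).preimage continuous_fst)
    intro z hz
    refine subset_tsupport _ fun h0 => hz ?_
    simp [h0]
  exact fun z hz => ⟨tsupport_cutoff m (this hz), trivial⟩

/-- A smooth function that vanishes over both end points is `O(x (1 - x))`. -/
theorem IsSmoothFun.exists_bound_of_boundary {ψ : ℝ × UnitAddCircle → ℂ} (hψ : IsSmoothFun ψ)
    (h0 : ∀ y, ψ (0, y) = 0) (h1 : ∀ y, ψ (1, y) = 0) :
    ∃ C : ℝ, 0 ≤ C ∧ ∀ z, z.1 ∈ Set.Icc (0 : ℝ) 1 → ‖ψ z‖ ≤ C * (z.1 * (1 - z.1)) := by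
  obtain ⟨C, hC0, hC⟩ := hψ.dx.bounded
  have key : ∀ y, ∀ s ∈ Set.Icc (0 : ℝ) 1, ∀ t ∈ Set.Icc (0 : ℝ) 1,
      ‖ψ (t, y) - ψ (s, y)‖ ≤ C * ‖t - s‖ := fun y s hs t ht =>
    (convex_Icc 0 1).norm_image_sub_le_of_norm_hasDerivWithin_le
      (fun x _ => (hψ.hasDerivAt_dx x y).hasDerivWithinAt) (fun x hx => hC (x, y) hx) hs ht
  refine ⟨2 * C, by positivity, ?_⟩
  rintro ⟨x, y⟩ hx
  simp only at hx ⊢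
  have e0 := key y 0 (by simp) x hx
  have e1 := key y 1 (by simp) x hx
  rw [h0, sub_zero, sub_zero, Real.norm_eq_abs, abs_of_nonneg hx.1] at e0
  rw [h1, sub_zero, Real.norm_eq_abs, abs_sub_comm, abs_of_nonneg (sub_nonneg.2 hx.2)] at e1
  rcases le_total x (1 / 2) with h | h
  · nlinarith [mul_nonneg hC0 hx.1]
  · nlinarith [mul_nonneg hC0 (sub_nonneg.2 hx.2)]

section weak

variable {f g : ℝ × UnitAddCircle → Spin}

theorem tendsto_integral_cutoff {h : ℝ × UnitAddCircle → Spin} (hh : Integrable h cylMeasure) :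
    Tendsto (fun m => ∫ z, (cutoff m z.1 : ℂ) • h z ∂cylMeasure) atTop
      (𝓝 (∫ z, h z ∂cylMeasure)) := by
  refine tendsto_integral_of_dominated_convergence (fun z => ‖h z‖) (fun m => ?_) hh.norm
    (fun m => Eventually.of_forall fun z => ?_) ?_
  · exact ((isSmoothFun_cutoff m).continuous.aestronglyMeasurable).smul hh.1
  · rw [norm_smul]
    exact mul_le_of_le_one_left (norm_nonneg _) (norm_cutoff_le m _)
  · filter_upwards [ae_cyl_mem_Ioo] with z hz
    refine tendsto_const_nhds.congr' ?_
    filter_upwards [eventually_cutoff hz] with m hm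
    simp [hm.1]

theorem HasWeakDx.integral_of_boundary (hf : MemLp f 2 cylMeasure) (hg : HasWeakDx f g)
    {ψ : ℝ × UnitAddCircle → ℂ} (hψ : IsSmoothFun ψ) (h0 : ∀ y, ψ (0, y) = 0)
    (h1 : ∀ y, ψ (1, y) = 0) :
    ∫ z, (dx ψ z • f z + ψ z • g z) ∂cylMeasure = 0 := by
  have hf1 := integrable_of_memLp hf
  have i1 := integrable_smul_smooth hf hψ.dx
  have i2 := integrable_smul_smooth hg.1 hψ
  obtain ⟨C, hC0, hC⟩ := hψ.exists_bound_of_boundary h0 h1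
  obtain ⟨C', hC'0, hC'⟩ := exists_deriv_cutoff_bound
  -- The derivative of the cutoff blows up like `1 / (x (1 - x))`, which `ψ` compensates.
  have hbd : ∀ m, ∀ᵐ z ∂cylMeasure,
      ‖(((deriv (cutoff m) z.1 : ℝ) : ℂ) * ψ z) • f z‖ ≤ C * C' * ‖f z‖ := by
    intro m
    filter_upwards [ae_cyl_mem_Ioo] with z hz
    rw [norm_smul]
    refine mul_le_mul_of_nonneg_right ?_ (norm_nonneg _)
    rw [norm_mul, Complex.norm_real, Real.norm_eq_abs]
    calc _ ≤ |deriv (cutoff m) z.1| * (C * (z.1 * (1 - z.1))) := by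
          gcongr
          exact hC z ⟨hz.1.le, hz.2.le⟩
      _ = C * (|deriv (cutoff m) z.1| * (z.1 * (1 - z.1))) := by ring
      _ ≤ _ := by gcongr; exact hC' m _ hz
  have hms : ∀ m, AEStronglyMeasurable (fun z => (((deriv (cutoff m) z.1 : ℝ) : ℂ) * ψ z) • f z)
      cylMeasure := by
    intro m
    have hc : Continuous fun z : ℝ × UnitAddCircle => ((deriv (cutoff m) z.1 : ℝ) : ℂ) * ψ z :=
      (Complex.continuous_ofReal.comp (((contDiff_cutoff m).continuous_deriv (by simp)).comp
        continuous_fst)).mul hψ.continuous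
    exact hc.aestronglyMeasurable.smul hf.1
  have i3 : ∀ m, Integrable (fun z => (((deriv (cutoff m) z.1 : ℝ) : ℂ) * ψ z) • f z) cylMeasure :=
    fun m => (hf1.norm.const_mul (C * C')).mono' (hms m) (hbd m)
  have t0 : Tendsto (fun m => ∫ z, (((deriv (cutoff m) z.1 : ℝ) : ℂ) * ψ z) • f z ∂cylMeasure) atTop
      (𝓝 (∫ _, (0 : Spin) ∂cylMeasure)) := by
    refine tendsto_integral_of_dominated_convergence (fun z => C * C' * ‖f z‖) hms
      (hf1.norm.const_mul _) hbd ?_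
    filter_upwards [ae_cyl_mem_Ioo] with z hz
    refine tendsto_const_nhds.congr' ?_
    filter_upwards [eventually_cutoff hz] with m hm
    simp [hm.2]
  have t1 := tendsto_integral_cutoff (i1.add i2)
  have heq : ∀ m, ∫ z, (cutoff m z.1 : ℂ) • (dx ψ z • f z + ψ z • g z) ∂cylMeasure =
      -∫ z, (((deriv (cutoff m) z.1 : ℝ) : ℂ) * ψ z) • f z ∂cylMeasure := by
    intro m
    have ht := isTestFun_cutoff_mul hψ m
    have h2 := hg.2 _ ht
    have i4 := integrable_smul_smooth hf ht.1.dx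
    have i5 := integrable_smul_smooth hg.1 ht.1
    rw [← sub_eq_zero, sub_neg_eq_add] at h2 ⊢
    rw [← integral_add i4 i5] at h2
    rw [← integral_add _ (i3 m), ← h2]
    · refine integral_congr_ae (Eventually.of_forall fun z => ?_)
      simp only
      rw [(isSmoothFun_cutoff m).dx_mul hψ, dx_cutoff]
      module
    · exact (integrable_smul_smooth (E := Spin) (f := f) hf
        ((isSmoothFun_cutoff m).mul hψ.dx)).add
        i5 |>.congr (Eventually.of_forall fun z => by simp only [Pi.add_apply]; module)
  have t2 := t1.congr heq
  have := tendsto_nhds_unique t2 t0.neg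
  simpa using this

theorem HasWeakDy.integral_smooth (hf : MemLp f 2 cylMeasure) (hg : HasWeakDy f g)
    {ψ : ℝ × UnitAddCircle → ℂ} (hψ : IsSmoothFun ψ) :
    ∫ z, dy ψ z • f z ∂cylMeasure = -∫ z, ψ z • g z ∂cylMeasure := by
  have i1 := integrable_smul_smooth hf hψ.dy
  have i2 := integrable_smul_smooth hg.1 hψ
  have t1 := tendsto_integral_cutoff i1
  have t2 := (tendsto_integral_cutoff i2).neg
  refine tendsto_nhds_unique t1 (t2.congr fun m => ?_)
  have h := hg.2 _ (isTestFun_cutoff_mul hψ m)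
  simp only [smul_smul]
  rw [← h]
  refine integral_congr_ae (Eventually.of_forall fun z => ?_)
  simp only
  rw [(isSmoothFun_cutoff m).dy_mul hψ, dy_of_fst (fun x => (cutoff m x : ℂ)), zero_mul, zero_add]

theorem HasWeakDx.unique {g' : ℝ × UnitAddCircle → Spin} (hg : HasWeakDx f g)
    (hg' : HasWeakDx f g') : g =ᵐ[cylMeasure] g' := by
  have h := ae_eq_zero_of_test (hg.1.sub hg'.1) fun φ hφ => by
    have i1 := integrable_smul_smooth hg.1 hφ.1
    have i2 := integrable_smul_smooth hg'.1 hφ.1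
    simp only [Pi.sub_apply, smul_sub]
    rw [integral_sub i1 i2, sub_eq_zero, ← neg_inj, ← hg.2 φ hφ, hg'.2 φ hφ]
  filter_upwards [h] with z hz using sub_eq_zero.1 hz

theorem HasWeakDy.unique {g' : ℝ × UnitAddCircle → Spin} (hg : HasWeakDy f g)
    (hg' : HasWeakDy f g') : g =ᵐ[cylMeasure] g' := by
  have h := ae_eq_zero_of_test (hg.1.sub hg'.1) fun φ hφ => by
    have i1 := integrable_smul_smooth hg.1 hφ.1
    have i2 := integrable_smul_smooth hg'.1 hφ.1
    simp only [Pi.sub_apply, smul_sub]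
    rw [integral_sub i1 i2, sub_eq_zero, ← neg_inj, ← hg.2 φ hφ, hg'.2 φ hφ]
  filter_upwards [h] with z hz using sub_eq_zero.1 hz

theorem memLp_integral_fst (hf : MemLp f 2 cylMeasure) :
    MemLp (fun y => ∫ x in Set.Icc (0 : ℝ) 1, f (x, y)) 2 volume := by
  have h : MemLp (fun w : UnitAddCircle × ℝ => f w.swap) 2
      ((volume : Measure UnitAddCircle).prod (volume.restrict (Set.Icc (0 : ℝ) 1))) :=
    hf.comp_measurePreserving Measure.measurePreserving_swap
  exact memLp_integral_snd h

/-- The boundary value on `{1} × 𝕋`, from `d(x f) = f + x f'`. -/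
def trace₁ (f g : ℝ × UnitAddCircle → Spin) (y : UnitAddCircle) : Spin :=
  ∫ x in Set.Icc (0 : ℝ) 1, (f (x, y) + (x : ℂ) • g (x, y))

/-- The boundary value on `{0} × 𝕋`, from `d((1 - x) f) = -f + (1 - x) f'`. -/
def trace₀ (f g : ℝ × UnitAddCircle → Spin) (y : UnitAddCircle) : Spin :=
  ∫ x in Set.Icc (0 : ℝ) 1, (f (x, y) - (1 - x : ℂ) • g (x, y))

theorem isSmoothFun_fst : IsSmoothFun fun z => (z.1 : ℂ) :=
  IsSmoothFun.of_fst (g := fun x => (x : ℂ)) Complex.ofRealCLM.contDiff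

theorem isSmoothFun_one_sub_fst : IsSmoothFun fun z => (1 - z.1 : ℂ) :=
  IsSmoothFun.of_fst (g := fun x => (1 - x : ℂ)) (contDiff_const.sub Complex.ofRealCLM.contDiff)

theorem memLp_trace₁ (hf : MemLp f 2 cylMeasure) (hg : MemLp g 2 cylMeasure) :
    MemLp (trace₁ f g) 2 volume :=
  memLp_integral_fst (f := fun z => f z + (z.1 : ℂ) • g z)
    (hf.add (memLp_smul_smooth hg isSmoothFun_fst))

theorem memLp_trace₀ (hf : MemLp f 2 cylMeasure) (hg : MemLp g 2 cylMeasure) :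
    MemLp (trace₀ f g) 2 volume :=
  memLp_integral_fst (f := fun z => f z - (1 - z.1 : ℂ) • g z)
    (hf.sub (memLp_smul_smooth hg isSmoothFun_one_sub_fst))

theorem integral_smul_integral_fst (hf : MemLp f 2 cylMeasure) {φ : ℝ × UnitAddCircle → ℂ}
    (hφ : IsSmoothFun φ) (s : ℝ) :
    ∫ y, φ (s, y) • (∫ x in Set.Icc (0 : ℝ) 1, f (x, y)) =
      ∫ z, φ (s, z.2) • f z ∂cylMeasure := by
  rw [integral_cyl_eq (integrable_smul_smooth hf (hφ.slice_fst s))]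
  simp only [integral_smul]

/-- Every function with a weak derivative in `L²` has boundary values. Subtracting from a smooth
function the affine interpolation of its boundary values reduces the Gauss-Green formula to
functions that vanish at the boundary. -/
theorem HasWeakDx.gauss_green (hf : MemLp f 2 cylMeasure) (hg : HasWeakDx f g)
    {φ : ℝ × UnitAddCircle → ℂ} (hφ : IsSmoothFun φ) :
    ∫ z, (dx φ z • f z + φ z • g z) ∂cylMeasure =
      (∫ y, φ (1, y) • trace₁ f g y) - ∫ y, φ (0, y) • trace₀ f g y := by
  have m1 : MemLp (fun z => f z + (z.1 : ℂ) • g z) 2 cylMeasure :=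
    hf.add (memLp_smul_smooth hg.1 isSmoothFun_fst)
  have m0 : MemLp (fun z => f z - (1 - z.1 : ℂ) • g z) 2 cylMeasure :=
    hf.sub (memLp_smul_smooth hg.1 isSmoothFun_one_sub_fst)
  have e1 := integral_smul_integral_fst m1 hφ 1
  have e0 := integral_smul_integral_fst m0 hφ 0
  have s1 : IsSmoothFun fun z => (z.1 : ℂ) * φ (1, z.2) := isSmoothFun_fst.mul (hφ.slice_fst 1)
  have s0 : IsSmoothFun fun z => (1 - z.1 : ℂ) * φ (0, z.2) :=
    isSmoothFun_one_sub_fst.mul (hφ.slice_fst 0)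
  have hs := (hφ.sub s1).sub s0
  have key := hg.integral_of_boundary hf hs (fun y => by simp) (fun y => by simp)
  have d1 : ∀ z : ℝ × UnitAddCircle, dx (fun z => (z.1 : ℂ)) z = 1 := fun z =>
    (Complex.ofRealCLM.hasDerivAt (x := z.1)).deriv
  have d0 : ∀ z : ℝ × UnitAddCircle, dx (fun z => (1 - z.1 : ℂ)) z = -1 := fun z =>
    ((Complex.ofRealCLM.hasDerivAt (x := z.1)).const_sub 1).deriv
  have hd : ∀ z, dx (fun z => φ z - (z.1 : ℂ) * φ (1, z.2) - (1 - z.1 : ℂ) * φ (0, z.2)) z =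
      dx φ z - φ (1, z.2) + φ (0, z.2) := by
    intro z
    rw [(hφ.sub s1).dx_sub s0, hφ.dx_sub s1, isSmoothFun_fst.dx_mul (hφ.slice_fst 1),
      isSmoothFun_one_sub_fst.dx_mul (hφ.slice_fst 0), d1, d0,
      dx_of_snd (fun y => φ (1, y)), dx_of_snd (fun y => φ (0, y))]
    ring
  have i1 := integrable_smul_smooth m1 (hφ.slice_fst 1)
  have i0 := integrable_smul_smooth m0 (hφ.slice_fst 0)
  have ia : Integrable (fun z => dx φ z • f z + φ z • g z) cylMeasure :=
    (integrable_smul_smooth hf hφ.dx).add (integrable_smul_smooth hg.1 hφ)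
  have i10 : Integrable (fun z => φ (1, z.2) • (f z + (z.1 : ℂ) • g z) -
      φ (0, z.2) • (f z - (1 - z.1 : ℂ) • g z)) cylMeasure := i1.sub i0
  have e1' : ∫ y, φ (1, y) • trace₁ f g y = _ := e1
  have e0' : ∫ y, φ (0, y) • trace₀ f g y = _ := e0
  rw [e1', e0', ← sub_eq_zero, ← integral_sub i1 i0, ← integral_sub ia i10, ← key]
  refine integral_congr_ae (Eventually.of_forall fun z => ?_)
  simp only [hd]
  module

theorem integrable_smul_trace {u : UnitAddCircle → Spin} (hu : MemLp u 2 volume)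
    {φ : UnitAddCircle → ℂ} (hφ : Continuous φ) : Integrable fun y => φ y • u y := by
  obtain ⟨C, hC⟩ := isCompact_univ.exists_bound_of_continuousOn hφ.continuousOn
  exact integrable_smul_of_norm_le (hu.integrable one_le_two) hφ.aestronglyMeasurable
    fun y => hC y trivial

/-- The boundary term of `HasTraces`, in which the second integral is a constant under the
first one; the circle has total measure one. -/
theorem integral_sub_trace {u₀ u₁ : UnitAddCircle → Spin} (hu : MemLp u₁ 2 volume)
    {φ : ℝ × UnitAddCircle → ℂ} (hφ : IsSmoothFun φ) :
    ∫ y, φ (1, y) • u₁ y - ∫ y, φ (0, y) • u₀ y =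
      (∫ y, φ (1, y) • u₁ y) - ∫ y, φ (0, y) • u₀ y := by
  have hi : Integrable fun y => φ (1, y) • u₁ y :=
    integrable_smul_trace hu (hφ.continuous.comp (Continuous.prodMk_right 1))
  rw [integral_sub hi (integrable_const _)]
  simp

theorem HasWeakDx.hasTraces (hf : MemLp f 2 cylMeasure) (hg : HasWeakDx f g) :
    HasTraces f (trace₀ f g) (trace₁ f g) := by
  have h1 := memLp_trace₁ hf hg.1
  refine ⟨memLp_trace₀ hf hg.1, h1, g, hg, fun φ hφ => ?_⟩
  rw [integral_sub_trace h1 hφ, hg.gauss_green hf hφ]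

/-- The transition function between the boundary values over `0` and `1` in the slice of `p`. -/
def twist (c : ℕ) (ν : ℝ) (p : ℤ) (y : UnitAddCircle) : ℂ :=
  fourier (c * p) (y - ((p * ν : ℝ) : UnitAddCircle))

theorem conj_twist_mul (c : ℕ) (ν : ℝ) (p : ℤ) (y : UnitAddCircle) :
    conj (twist c ν p y) * twist c ν p y = 1 := conj_fourier_mul_self _ _

theorem isSmoothFun_twist (c : ℕ) (ν : ℝ) (p : ℤ) : IsSmoothFun fun z => twist c ν p z.2 := by
  have := (IsSmoothFun.fourier (c * p)).translate 0 (p * ν)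
  exact this

/-- Smooth functions with the boundary condition dual to that of the slice of `p`. -/
def IsDualTest (c : ℕ) (ν : ℝ) (p : ℤ) (φ : ℝ × UnitAddCircle → ℂ) : Prop :=
  IsSmoothFun φ ∧ ∀ y, φ (0, y) = twist c ν p y * φ (1, y)

/-- `g` is the weak derivative `∂f/∂x` of a section `f` of the line bundle over the torus whose
transition function is `twist c ν p`: the test functions need not vanish at the boundary. -/
def WeakQP (c : ℕ) (ν : ℝ) (p : ℤ) (f g : ℝ × UnitAddCircle → Spin) : Prop :=
  MemLp g 2 cylMeasure ∧ ∀ φ, IsDualTest c ν p φ →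
    ∫ z, (dx φ z • f z + φ z • g z) ∂cylMeasure = 0

variable {c : ℕ} {ν : ℝ} {p : ℤ}

theorem IsTestFun.isDualTest {φ : ℝ × UnitAddCircle → ℂ} (hφ : IsTestFun φ) :
    IsDualTest c ν p φ := by
  refine ⟨hφ.1, fun y => ?_⟩
  have h0 : φ (0, y) = 0 := by
    by_contra h
    exact lt_irrefl _ (hφ.2 (subset_tsupport _ h)).1.1
  have h1 : φ (1, y) = 0 := by
    by_contra h
    exact lt_irrefl _ (hφ.2 (subset_tsupport _ h)).1.2
  rw [h0, h1, mul_zero]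

theorem WeakQP.hasWeakDx (hf : MemLp f 2 cylMeasure) (h : WeakQP c ν p f g) : HasWeakDx f g := by
  refine ⟨h.1, fun φ hφ => ?_⟩
  have := h.2 φ hφ.isDualTest
  rw [integral_add (integrable_smul_smooth hf hφ.1.dx) (integrable_smul_smooth h.1 hφ.1)] at this
  exact eq_neg_of_add_eq_zero_left this

theorem HasTraces.weakQP {u₀ u₁ : UnitAddCircle → Spin} (h : HasTraces f u₀ u₁)
    (hu : ∀ᵐ y, u₀ y = conj (twist c ν p y) • u₁ y) (hf : HasWeakDx f g) : WeakQP c ν p f g := by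
  obtain ⟨h0, h1, g', hg', hgg⟩ := h
  refine ⟨hf.1, fun φ hφ => ?_⟩
  have e : ∫ z, (dx φ z • f z + φ z • g z) ∂cylMeasure =
      ∫ z, (dx φ z • f z + φ z • g' z) ∂cylMeasure := by
    refine integral_congr_ae ?_
    filter_upwards [hf.unique hg'] with z hz
    rw [hz]
  rw [e, hgg φ hφ.1, integral_sub_trace h1 hφ.1, sub_eq_zero]
  refine integral_congr_ae ?_
  filter_upwards [hu] with y hy
  rw [hy, hφ.2, smul_smul, mul_right_comm, mul_comm (twist c ν p y), conj_twist_mul, one_mul]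

theorem WeakQP.traces_eq (hf : MemLp f 2 cylMeasure) (h : WeakQP c ν p f g) :
    ∀ᵐ y, trace₀ f g y = conj (twist c ν p y) • trace₁ f g y := by
  have hd := h.hasWeakDx hf
  have m1 := memLp_trace₁ hf hd.1
  have m0 := memLp_trace₀ hf hd.1
  have ct : Continuous (twist c ν p) := by
    unfold twist; fun_prop
  have cct : Continuous fun y => conj (twist c ν p y) := Complex.continuous_conj.comp ct
  have bt : ∀ y, ‖conj (twist c ν p y)‖ ≤ 1 := fun y => by
    rw [RCLike.norm_conj]; exact (norm_fourier _ _).le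
  have m1' : MemLp (fun y => conj (twist c ν p y) • trace₁ f g y) 2 volume :=
    memLp_smul_of_norm_le m1 cct.aestronglyMeasurable bt
  have key := ae_eq_zero_of_fourier (m0.sub m1') fun n => ?_
  · filter_upwards [key] with y hy using sub_eq_zero.1 hy
  -- The test function interpolates between `e(ny)` over `0` and its transform over `1`.
  let S : ℝ → ℂ := fun x => (Real.smoothTransition x : ℂ)
  have hS : ContDiff ℝ ∞ S := Complex.ofRealCLM.contDiff.comp Real.smoothTransition.contDiff
  have hS' : ContDiff ℝ ∞ fun x => S (1 - x) := hS.comp (contDiff_const.sub contDiff_id)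
  let φ : ℝ × UnitAddCircle → ℂ := fun z =>
    S (1 - z.1) * fourier n z.2 + S z.1 * (conj (twist c ν p z.2) * fourier n z.2)
  have hφ : IsSmoothFun φ := ((IsSmoothFun.of_fst hS').mul (IsSmoothFun.fourier n)).add
    ((IsSmoothFun.of_fst hS).mul ((isSmoothFun_twist c ν p).star.mul (IsSmoothFun.fourier n)))
  have hφ0 : ∀ y, φ (0, y) = fourier n y := fun y => by
    simp [φ, S, Real.smoothTransition.zero]
  have hφ1 : ∀ y, φ (1, y) = conj (twist c ν p y) * fourier n y := fun y => by
    simp [φ, S, Real.smoothTransition.zero]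
  have h2 := h.2 φ ⟨hφ, fun y => by
    rw [hφ0, hφ1, ← mul_assoc, mul_comm (twist c ν p y), conj_twist_mul, one_mul]⟩
  rw [hd.gauss_green hf hφ] at h2
  simp only [hφ0, hφ1] at h2
  simp only [Pi.sub_apply, smul_sub]
  rw [integral_sub (integrable_smul_trace m0 (fourier n).continuous)
    (integrable_smul_trace m1' (fourier n).continuous), ← neg_eq_zero, neg_sub, ← h2]
  congr 1
  refine integral_congr_ae (Eventually.of_forall fun y => ?_)
  simp only [smul_smul]
  rw [mul_comm]

end weak

end QHM

/-! ### Hermite functions -/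

namespace QHM

open Filter Topology Polynomial

/-- The function `P(t) exp(-κ t² / 2)`. -/
def gaussPoly (κ : ℝ) (P : ℝ[X]) (t : ℝ) : ℝ := P.eval t * Real.exp (-(κ * t ^ 2 / 2))

section gaussPoly

variable {κ : ℝ}

theorem contDiff_gaussPoly (κ : ℝ) (P : ℝ[X]) : ContDiff ℝ ∞ (gaussPoly κ P) :=
  (Polynomial.contDiff_aeval P ∞).mul (by fun_prop)

theorem hasDerivAt_gaussPoly (κ : ℝ) (P : ℝ[X]) (t : ℝ) :
    HasDerivAt (gaussPoly κ P) (gaussPoly κ (derivative P - C κ * X * P) t) t := by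
  have h1 : HasDerivAt (fun t : ℝ => -(κ * t ^ 2 / 2)) (-(κ * t)) t := by
    have := (((hasDerivAt_pow 2 t).const_mul κ).div_const 2).neg
    refine this.congr_deriv ?_
    push_cast
    ring
  have h := (P.hasDerivAt t).mul h1.exp
  refine h.congr_deriv ?_
  simp only [gaussPoly, eval_sub, eval_mul, eval_C, eval_X]
  ring

theorem gaussPoly_add (P Q : ℝ[X]) (t : ℝ) :
    gaussPoly κ (P + Q) t = gaussPoly κ P t + gaussPoly κ Q t := by
  simp [gaussPoly, add_mul]

theorem gaussPoly_C_mul (a : ℝ) (P : ℝ[X]) (t : ℝ) :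
    gaussPoly κ (C a * P) t = a * gaussPoly κ P t := by
  simp [gaussPoly, mul_assoc]

theorem gaussPoly_X_mul (P : ℝ[X]) (t : ℝ) :
    gaussPoly κ (X * P) t = t * gaussPoly κ P t := by
  simp [gaussPoly, mul_assoc]

theorem exists_eval_bound (P : ℝ[X]) : ∃ C : ℝ, 0 ≤ C ∧ ∀ t, |P.eval t| ≤ C * Real.exp |t| := by
  induction P using Polynomial.induction_on' with
  | add P Q hP hQ =>
    obtain ⟨C₁, h1, h1'⟩ := hP
    obtain ⟨C₂, h2, h2'⟩ := hQ
    refine ⟨C₁ + C₂, by positivity, fun t => ?_⟩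
    rw [eval_add, add_mul]
    exact (abs_add_le _ _).trans (add_le_add (h1' t) (h2' t))
  | monomial n a =>
    refine ⟨|a| * n.factorial, by positivity, fun t => ?_⟩
    rw [eval_monomial, abs_mul, abs_pow, mul_assoc]
    gcongr
    have h := Real.pow_div_factorial_le_exp (x := |t|) (abs_nonneg t) n
    rwa [div_le_iff₀' (by positivity)] at h

/-- Gaussian decay beats polynomial and exponential growth. -/
theorem exists_decay (hκ : 0 < κ) (P : ℝ[X]) (a : ℝ) : ∃ C : ℝ, 0 ≤ C ∧ ∀ t : ℝ,
    Real.exp (a * |t|) * |gaussPoly κ P t| ≤ C * (1 + t ^ 2)⁻¹ := by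
  obtain ⟨C, hC0, hC⟩ := exists_eval_bound ((1 + X ^ 2) * P)
  refine ⟨C * Real.exp ((a + 1) ^ 2 / (2 * κ)), by positivity, fun t => ?_⟩
  have h1 : 0 < 1 + t ^ 2 := by positivity
  rw [← div_eq_mul_inv, le_div_iff₀ h1]
  have h2 := hC t
  rw [eval_mul, abs_mul, show eval t (1 + X ^ 2 : ℝ[X]) = 1 + t ^ 2 by simp, abs_of_pos h1] at h2
  have h3 : Real.exp (a * |t|) * Real.exp |t| * Real.exp (-(κ * t ^ 2 / 2)) ≤
      Real.exp ((a + 1) ^ 2 / (2 * κ)) := by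
    rw [← Real.exp_add, ← Real.exp_add]
    refine Real.exp_le_exp.2 ?_
    rw [le_div_iff₀ (by positivity), ← sq_abs t]
    nlinarith [sq_nonneg (κ * |t| - (a + 1))]
  rw [gaussPoly, abs_mul, Real.abs_exp]
  calc _ = Real.exp (a * |t|) * Real.exp (-(κ * t ^ 2 / 2)) * ((1 + t ^ 2) * |eval t P|) := by ring
    _ ≤ Real.exp (a * |t|) * Real.exp (-(κ * t ^ 2 / 2)) * (C * Real.exp |t|) := by gcongr
    _ = C * (Real.exp (a * |t|) * Real.exp |t| * Real.exp (-(κ * t ^ 2 / 2))) := by ring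
    _ ≤ _ := by gcongr

theorem exists_gaussPoly_bound (hκ : 0 < κ) (P : ℝ[X]) : ∃ C : ℝ, 0 ≤ C ∧ ∀ t : ℝ,
    |gaussPoly κ P t| ≤ C * (1 + t ^ 2)⁻¹ := by
  obtain ⟨C, h, h'⟩ := exists_decay hκ P 0
  exact ⟨C, h, by simpa using h'⟩

theorem integrable_gaussPoly (hκ : 0 < κ) (P : ℝ[X]) : Integrable (gaussPoly κ P) := by
  obtain ⟨C, -, hC⟩ := exists_gaussPoly_bound hκ P
  exact (integrable_inv_one_add_sq.const_mul C).mono'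
    (contDiff_gaussPoly κ P).continuous.aestronglyMeasurable (Eventually.of_forall hC)

theorem gaussPoly_mul (P Q : ℝ[X]) (t : ℝ) :
    gaussPoly κ P t * gaussPoly κ Q t = gaussPoly (2 * κ) (P * Q) t := by
  simp only [gaussPoly, eval_mul]
  rw [mul_mul_mul_comm, ← Real.exp_add]
  ring_nf

/-- The inner product of `P(t) exp(-κ t² / 2)` and `Q(t) exp(-κ t² / 2)` in `L²(ℝ)`. -/
def gaussInner (κ : ℝ) (P Q : ℝ[X]) : ℝ := ∫ t, gaussPoly κ P t * gaussPoly κ Q t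

theorem integrable_gaussPoly_mul (hκ : 0 < κ) (P Q : ℝ[X]) :
    Integrable fun t => gaussPoly κ P t * gaussPoly κ Q t := by
  simp only [gaussPoly_mul]
  exact integrable_gaussPoly (by positivity) _

theorem gaussInner_C_mul (a : ℝ) (P Q : ℝ[X]) :
    gaussInner κ (C a * P) Q = a * gaussInner κ P Q := by
  simp only [gaussInner, gaussPoly_C_mul, mul_assoc, integral_const_mul]

theorem gaussInner_comm (P Q : ℝ[X]) : gaussInner κ P Q = gaussInner κ Q P := by
  simp only [gaussInner, mul_comm]

theorem gaussInner_C_mul_right (a : ℝ) (P Q : ℝ[X]) :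
    gaussInner κ P (C a * Q) = a * gaussInner κ P Q := by
  rw [gaussInner_comm, gaussInner_C_mul, gaussInner_comm]

/-- The creation operator `κ t - d/dt` on functions `P(t) exp(-κ t² / 2)`. The annihilation
operator `κ t + d/dt` is the derivative of `P`. -/
def creation (κ : ℝ) (P : ℝ[X]) : ℝ[X] := C (2 * κ) * X * P - derivative P

theorem derivative_creation (κ : ℝ) (P : ℝ[X]) :
    derivative (creation κ P) = creation κ (derivative P) + C (2 * κ) * P := by
  simp only [creation, derivative_sub, derivative_mul, derivative_C, derivative_X]
  ring

theorem creation_C_mul (a : ℝ) (P : ℝ[X]) : creation κ (C a * P) = C a * creation κ P := by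
  simp only [creation, derivative_C_mul]
  ring

theorem gaussInner_creation (hκ : 0 < κ) (P Q : ℝ[X]) :
    gaussInner κ (creation κ P) Q = gaussInner κ P (derivative Q) := by
  have h : ∀ t, HasDerivAt (gaussPoly (2 * κ) (P * Q))
      (gaussPoly κ P t * gaussPoly κ (derivative Q) t -
        gaussPoly κ (creation κ P) t * gaussPoly κ Q t) t := by
    intro t
    refine (hasDerivAt_gaussPoly (2 * κ) (P * Q) t).congr_deriv ?_
    rw [gaussPoly_mul, gaussPoly_mul]
    simp only [gaussPoly, creation, eval_sub, eval_mul, eval_C, eval_X, derivative_mul, eval_add]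
    ring
  have i1 := integrable_gaussPoly_mul hκ P (derivative Q)
  have i2 := integrable_gaussPoly_mul hκ (creation κ P) Q
  have := integral_eq_zero_of_hasDerivAt_of_integrable h (i1.sub i2)
    (integrable_gaussPoly (by positivity) _)
  rw [integral_sub i1 i2, sub_eq_zero] at this
  exact this.symm

theorem gaussInner_one_pos (hκ : 0 < κ) : 0 < gaussInner κ 1 1 := by
  have h : ∀ t, gaussPoly κ 1 t * gaussPoly κ 1 t = Real.exp (-κ * t ^ 2) := by
    intro t
    simp only [gaussPoly, eval_one, one_mul]
    rw [← Real.exp_add]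
    ring_nf
  simp only [gaussInner, h]
  rw [integral_gaussian]
  positivity

/-- The polynomial factors of the Hermite functions, an orthonormal basis of `L²(ℝ)`. -/
def hermitePoly (κ : ℝ) : ℕ → ℝ[X]
  | 0 => C (√(gaussInner κ 1 1))⁻¹
  | k + 1 => C (√(2 * κ * (k + 1)))⁻¹ * creation κ (hermitePoly κ k)

theorem creation_hermitePoly (hκ : 0 < κ) (k : ℕ) :
    creation κ (hermitePoly κ k) = C √(2 * κ * (k + 1)) * hermitePoly κ (k + 1) := by
  rw [hermitePoly, ← mul_assoc, ← C_mul, mul_inv_cancel₀ (by positivity), C_1, one_mul]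

theorem derivative_hermitePoly_zero : derivative (hermitePoly κ 0) = 0 := derivative_C

theorem derivative_hermitePoly_succ (hκ : 0 < κ) (k : ℕ) :
    derivative (hermitePoly κ (k + 1)) = C √(2 * κ * (k + 1)) * hermitePoly κ k := by
  have key : creation κ (derivative (hermitePoly κ k)) = C (2 * κ * k) * hermitePoly κ k := by
    induction k with
    | zero => simp [derivative_hermitePoly_zero, creation]
    | succ k ih =>
      have h0 : (0 : ℝ) ≤ 2 * κ * (k + 1) := by positivity
      rw [hermitePoly, derivative_C_mul, derivative_creation, ih, ← add_mul, ← C_add,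
        creation_C_mul, creation_C_mul]
      push_cast
      rw [show 2 * κ * (k : ℝ) + 2 * κ = 2 * κ * (k + 1) by ring]
      ring
  have hpos : (0 : ℝ) < 2 * κ * (k + 1) := by positivity
  rw [hermitePoly, derivative_C_mul, derivative_creation, key, ← add_mul, ← C_add, ← mul_assoc,
    ← C_mul]
  congr 2
  rw [inv_mul_eq_div, show 2 * κ * (k : ℝ) + 2 * κ = 2 * κ * (k + 1) by ring, Real.div_sqrt]

theorem gaussInner_hermitePoly (hκ : 0 < κ) (k l : ℕ) :
    gaussInner κ (hermitePoly κ k) (hermitePoly κ l) = if k = l then 1 else 0 := by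
  have hzero : ∀ l, gaussInner κ (hermitePoly κ 0) (hermitePoly κ (l + 1)) = 0 := by
    intro l
    rw [gaussInner_comm, hermitePoly.eq_2, gaussInner_C_mul, gaussInner_creation hκ,
      derivative_hermitePoly_zero]
    simp [gaussInner, gaussPoly]
  induction k generalizing l with
  | zero =>
    cases l with
    | zero =>
      have h := gaussInner_one_pos hκ
      rw [hermitePoly, ← mul_one (C _), gaussInner_C_mul, gaussInner_C_mul_right, if_pos rfl,
        ← mul_assoc, ← mul_inv, Real.mul_self_sqrt h.le, inv_mul_cancel₀ h.ne']
    | succ l => rw [hzero, if_neg (by omega)]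
  | succ k ih =>
    cases l with
    | zero => rw [gaussInner_comm, hzero, if_neg (by omega)]
    | succ l =>
      have hk : (0 : ℝ) < 2 * κ * (k + 1) := by positivity
      rw [hermitePoly, gaussInner_C_mul, gaussInner_creation hκ, derivative_hermitePoly_succ hκ,
        gaussInner_C_mul_right, ih]
      by_cases h : k = l
      · subst h
        rw [if_pos rfl, if_pos rfl, mul_one, inv_mul_cancel₀ (by positivity)]
      · rw [if_neg h, if_neg (by omega), mul_zero, mul_zero]

/-- The Hermite polynomials span all polynomials, since their span is stable under creation and
annihilation, hence under multiplication by the variable. -/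
theorem span_hermitePoly (hκ : 0 < κ) :
    Submodule.span ℝ (Set.range (hermitePoly κ)) = ⊤ := by
  set W := Submodule.span ℝ (Set.range (hermitePoly κ)) with hW
  have hmem : ∀ k, hermitePoly κ k ∈ W := fun k => Submodule.subset_span ⟨k, rfl⟩
  have hX : ∀ P ∈ W, X * P ∈ W := by
    intro P hP
    induction hP using Submodule.span_induction with
    | zero => simp
    | add P Q _ _ h1 h2 => rw [mul_add]; exact W.add_mem h1 h2
    | smul a P _ h => rw [mul_smul_comm]; exact W.smul_mem a h
    | mem P hP =>
      obtain ⟨k, rfl⟩ := hP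
      have h1 : X * hermitePoly κ k = (2 * κ)⁻¹ •
          (creation κ (hermitePoly κ k) + derivative (hermitePoly κ k)) := by
        rw [creation, sub_add_cancel, mul_assoc, ← smul_eq_C_mul, smul_smul,
          inv_mul_cancel₀ (by positivity), one_smul]
      rw [h1]
      refine W.smul_mem _ (W.add_mem ?_ ?_)
      · rw [creation_hermitePoly hκ, ← smul_eq_C_mul]
        exact W.smul_mem _ (hmem _)
      · cases k with
        | zero => rw [derivative_hermitePoly_zero]; exact W.zero_mem
        | succ k =>
          rw [derivative_hermitePoly_succ hκ, ← smul_eq_C_mul]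
          exact W.smul_mem _ (hmem _)
  rw [eq_top_iff]
  intro P _
  have h1 : (1 : ℝ[X]) ∈ W := by
    have h := W.smul_mem √(gaussInner κ 1 1) (hmem 0)
    have hpos := Real.sqrt_pos.2 (gaussInner_one_pos hκ)
    rwa [hermitePoly, smul_C, smul_eq_mul, mul_inv_cancel₀ hpos.ne', C_1] at h
  have hpow : ∀ n : ℕ, (X : ℝ[X]) ^ n ∈ W := by
    intro n
    induction n with
    | zero => simpa using h1
    | succ n ih => rw [pow_succ']; exact hX _ ih
  induction P using Polynomial.induction_on' with
  | add P Q h1 h2 => exact W.add_mem (h1 trivial) (h2 trivial)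
  | monomial n a =>
    rw [← C_mul_X_pow_eq_monomial, ← smul_eq_C_mul]
    exact W.smul_mem a (hpow n)

end gaussPoly

section completeness

variable {E : Type*} [NormedAddCommGroup E] [NormedSpace ℂ E] [CompleteSpace E]

theorem ae_eq_zero_of_fourier_eq_zero {G : ℝ → E} (hG : Integrable G)
    (h : ∀ ξ : ℝ, ∫ t : ℝ, Complex.exp (Complex.I * ξ * t) • G t = 0) : G =ᵐ[volume] 0 := by
  refine ae_eq_zero_of_integral_contDiff_smul_eq_zero hG.locallyIntegrable fun χ h1 h2 => ?_
  have hF : ∀ v, FourierTransform.fourier G v = 0 := by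
    intro v
    rw [Real.fourier_real_eq_integral_exp_smul]
    rw [← h (-2 * Real.pi * v)]
    congr 1
    ext t
    congr 2
    push_cast
    ring
  have hs : HasCompactSupport fun t => (χ t : ℂ) := h2.comp_left Complex.ofReal_zero
  let f : SchwartzMap ℝ ℂ := hs.toSchwartzMap (Complex.ofRealCLM.contDiff.comp h1)
  let ψ : SchwartzMap ℝ ℂ := FourierTransformInv.fourierInv f
  have hψ : FourierTransform.fourier ψ = f := FourierTransform.fourier_fourierInv_eq f
  have := VectorFourier.integral_fourierIntegral_smul_eq_flip (L := innerₗ ℝ)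
    (μ := volume) (ν := volume) (f := ψ) (g := G) Real.continuous_fourierChar
    continuous_inner ψ.integrable hG
  have e1 : ∫ x, χ x • G x = ∫ x, FourierTransform.fourier (ψ : ℝ → ℂ) x • G x := by
    refine integral_congr_ae (Eventually.of_forall fun x => ?_)
    have : FourierTransform.fourier (ψ : ℝ → ℂ) x = (χ x : ℂ) := by
      rw [← SchwartzMap.fourier_coe, hψ]; rfl
    simp only [this]
    rfl
  have e2 : ∫ x, FourierTransform.fourier (ψ : ℝ → ℂ) x • G x =
      ∫ x, ψ x • FourierTransform.fourier G x := by
    refine this.trans ?_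
    rw [flip_innerₗ]
    rfl
  rw [e1, e2]
  simp [hF]

/-- A function of at most exponential growth in the mean that is orthogonal to all products of
polynomials and a Gaussian vanishes: the power series of its Fourier integral is zero. -/
theorem ae_eq_zero_of_gaussPoly {κ : ℝ} {F : ℝ → E}
    (hF : ∀ a : ℝ, Integrable fun t => (Real.exp (a * |t|) * gaussPoly κ 1 t : ℂ) • F t)
    (h : ∀ P : ℝ[X], ∫ t, (gaussPoly κ P t : ℂ) • F t = 0) : F =ᵐ[volume] 0 := by
  have hG : Integrable fun t => (gaussPoly κ 1 t : ℂ) • F t := by simpa using hF 0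
  have key := ae_eq_zero_of_fourier_eq_zero hG fun ξ => ?_
  · filter_upwards [key] with t ht
    have h1 : (gaussPoly κ 1 t : ℂ) ≠ 0 := by
      rw [gaussPoly, eval_one, one_mul]
      exact_mod_cast (Real.exp_pos _).ne'
    exact (smul_eq_zero.1 ht).resolve_left h1
  have hs := hasSum_integral_of_dominated_convergence (μ := volume)
    (F := fun (n : ℕ) (t : ℝ) => ((n.factorial : ℂ)⁻¹ * (Complex.I * ξ * t) ^ n) •
      ((gaussPoly κ 1 t : ℂ) • F t))
    (f := fun t : ℝ => Complex.exp (Complex.I * ξ * t) • ((gaussPoly κ 1 t : ℂ) • F t))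
    (fun n t => ((|ξ| * |t|) ^ n / n.factorial) * ‖(gaussPoly κ 1 t : ℂ) • F t‖)
    (fun n => ?_) (fun n => Eventually.of_forall fun t => ?_)
    (Eventually.of_forall fun t => ?_) ?_ (Eventually.of_forall fun t => ?_)
  · have h0 : ∀ n : ℕ, ∫ t : ℝ, ((n.factorial : ℂ)⁻¹ * (Complex.I * ξ * t) ^ n) •
        ((gaussPoly κ 1 t : ℂ) • F t) = 0 := by
      intro n
      have h1 := h (X ^ n)
      have h2 : ∀ t : ℝ, ((n.factorial : ℂ)⁻¹ * (Complex.I * ξ * t) ^ n) •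
          ((gaussPoly κ 1 t : ℂ) • F t) = ((n.factorial : ℂ)⁻¹ * (Complex.I * ξ) ^ n) •
          ((gaussPoly κ (X ^ n) t : ℂ) • F t) := by
        intro t
        simp only [gaussPoly, eval_one, eval_pow, eval_X, one_mul, smul_smul]
        congr 1
        push_cast
        ring
      simp only [h2]
      rw [integral_smul, h1, smul_zero]
    simp only [h0] at hs
    exact hs.unique hasSum_zero
  · exact (Continuous.aestronglyMeasurable (by fun_prop)).smul hG.1
  · rw [norm_smul, norm_mul, norm_pow, norm_mul, norm_mul, norm_inv, Complex.norm_natCast,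
      Complex.norm_I, one_mul, Complex.norm_real, Complex.norm_real, Real.norm_eq_abs,
      Real.norm_eq_abs, div_eq_inv_mul]
  · exact (Real.summable_pow_div_factorial _).mul_right _
  · have h1 : ∀ t : ℝ, ∑' n : ℕ, ((|ξ| * |t|) ^ n / n.factorial) * ‖(gaussPoly κ 1 t : ℂ) • F t‖ =
        ‖(Real.exp (|ξ| * |t|) * gaussPoly κ 1 t : ℂ) • F t‖ := by
      intro t
      rw [tsum_mul_right, mul_smul, norm_smul (Real.exp (|ξ| * |t|) : ℂ), Complex.norm_real,
        Real.norm_eq_abs, Real.abs_exp, Real.exp_eq_exp_ℝ, NormedSpace.exp_eq_tsum_div]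
    simp only [h1]
    exact (hF |ξ|).norm
  · have h1 := (NormedSpace.expSeries_div_hasSum_exp (𝔸 := ℂ) (Complex.I * ξ * t)).smul_const
      ((gaussPoly κ 1 t : ℂ) • F t)
    rw [← Complex.exp_eq_exp_ℂ] at h1
    simpa only [div_eq_inv_mul] using h1

end completeness

end QHM

/-! ### Landau modes: theta functions with Gaussian profile -/

namespace QHM

open Filter Topology Polynomial

/-- The vector representing the functional `Φ ↦ ∫ φ Φ(·, ·, p)_s`. -/
def testVec (p : ℤ) {φ : ℝ × UnitAddCircle → ℂ} (hφ : IsSmoothFun φ) (s : Fin 2) : Hilb :=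
  ofSlice p (fun z => conj (φ z) • EuclideanSpace.single s (1 : ℂ))
    (memLp_smul_smooth (memLp_const _) hφ.star)

theorem inner_testVec (p : ℤ) {φ : ℝ × UnitAddCircle → ℂ} (hφ : IsSmoothFun φ) (s : Fin 2)
    (Φ : Hilb) : ⟪testVec p hφ s, Φ⟫_ℂ = (∫ z, φ z • slice Φ p z ∂cylMeasure) s := by
  have h1 := ContinuousLinearMap.integral_comp_comm (EuclideanSpace.proj s : Spin →L[ℂ] ℂ)
    (integrable_smul_smooth (Hilb.memLp_slice Φ p) hφ)
  rw [testVec, inner_ofSlice]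
  refine Eq.trans ?_ h1
  refine integral_congr_ae (Eventually.of_forall fun z => ?_)
  simp [EuclideanSpace.inner_single_left, mul_comm]

theorem integral_smul_slice_testVec (p q : ℤ) {φ ψ : ℝ × UnitAddCircle → ℂ}
    (hψ : IsSmoothFun ψ) (s : Fin 2) :
    ∫ z, φ z • slice (testVec q hψ s) p z ∂cylMeasure =
      if p = q then (∫ z, φ z * conj (ψ z) ∂cylMeasure) • EuclideanSpace.single s (1 : ℂ)
      else 0 := by
  have h := slice_ofSlice (p := q) (memLp_smul_smooth
    (memLp_const (EuclideanSpace.single s (1 : ℂ))) hψ.star) p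
  split_ifs with hp
  · rw [← integral_smul_const]
    refine integral_congr_ae ?_
    filter_upwards [h] with z hz
    rw [testVec, hz, if_pos hp, smul_smul]
  · rw [← integral_zero]
    refine integral_congr_ae ?_
    filter_upwards [h] with z hz
    rw [testVec, hz, if_neg hp, Pi.zero_apply, smul_zero]

theorem inner_testVec_testVec (p q : ℤ) {φ ψ : ℝ × UnitAddCircle → ℂ} (hφ : IsSmoothFun φ)
    (hψ : IsSmoothFun ψ) (s t : Fin 2) :
    ⟪testVec p hφ s, testVec q hψ t⟫_ℂ =
      if p = q ∧ s = t then ∫ z, φ z * conj (ψ z) ∂cylMeasure else 0 := by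
  rw [inner_testVec, integral_smul_slice_testVec]
  by_cases hp : p = q
  · by_cases hs : s = t <;> simp [hp, hs]
  · simp [hp]

theorem norm_testVec_le (p : ℤ) {φ : ℝ × UnitAddCircle → ℂ} (hφ : IsSmoothFun φ) (s : Fin 2)
    {C : ℝ} (hC0 : 0 ≤ C) (hC : ∀ z, z.1 ∈ Set.Icc (0 : ℝ) 1 → ‖φ z‖ ≤ C) :
    ‖testVec p hφ s‖ ≤ C := by
  refine abs_le_of_sq_le_sq' ?_ hC0 |>.2
  have h1 := norm_integral_le_of_norm_le_const (μ := cylMeasure) (f := fun z => φ z * conj (φ z))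
    (C := C ^ 2) (by
      filter_upwards [ae_cyl_mem] with z hz
      rw [norm_mul, RCLike.norm_conj, ← sq]
      exact pow_le_pow_left₀ (norm_nonneg _) (hC z hz) 2)
  have h2 := inner_testVec_testVec p p hφ hφ s s
  rw [if_pos ⟨rfl, rfl⟩, inner_self_eq_norm_sq_to_K] at h2
  rw [← h2] at h1
  simpa using h1

/-- The frequency of the harmonic oscillator on the slice of `p`. -/
def landauFreq (c : ℕ) (p : ℤ) : ℝ := 2 * Real.pi * c * |(p : ℝ)|

theorem landauFreq_pos {c : ℕ} (hc : 0 < c) {p : ℤ} (hp : p ≠ 0) : 0 < landauFreq c p := by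
  have : (0 : ℝ) < c := by exact_mod_cast hc
  have : 0 < |(p : ℝ)| := abs_pos.2 (by exact_mod_cast hp)
  unfold landauFreq
  positivity

/-- The centre of the Gaussian in the theta function of residue `j`. -/
def landauShift (c : ℕ) (μ : ℝ) (p j : ℤ) : ℝ := j / (c * p) + p * μ

/-- The terms of the complex conjugate of the theta function
`∑_l conj (e(cp²νl)) P(x - l - θ) exp(-κ(x - l - θ)² / 2) e((j + cpl)y)`. -/
def landauTest (c : ℕ) (μ ν : ℝ) (p j : ℤ) (P : ℝ[X]) (l : ℤ) (z : ℝ × UnitAddCircle) : ℂ :=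
  (fourier l ((c * p ^ 2 * ν : ℝ) : UnitAddCircle) *
    gaussPoly (landauFreq c p) P (z.1 - l - landauShift c μ p j)) *
      fourier (-(j + c * p * l)) z.2

section landau

variable {c : ℕ} {μ ν : ℝ} {p j : ℤ}

theorem isSmoothFun_landauTest (P : ℝ[X]) (l : ℤ) : IsSmoothFun (landauTest c μ ν p j P l) := by
  refine IsSmoothFun.mul ?_ (IsSmoothFun.fourier _)
  refine IsSmoothFun.of_fst (g := fun x : ℝ =>
    (fourier l ((c * p ^ 2 * ν : ℝ) : UnitAddCircle) : ℂ) *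
    (gaussPoly (landauFreq c p) P (x - l - landauShift c μ p j) : ℂ)) ?_
  refine contDiff_const.mul (Complex.ofRealCLM.contDiff.comp ((contDiff_gaussPoly _ P).comp ?_))
  fun_prop

theorem landauTest_boundary (P : ℝ[X]) (l : ℤ) (y : UnitAddCircle) :
    landauTest c μ ν p j P l (0, y) =
      twist c ν p y * landauTest c μ ν p j P (l + 1) (1, y) := by
  have h1 : (fourier (c * p) (y - ((p * ν : ℝ) : UnitAddCircle)) : ℂ) *
      (fourier (l + 1) ((c * p ^ 2 * ν : ℝ) : UnitAddCircle) *
        fourier (-(j + c * p * (l + 1))) y) =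
      fourier l ((c * p ^ 2 * ν : ℝ) : UnitAddCircle) * fourier (-(j + c * p * l)) y := by
    simp only [fourier_apply, ← Circle.coe_mul, ← AddCircle.toCircle_add]
    congr 2
    rw [show (c * p ^ 2 * ν : ℝ) = ((c * p ^ 2 : ℤ) : ℝ) * ν by push_cast; ring]
    simp only [coe_int_mul]
    module
  simp only [landauTest, twist]
  rw [show (1 : ℝ) - ((l + 1 : ℤ) : ℝ) - landauShift c μ p j = 0 - l - landauShift c μ p j by
    push_cast; ring]
  linear_combination (-(gaussPoly (landauFreq c p) P (0 - l - landauShift c μ p j) : ℂ)) * h1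

theorem dx_landauTest (P : ℝ[X]) (l : ℤ) (z : ℝ × UnitAddCircle) :
    dx (landauTest c μ ν p j P l) z =
      landauTest c μ ν p j (derivative P - C (landauFreq c p) * X * P) l z := by
  have h := ((hasDerivAt_gaussPoly (landauFreq c p) P (z.1 - l - landauShift c μ p j)).comp z.1
    (((hasDerivAt_id z.1).sub_const (l : ℝ)).sub_const (landauShift c μ p j))).ofReal_comp
  have h' := (h.const_mul (fourier l ((c * p ^ 2 * ν : ℝ) : UnitAddCircle) : ℂ)).mul_const
    (fourier (-(j + c * p * l)) z.2 : ℂ)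
  rw [mul_one] at h'
  exact h'.deriv

theorem dy_landauTest (P : ℝ[X]) (l : ℤ) (z : ℝ × UnitAddCircle) :
    dy (landauTest c μ ν p j P l) z =
      -(2 * Real.pi * Complex.I * (j + c * p * l)) * landauTest c μ ν p j P l z := by
  have h1 : IsSmoothFun fun z : ℝ × UnitAddCircle =>
      (fourier l ((c * p ^ 2 * ν : ℝ) : UnitAddCircle) *
        gaussPoly (landauFreq c p) P (z.1 - l - landauShift c μ p j) : ℂ) := by
    refine IsSmoothFun.of_fst (g := fun x : ℝ =>
      (fourier l ((c * p ^ 2 * ν : ℝ) : UnitAddCircle) : ℂ) *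
      (gaussPoly (landauFreq c p) P (x - l - landauShift c μ p j) : ℂ)) ?_
    refine contDiff_const.mul (Complex.ofRealCLM.contDiff.comp ((contDiff_gaussPoly _ P).comp ?_))
    fun_prop
  have h2 := h1.dy_mul (IsSmoothFun.fourier (-(j + c * p * l))) z
  rw [dy_fourier, dy_of_fst (fun x : ℝ => (fourier l ((c * p ^ 2 * ν : ℝ) : UnitAddCircle) *
        gaussPoly (landauFreq c p) P (x - l - landauShift c μ p j) : ℂ))] at h2
  refine h2.trans ?_
  simp only [landauTest]
  push_cast
  ring

theorem gauge_landauTest (hc : 0 < c) (hp : p ≠ 0) (P : ℝ[X]) (l : ℤ) (z : ℝ × UnitAddCircle) :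
    2 * Real.pi * c * p * (z.1 - p * μ) * landauTest c μ ν p j P l z -
        Complex.I * dy (landauTest c μ ν p j P l) z =
      landauTest c μ ν p j (C (2 * Real.pi * c * p) * (X * P)) l z := by
  rw [dy_landauTest]
  simp only [landauTest, gaussPoly_C_mul, gaussPoly_X_mul]
  have hc' : (c : ℂ) ≠ 0 := by exact_mod_cast hc.ne'
  have hp' : (p : ℂ) ≠ 0 := by exact_mod_cast hp
  have h : (c * p : ℂ) * (landauShift c μ p j : ℂ) = j + c * p * (p * μ) := by
    rw [landauShift]
    push_cast
    field_simp
  push_cast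
  linear_combination (2 * Real.pi * (fourier l ((c * p ^ 2 * ν : ℝ) : UnitAddCircle) *
    (gaussPoly (landauFreq c p) P (z.1 - l - landauShift c μ p j) : ℂ) *
      fourier (-(j + c * p * l)) z.2)) * h + (2 * Real.pi * (j + c * p * l) *
      (fourier l ((c * p ^ 2 * ν : ℝ) : UnitAddCircle) *
    (gaussPoly (landauFreq c p) P (z.1 - l - landauShift c μ p j) : ℂ) *
      fourier (-(j + c * p * l)) z.2)) * Complex.I_mul_I

theorem summable_inv_one_add_sq : Summable fun l : ℤ => (1 + (l : ℝ) ^ 2)⁻¹ := by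
  have h : Summable fun l : ℤ => 1 / (l : ℝ) ^ 2 :=
    Real.summable_one_div_int_pow.2 (by norm_num)
  refine Summable.of_norm_bounded_eventually h ?_
  have : {0}ᶜ ∈ (cofinite : Filter ℤ) := (Set.finite_singleton 0).compl_mem_cofinite
  filter_upwards [this] with l hl
  have hl' : (0 : ℝ) < (l : ℝ) ^ 2 := by
    have : (l : ℝ) ≠ 0 := by exact_mod_cast hl
    positivity
  rw [Real.norm_of_nonneg (by positivity), one_div]
  exact inv_anti₀ hl' (by linarith)

/-- Peetre's inequality. -/
theorem inv_one_add_sq_le (x l θ : ℝ) (hx : x ∈ Set.Icc (0 : ℝ) 1) :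
    (1 + (x - l - θ) ^ 2)⁻¹ ≤ 2 * (1 + (1 + |θ|) ^ 2) * (1 + l ^ 2)⁻¹ := by
  have h1 : (x - θ) ^ 2 ≤ (1 + |θ|) ^ 2 := by
    refine sq_le_sq' ?_ ?_ <;> [have := le_abs_self θ; have := neg_abs_le θ] <;>
      linarith [hx.1, hx.2]
  rw [← div_eq_mul_inv, le_div_iff₀ (by positivity), inv_mul_le_iff₀ (by positivity)]
  nlinarith [sq_nonneg (x - l - θ), sq_nonneg ((x - θ) + (x - l - θ)),
    mul_nonneg (sq_nonneg (x - l - θ)) (sq_nonneg (1 + |θ|))]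

theorem exists_landauTest_bound (hc : 0 < c) (hp : p ≠ 0) (P : ℝ[X]) : ∃ C : ℝ, 0 ≤ C ∧
    ∀ l z, z.1 ∈ Set.Icc (0 : ℝ) 1 → ‖landauTest c μ ν p j P l z‖ ≤ C * (1 + (l : ℝ) ^ 2)⁻¹ := by
  obtain ⟨C, hC0, hC⟩ := exists_gaussPoly_bound (landauFreq_pos hc hp) P
  refine ⟨C * (2 * (1 + (1 + |landauShift c μ p j|) ^ 2)), by positivity, fun l z hz => ?_⟩
  rw [landauTest, norm_mul, norm_mul, norm_fourier, norm_fourier, one_mul, mul_one,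
    Complex.norm_real, Real.norm_eq_abs, mul_assoc]
  exact (hC _).trans (mul_le_mul_of_nonneg_left (inv_one_add_sq_le _ _ _ hz) hC0)

theorem summable_landauTest (hc : 0 < c) (hp : p ≠ 0) (P : ℝ[X]) {f : ℝ × UnitAddCircle → Spin}
    (hf : Integrable f cylMeasure) :
    Summable fun l => ∫ z, landauTest c μ ν p j P l z • f z ∂cylMeasure := by
  obtain ⟨C, hC0, hC⟩ := exists_landauTest_bound (μ := μ) (ν := ν) (j := j) hc hp P
  refine Summable.of_norm_bounded (g := fun l : ℤ => (C * (1 + (l : ℝ) ^ 2)⁻¹) *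
    ∫ z, ‖f z‖ ∂cylMeasure) ((summable_inv_one_add_sq.mul_left C).mul_right _) fun l => ?_
  rw [← integral_const_mul]
  refine norm_integral_le_of_norm_le (hf.norm.const_mul _) ?_
  filter_upwards [ae_cyl_mem] with z hz
  rw [norm_smul]
  gcongr
  exact hC l z hz

/-- The coefficient of a function with respect to a theta function. -/
def landauCoeff (c : ℕ) (μ ν : ℝ) (p j : ℤ) (P : ℝ[X]) (f : ℝ × UnitAddCircle → Spin) : Spin :=
  ∑' l, ∫ z, landauTest c μ ν p j P l z • f z ∂cylMeasure

theorem summable_testVec (hc : 0 < c) (hp : p ≠ 0) (P : ℝ[X]) (s : Fin 2) :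
    Summable fun l => testVec p (isSmoothFun_landauTest (c := c) (μ := μ) (ν := ν) (p := p)
      (j := j) P l) s := by
  obtain ⟨C, hC0, hC⟩ := exists_landauTest_bound (μ := μ) (ν := ν) (j := j) hc hp P
  exact Summable.of_norm_bounded (summable_inv_one_add_sq.mul_left C) fun l =>
    norm_testVec_le _ _ _ (by positivity) (hC l)

/-- The theta function with profile `P`, with spin `s`. -/
def landauVec (c : ℕ) (μ ν : ℝ) (p j : ℤ) (P : ℝ[X]) (s : Fin 2) : Hilb :=
  ∑' l, testVec p (isSmoothFun_landauTest (c := c) (μ := μ) (ν := ν) (p := p) (j := j) P l) s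

theorem hasSum_inner_landauVec (hc : 0 < c) (hp : p ≠ 0) (P : ℝ[X]) (s : Fin 2) (Φ : Hilb) :
    HasSum (fun l => ⟪testVec p (isSmoothFun_landauTest (c := c) (μ := μ) (ν := ν) (p := p)
      (j := j) P l) s, Φ⟫_ℂ) ⟪landauVec c μ ν p j P s, Φ⟫_ℂ := by
  have h := (summable_testVec (μ := μ) (ν := ν) (j := j) hc hp P s).hasSum.mapL (innerSL ℂ Φ)
  have h' := h.map (starRingEnd ℂ) Complex.continuous_conj
  simpa [Function.comp_def, landauVec] using h'

theorem inner_landauVec (hc : 0 < c) (hp : p ≠ 0) (P : ℝ[X]) (s : Fin 2) (Φ : Hilb) :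
    ⟪landauVec c μ ν p j P s, Φ⟫_ℂ = landauCoeff c μ ν p j P (slice Φ p) s := by
  refine (hasSum_inner_landauVec hc hp P s Φ).unique ?_
  simp only [inner_testVec]
  exact (summable_landauTest hc hp P (integrable_of_memLp (Hilb.memLp_slice Φ p))).hasSum.mapL
    (EuclideanSpace.proj s : Spin →L[ℂ] ℂ)

theorem landauCoeff_add (hc : 0 < c) (hp : p ≠ 0) (P Q : ℝ[X]) {f : ℝ × UnitAddCircle → Spin}
    (hf : MemLp f 2 cylMeasure) :
    landauCoeff c μ ν p j (P + Q) f = landauCoeff c μ ν p j P f + landauCoeff c μ ν p j Q f := by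
  have hi := integrable_of_memLp hf
  rw [landauCoeff, landauCoeff, landauCoeff,
    ← (summable_landauTest hc hp P hi).tsum_add (summable_landauTest hc hp Q hi)]
  refine tsum_congr fun l => ?_
  rw [← integral_add (integrable_smul_smooth hf (isSmoothFun_landauTest P l))
    (integrable_smul_smooth hf (isSmoothFun_landauTest Q l))]
  refine integral_congr_ae (Eventually.of_forall fun z => ?_)
  simp only [landauTest, gaussPoly_add, ← add_smul]
  push_cast
  ring_nf

theorem landauCoeff_C_mul (a : ℝ) (P : ℝ[X]) (f : ℝ × UnitAddCircle → Spin) :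
    landauCoeff c μ ν p j (C a * P) f = (a : ℂ) • landauCoeff c μ ν p j P f := by
  rw [landauCoeff, landauCoeff, ← tsum_const_smul'']
  refine tsum_congr fun l => ?_
  rw [← integral_smul]
  refine integral_congr_ae (Eventually.of_forall fun z => ?_)
  simp only [landauTest, gaussPoly_C_mul, smul_smul]
  push_cast
  ring_nf

/-- Integration by parts against a theta function: the boundary terms telescope. -/
theorem WeakQP.landauCoeff_eq (hc : 0 < c) (hp : p ≠ 0) {f g : ℝ × UnitAddCircle → Spin}
    (hf : MemLp f 2 cylMeasure) (h : WeakQP c ν p f g) (P : ℝ[X]) :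
    landauCoeff c μ ν p j P g =
      -landauCoeff c μ ν p j (derivative P - C (landauFreq c p) * X * P) f := by
  have hd := h.hasWeakDx hf
  have m1 := memLp_trace₁ hf hd.1
  set B : ℤ → Spin := fun l => ∫ y, landauTest c μ ν p j P l (1, y) • trace₁ f g y with hB
  have hBs : Summable B := by
    obtain ⟨C, hC0, hC⟩ := exists_landauTest_bound (μ := μ) (ν := ν) (j := j) hc hp P
    refine Summable.of_norm_bounded (g := fun l : ℤ => (C * (1 + (l : ℝ) ^ 2)⁻¹) *
      ∫ y : UnitAddCircle, ‖trace₁ f g y‖)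
      ((summable_inv_one_add_sq.mul_left C).mul_right _) fun l => ?_
    rw [← integral_const_mul]
    refine norm_integral_le_of_norm_le ((m1.integrable one_le_two).norm.const_mul _)
      (Eventually.of_forall fun y => ?_)
    rw [norm_smul]
    gcongr
    exact hC l (1, y) (by simp)
  have key : ∀ l, (∫ z, landauTest c μ ν p j (derivative P - C (landauFreq c p) * X * P) l z •
      f z ∂cylMeasure) + ∫ z, landauTest c μ ν p j P l z • g z ∂cylMeasure = B l - B (l + 1) := by
    intro l
    have h1 := hd.gauss_green hf (isSmoothFun_landauTest (c := c) (μ := μ) (ν := ν) (p := p)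
      (j := j) P l)
    simp only [dx_landauTest] at h1
    rw [integral_add (integrable_smul_smooth hf (isSmoothFun_landauTest _ l))
      (integrable_smul_smooth hd.1 (isSmoothFun_landauTest P l))] at h1
    rw [h1, hB]
    congr 1
    refine integral_congr_ae ?_
    filter_upwards [h.traces_eq hf] with y hy
    rw [landauTest_boundary, hy, smul_smul, mul_right_comm, mul_comm (twist c ν p y),
      conj_twist_mul, one_mul]
  have s1 := summable_landauTest (μ := μ) (ν := ν) (j := j) hc hp
    (derivative P - C (landauFreq c p) * X * P) (integrable_of_memLp hf)
  have s2 := summable_landauTest (μ := μ) (ν := ν) (j := j) hc hp P (integrable_of_memLp hd.1)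
  have h3 : landauCoeff c μ ν p j (derivative P - C (landauFreq c p) * X * P) f +
      landauCoeff c μ ν p j P g = 0 := by
    have h4 : Summable fun l => B (l + 1) := (Equiv.addRight (1 : ℤ)).summable_iff.2 hBs
    have h5 : ∑' l, B (l + 1) = ∑' l, B l := (Equiv.addRight (1 : ℤ)).tsum_eq B
    rw [landauCoeff, landauCoeff, ← s1.tsum_add s2, tsum_congr key, hBs.tsum_sub h4, h5, sub_self]
  exact eq_neg_of_add_eq_zero_right h3

/-- `h` is the weak form of `2πcp(x - pμ)f + i ∂f/∂y`. -/
def WeakM (c : ℕ) (μ : ℝ) (p : ℤ) (f h : ℝ × UnitAddCircle → Spin) : Prop :=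
  MemLp h 2 cylMeasure ∧ ∀ φ, IsSmoothFun φ →
    ∫ z, (2 * Real.pi * c * p * (z.1 - p * μ) * φ z - Complex.I * dy φ z : ℂ) • f z ∂cylMeasure =
      ∫ z, φ z • h z ∂cylMeasure

theorem WeakM.landauCoeff_eq (hc : 0 < c) (hp : p ≠ 0) {f h : ℝ × UnitAddCircle → Spin}
    (hh : WeakM c μ p f h) (P : ℝ[X]) :
    landauCoeff c μ ν p j P h =
      landauCoeff c μ ν p j (C (2 * Real.pi * c * p) * (X * P)) f := by
  rw [landauCoeff, landauCoeff]
  refine tsum_congr fun l => ?_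
  rw [← hh.2 _ (isSmoothFun_landauTest P l)]
  simp only [gauge_landauTest hc hp]

end landau

end QHM

/-! ### Orthonormality and completeness of the modes -/

namespace QHM

open Filter Topology Polynomial

section glue

variable {E : Type*}

/-- The function on the line obtained from functions on the unit interval: it is `F l` on
`[-l - θ, -l - θ + 1)`, up to translation. -/
def glue (F : ℤ → ℝ → E) (θ u : ℝ) : E := F (-⌊u + θ⌋) (Int.fract (u + θ))

theorem glue_apply (F : ℤ → ℝ → E) (θ : ℝ) (l : ℤ) {x : ℝ} (hx : x ∈ Set.Ico (0 : ℝ) 1) :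
    glue F θ (x - l - θ) = F l x := by
  have h : x - l - θ + θ = x + ((-l : ℤ) : ℝ) := by push_cast; ring
  rw [glue, h, Int.floor_add_intCast, Int.fract_add_intCast, Int.floor_eq_zero_iff.2 hx,
    Int.fract_eq_self.2 hx]
  simp

/-- Gluing the intervals `[0, 1]` for all `l` turns a sum of integrals against the translates of a
weight into one integral over the line. -/
theorem glue_hasSum [NormedAddCommGroup E] [NormedSpace ℂ E] {w : ℝ → ℂ}
    (hw : Continuous w) {A : ℝ} (hA0 : 0 ≤ A)
    (hA : ∀ t, ‖w t‖ ≤ A * (1 + t ^ 2)⁻¹) {F : ℤ → ℝ → E} {θ B : ℝ}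
    (hF : ∀ l, IntegrableOn (F l) (Set.Icc 0 1)) (hB : ∀ l, ∫ x in Set.Icc (0 : ℝ) 1, ‖F l x‖ ≤ B) :
    Integrable (fun u => w u • glue F θ u) ∧
      HasSum (fun l : ℤ => ∫ x in Set.Icc (0 : ℝ) 1, w (x - l - θ) • F l x)
        (∫ u, w u • glue F θ u) := by
  set K : ℝ → E := fun u => w u • glue F θ u with hK
  set S : ℤ → Set ℝ := fun l => (fun u => u + (l + θ)) ⁻¹' Set.Ico (0 : ℝ) 1 with hS
  have mp : ∀ l : ℤ, MeasurePreserving (fun u : ℝ => u + (l + θ)) volume volume := fun l =>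
    measurePreserving_add_right volume _
  have emb : ∀ l : ℤ, MeasurableEmbedding fun u : ℝ => u + (l + θ) := fun l =>
    (MeasurableEquiv.addRight (l + θ : ℝ)).measurableEmbedding
  have hSm : ∀ l, MeasurableSet (S l) := fun l => (mp l).measurable measurableSet_Ico
  have hKS : ∀ l, ∀ u ∈ S l, K u = w ((u + (l + θ)) - l - θ) • F l (u + (l + θ)) := by
    intro l u hu
    have h := glue_apply F θ l hu
    have h' : u + (l + θ) - l - θ = u := by ring
    rw [h'] at h ⊢
    rw [hK, ← h]
  have hi : ∀ l : ℤ, IntegrableOn (fun x => w (x - l - θ) • F l x) (Set.Icc 0 1) := by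
    intro l
    refine (hF l).bdd_smul A (hw.comp (by fun_prop)).aestronglyMeasurable
      (Eventually.of_forall fun x => (hA _).trans ?_)
    exact mul_le_of_le_one_right hA0 (inv_le_one_of_one_le₀ (by nlinarith [sq_nonneg (x - l - θ)]))
  have hKi : ∀ l, IntegrableOn K (S l) := by
    intro l
    rw [integrableOn_congr_fun (hKS l) (hSm l)]
    exact ((mp l).integrableOn_comp_preimage (emb l)).2 ((hi l).mono_set Set.Ico_subset_Icc_self)
  have hn : ∀ l, ∫ u in S l, ‖K u‖ ≤ A * (2 * (1 + (1 + |θ|) ^ 2) * (1 + (l : ℝ) ^ 2)⁻¹) * B := by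
    intro l
    have e : ∫ u in S l, ‖K u‖ = ∫ x in Set.Icc (0 : ℝ) 1, ‖w (x - l - θ) • F l x‖ := by
      rw [integral_Icc_eq_integral_Ico, ← (mp l).setIntegral_preimage_emb (emb l)
        (fun x => ‖w (x - l - θ) • F l x‖)]
      exact setIntegral_congr_fun (hSm l) fun u hu => congrArg _ (hKS l u hu)
    rw [e]
    refine le_trans ?_ (mul_le_mul_of_nonneg_left (hB l) (by positivity))
    rw [← integral_const_mul]
    refine setIntegral_mono_on (hi l).norm ((hF l).norm.const_mul _) measurableSet_Icc
      fun x hx => ?_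
    rw [norm_smul]
    gcongr
    exact (hA _).trans (mul_le_mul_of_nonneg_left (inv_one_add_sq_le _ _ _ hx) hA0)
  have hU : ⋃ l, S l = Set.univ := by
    refine Set.eq_univ_of_forall fun u => Set.mem_iUnion.2 ⟨-⌊u + θ⌋, ?_⟩
    have h1 := Int.floor_le (u + θ)
    have h2 := Int.lt_floor_add_one (u + θ)
    simp only [hS, Set.mem_preimage, Set.mem_Ico]
    push_cast
    constructor <;> linarith
  have hKint : IntegrableOn K (⋃ l, S l) := by
    refine integrableOn_iUnion_of_summable_integral_norm hKi ?_
    refine Summable.of_nonneg_of_le (fun l => integral_nonneg fun u => norm_nonneg _) hn ?_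
    exact ((summable_inv_one_add_sq.mul_left _).mul_left _).mul_right _
  have hdisj : Pairwise (Function.onFun Disjoint S) := by
    intro l m hlm
    refine Set.disjoint_left.2 fun u hu hu' => hlm ?_
    have e1 : ⌊u + (l + θ)⌋ = 0 := Int.floor_eq_zero_iff.2 hu
    have e2 : ⌊u + (m + θ)⌋ = 0 := Int.floor_eq_zero_iff.2 hu'
    rw [show u + (l + θ) = (u + θ) + l by ring, Int.floor_add_intCast] at e1
    rw [show u + (m + θ) = (u + θ) + m by ring, Int.floor_add_intCast] at e2
    omega
  have hs := hasSum_integral_iUnion hSm hdisj hKint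
  rw [hU] at hKint hs
  rw [integrableOn_univ] at hKint
  rw [setIntegral_univ] at hs
  have e : (fun l : ℤ => ∫ u in S l, K u) =
      fun l : ℤ => ∫ x in Set.Icc (0 : ℝ) 1, w (x - l - θ) • F l x := by
    funext l
    rw [integral_Icc_eq_integral_Ico, ← (mp l).setIntegral_preimage_emb (emb l)
      (fun x => w (x - l - θ) • F l x)]
    exact setIntegral_congr_fun (hSm l) (hKS l)
  rw [e] at hs
  exact ⟨hKint, hs⟩

end glue

section landau

variable {c : ℕ} {μ ν : ℝ} {p : ℤ}

theorem integral_mul_fourier {g : ℝ → ℂ} (hg : ContDiff ℝ ∞ g) {n : ℤ} (hn : n ≠ 0) :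
    ∫ z, g z.1 * fourier n z.2 ∂cylMeasure = 0 := by
  have h := integral_dy ((IsSmoothFun.of_fst hg).mul (IsSmoothFun.fourier n))
  have e : (fun z : ℝ × UnitAddCircle => dy (fun z => g z.1 * fourier n z.2) z) =
      fun z => (2 * Real.pi * Complex.I * n) * (g z.1 * fourier n z.2) := by
    funext z
    rw [(IsSmoothFun.of_fst hg).dy_mul (IsSmoothFun.fourier n), dy_of_fst, dy_fourier]
    ring
  rw [e, integral_const_mul] at h
  have hn' : (n : ℂ) ≠ 0 := by exact_mod_cast hn
  simpa [hn', Real.pi_ne_zero] using h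

theorem integral_landauTest_mul_conj {j j' : ℤ} (P Q : ℝ[X]) (l m : ℤ) :
    ∫ z, landauTest c μ ν p j P l z * conj (landauTest c μ ν p j' Q m z) ∂cylMeasure =
      if j + c * p * l = j' + c * p * m then
        (fourier l ((c * p ^ 2 * ν : ℝ) : UnitAddCircle) : ℂ) *
        conj (fourier m ((c * p ^ 2 * ν : ℝ) : UnitAddCircle)) *
        ∫ x in Set.Icc (0 : ℝ) 1,
          ((gaussPoly (landauFreq c p) P (x - l - landauShift c μ p j) *
            gaussPoly (landauFreq c p) Q (x - m - landauShift c μ p j') : ℝ) : ℂ)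
      else 0 := by
  set g : ℝ → ℂ := fun x => (fourier l ((c * p ^ 2 * ν : ℝ) : UnitAddCircle) : ℂ) *
        conj (fourier m ((c * p ^ 2 * ν : ℝ) : UnitAddCircle)) *
        ((gaussPoly (landauFreq c p) P (x - l - landauShift c μ p j) *
            gaussPoly (landauFreq c p) Q (x - m - landauShift c μ p j') : ℝ) : ℂ) with hg
  have hgs : ContDiff ℝ ∞ g := by
    refine contDiff_const.mul (Complex.ofRealCLM.contDiff.comp
      (((contDiff_gaussPoly _ P).comp ?_).mul ((contDiff_gaussPoly _ Q).comp ?_))) <;> fun_prop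
  have e : ∀ z, landauTest c μ ν p j P l z * conj (landauTest c μ ν p j' Q m z) =
      g z.1 * fourier (j' + c * p * m - (j + c * p * l)) z.2 := by
    intro z
    have h1 : (fourier (j' + c * p * m - (j + c * p * l)) z.2 : ℂ) =
        fourier (-(j + c * p * l)) z.2 * fourier (j' + c * p * m) z.2 := by
      rw [← fourier_add]; congr 2; ring
    rw [h1, hg]
    simp only [landauTest, map_mul, Complex.conj_ofReal, ← fourier_neg, neg_neg]
    push_cast
    ring
  simp only [e]
  split_ifs with h
  · rw [← integral_const_mul]
    simp only [h, sub_self, fourier_zero, mul_one]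
    rw [cylMeasure, integral_fun_fst (f := g), probReal_univ, one_smul]
  · exact integral_mul_fourier hgs fun h' => h (by linarith)

/-- The theta functions of one slice are orthogonal for different residues, since their frequencies
in `y` are disjoint. For equal residues the integrals over `[0, 1]` of the translates of the
profiles add up to an integral over the line. -/
theorem inner_landauVec_landauVec (hc : 0 < c) (hp : p ≠ 0) {j j' : ℤ}
    (hj : ∀ l m : ℤ, j + c * p * l = j' + c * p * m → j = j' ∧ l = m) (P Q : ℝ[X])
    (s t : Fin 2) :
    ⟪landauVec c μ ν p j P s, landauVec c μ ν p j' Q t⟫_ℂ =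
      if j = j' ∧ s = t then (gaussInner (landauFreq c p) P Q : ℂ) else 0 := by
  have h1 := hasSum_inner_landauVec (μ := μ) (ν := ν) (j := j) hc hp P s
    (landauVec c μ ν p j' Q t)
  have h2 : ∀ l, ⟪testVec p (isSmoothFun_landauTest (c := c) (μ := μ) (ν := ν) (p := p)
      (j := j) P l) s, landauVec c μ ν p j' Q t⟫_ℂ =
      if j = j' ∧ s = t then ∫ z, landauTest c μ ν p j P l z *
        conj (landauTest c μ ν p j' Q l z) ∂cylMeasure else 0 := by
    intro l
    have h3 := (hasSum_inner_landauVec (μ := μ) (ν := ν) (j := j') hc hp Q t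
      (testVec p (isSmoothFun_landauTest (c := c) (μ := μ) (ν := ν) (p := p)
      (j := j) P l) s)).map (starRingEnd ℂ) Complex.continuous_conj
    simp only [Function.comp_def, inner_conj_symm] at h3
    simp only [inner_testVec_testVec, true_and] at h3
    refine h3.unique ?_
    have h4 : ∀ m ≠ l, (if s = t then ∫ z, landauTest c μ ν p j P l z *
        conj (landauTest c μ ν p j' Q m z) ∂cylMeasure else 0) = 0 := by
      intro m hm
      rw [integral_landauTest_mul_conj, if_neg fun h => hm (hj _ _ h).2.symm, ite_self]
    convert hasSum_single l h4 using 1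
    by_cases hs : s = t
    · by_cases hjj : j = j'
      · simp [hs, hjj]
      · rw [if_neg (by tauto), if_pos hs, integral_landauTest_mul_conj,
          if_neg fun h => hjj (hj _ _ h).1]
    · rw [if_neg (by tauto), if_neg hs]
  simp only [h2] at h1
  split_ifs at h1 ⊢ with h
  · obtain ⟨rfl, rfl⟩ := h
    refine h1.unique ?_
    obtain ⟨A, hA0, hA⟩ := exists_gaussPoly_bound
      (κ := 2 * landauFreq c p) (by linarith [landauFreq_pos hc hp]) (P * Q)
    have h5 := (glue_hasSum (w := fun t => ((gaussPoly (landauFreq c p) P t *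
      gaussPoly (landauFreq c p) Q t : ℝ) : ℂ)) (Complex.continuous_ofReal.comp
        ((contDiff_gaussPoly _ P).continuous.mul (contDiff_gaussPoly _ Q).continuous)) hA0
        (fun t => by rw [Complex.norm_real, Real.norm_eq_abs, gaussPoly_mul]; exact hA t)
        (F := fun _ _ => (1 : ℂ)) (θ := landauShift c μ p j) (B := 1)
        (fun _ => (integrable_const _)) (fun _ => by simp)).2
    simp only [glue, smul_eq_mul, mul_one] at h5
    rw [integral_complex_ofReal] at h5
    rw [gaussInner]
    have h6 : ∀ l, ∫ z, landauTest c μ ν p j P l z * conj (landauTest c μ ν p j Q l z)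
        ∂cylMeasure = ∫ x in Set.Icc (0 : ℝ) 1,
          ((gaussPoly (landauFreq c p) P (x - l - landauShift c μ p j) *
            gaussPoly (landauFreq c p) Q (x - l - landauShift c μ p j) : ℝ) : ℂ) := fun l => by
      rw [integral_landauTest_mul_conj, if_pos rfl, mul_comm (fourier l _ : ℂ),
        conj_fourier_mul_self, one_mul]
    simp only [h6]
    exact h5
  · exact h1.unique hasSum_zero

theorem inner_landauVec_of_ne (hc : 0 < c) (hp : p ≠ 0) {j : ℤ} (P : ℝ[X]) (s : Fin 2) {q : ℤ}
    (hq : q ≠ p) {φ : ℝ × UnitAddCircle → ℂ} (hφ : IsSmoothFun φ) (t : Fin 2) :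
    ⟪landauVec c μ ν p j P s, testVec q hφ t⟫_ℂ = 0 := by
  refine (hasSum_inner_landauVec hc hp P s _).unique ?_
  simp only [inner_testVec_testVec, hq.symm, false_and, if_false]
  exact hasSum_zero

theorem inner_landauVec_landauVec_of_ne (hc : 0 < c) (hp : p ≠ 0) {j : ℤ} (P : ℝ[X]) (s : Fin 2)
    {q : ℤ} (hq0 : q ≠ 0) (hq : q ≠ p) {j' : ℤ} (Q : ℝ[X]) (t : Fin 2) :
    ⟪landauVec c μ ν p j P s, landauVec c μ ν q j' Q t⟫_ℂ = 0 := by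
  refine (hasSum_inner_landauVec hc hp P s _).unique ?_
  have h : ∀ l, ⟪testVec p (isSmoothFun_landauTest (c := c) (μ := μ) (ν := ν) (p := p)
      (j := j) P l) s, landauVec c μ ν q j' Q t⟫_ℂ = 0 := fun l => by
    rw [← inner_conj_symm, inner_landauVec_of_ne hc hq0 Q t hq.symm, map_zero]
  simp only [h]
  exact hasSum_zero

/-- The theta functions are complete: the Fourier coefficients of `f` with frequencies in one
residue class modulo `cp`, glued along the line, form a function orthogonal to all Hermite functions. -/
theorem ae_eq_zero_of_landauCoeff (hc : 0 < c) (hp : p ≠ 0) {f : ℝ × UnitAddCircle → Spin}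
    (hf : MemLp f 2 cylMeasure) (h : ∀ j : ℤ, 0 ≤ j → j < c * |p| → ∀ k,
      landauCoeff c μ ν p j (hermitePoly (landauFreq c p) k) f = 0) : f =ᵐ[cylMeasure] 0 := by
  have hκ := landauFreq_pos hc hp
  have hf1 := integrable_of_memLp hf
  have hcp : (c * p : ℤ) ≠ 0 := mul_ne_zero (by exact_mod_cast hc.ne') hp
  refine ae_eq_zero_of_fibreCoeff hf fun n => ?_
  set j := n % (c * p) with hjdef
  have hj0 : 0 ≤ j := Int.emod_nonneg _ hcp
  have hj1 : j < c * |p| := by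
    have := Int.emod_lt_abs n hcp
    rwa [abs_mul, Nat.abs_cast] at this
  have hP : ∀ P : ℝ[X], landauCoeff c μ ν p j P f = 0 := by
    intro P
    have hmem : P ∈ Submodule.span ℝ (Set.range (hermitePoly (landauFreq c p))) := by
      rw [span_hermitePoly hκ]; trivial
    induction hmem using Submodule.span_induction with
    | mem P hP =>
      obtain ⟨k, rfl⟩ := hP
      exact h j hj0 hj1 k
    | zero => simpa using landauCoeff_C_mul (c := c) (μ := μ) (ν := ν) (p := p) (j := j) 0 0 f
    | add P Q _ _ hP hQ => rw [landauCoeff_add hc hp _ _ hf, hP, hQ, add_zero]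
    | smul a P _ hP => rw [Polynomial.smul_eq_C_mul, landauCoeff_C_mul, hP, smul_zero]
  set F : ℤ → ℝ → Spin := fun l x =>
    (fourier l ((c * p ^ 2 * ν : ℝ) : UnitAddCircle) : ℂ) • fibreCoeff (j + c * p * l) f x with hF
  have hFi : ∀ l, IntegrableOn (F l) (Set.Icc 0 1) := fun l =>
    (integrable_fibreCoeff hf1 (j + c * p * l)).smul
      (fourier l ((c * p ^ 2 * ν : ℝ) : UnitAddCircle) : ℂ)
  have hFB : ∀ l, ∫ x in Set.Icc (0 : ℝ) 1, ‖F l x‖ ≤ ∫ z, ‖f z‖ ∂cylMeasure := by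
    intro l
    rw [cylMeasure, integral_prod _ hf1.norm]
    refine integral_mono (hFi l).norm hf1.norm.integral_prod_left fun x => ?_
    simp only [hF, norm_smul, norm_fourier, one_mul]
    exact norm_fibreCoeff_le _ _ _
  have hzero := ae_eq_zero_of_gaussPoly (κ := landauFreq c p)
    (F := glue F (landauShift c μ p j)) (fun a => ?_) fun P => ?_
  · have hpre := (measurePreserving_sub_right volume
      ((n / (c * p) : ℤ) + landauShift c μ p j)).quasiMeasurePreserving.ae hzero
    rw [← restrict_Ico_eq_restrict_Icc]
    filter_upwards [ae_restrict_of_ae hpre, ae_restrict_mem measurableSet_Ico] with x hx hx1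
    rw [← sub_sub, glue_apply _ _ _ hx1, Pi.zero_apply, hF, smul_eq_zero] at hx
    have hn : j + c * p * (n / (c * p)) = n := Int.emod_add_mul_ediv n (c * p)
    rw [hn] at hx
    refine hx.resolve_left fun h0 => ?_
    have := norm_fourier (n / (c * p)) ((c * p ^ 2 * ν : ℝ) : UnitAddCircle)
    simp [h0] at this
  · obtain ⟨A, hA0, hA⟩ := exists_decay hκ 1 a
    refine (glue_hasSum (w := fun t => (Real.exp (a * |t|) * gaussPoly (landauFreq c p) 1 t : ℂ))
      ?_ hA0 (fun t => ?_) hFi hFB).1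
    · have := (contDiff_gaussPoly (landauFreq c p) 1).continuous
      fun_prop
    · rw [norm_mul, Complex.norm_real, Complex.norm_real, Real.norm_eq_abs, Real.norm_eq_abs,
        Real.abs_exp]
      exact hA t
  · obtain ⟨A, hA0, hA⟩ := exists_gaussPoly_bound hκ P
    have h1 := (glue_hasSum (w := fun t => (gaussPoly (landauFreq c p) P t : ℂ))
      (Complex.continuous_ofReal.comp (contDiff_gaussPoly _ P).continuous) hA0
      (fun t => by rw [Complex.norm_real, Real.norm_eq_abs]; exact hA t) (θ := landauShift c μ p j)
      hFi hFB).2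
    rw [← h1.tsum_eq, ← hP P, landauCoeff]
    refine tsum_congr fun l => ?_
    have h2 := integral_smul_fibreCoeff hf1 (g := fun x : ℝ =>
      (fourier l ((c * p ^ 2 * ν : ℝ) : UnitAddCircle) *
        gaussPoly (landauFreq c p) P (x - l - landauShift c μ p j) : ℂ)) (by
          have := (contDiff_gaussPoly (landauFreq c p) P).continuous
          fun_prop) (j + c * p * l)
    refine Eq.trans ?_ h2.symm
    refine integral_congr_ae (Eventually.of_forall fun x => ?_)
    simp only [hF, smul_smul]
    rw [mul_comm]

end landau

section torus

/-- The complex conjugate of the character `e(mx) e(ny)`. -/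
def torusTest (n m : ℤ) (z : ℝ × UnitAddCircle) : ℂ :=
  fourier (-m) (z.1 : UnitAddCircle) * fourier (-n) z.2

theorem isSmoothFun_torusTest (n m : ℤ) : IsSmoothFun (torusTest n m) :=
  (IsSmoothFun.of_fst (contDiff_fourier (-m))).mul (IsSmoothFun.fourier (-n))

theorem isDualTest_torusTest (c : ℕ) (ν : ℝ) (n m : ℤ) : IsDualTest c ν 0 (torusTest n m) := by
  refine ⟨isSmoothFun_torusTest n m, fun y => ?_⟩
  have h : ((1 : ℝ) : UnitAddCircle) = 0 := AddCircle.coe_period 1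
  simp only [torusTest, twist, h, QuotientAddGroup.mk_zero, mul_zero, fourier_zero, one_mul]

theorem dx_torusTest (n m : ℤ) (z : ℝ × UnitAddCircle) :
    dx (torusTest n m) z = -(2 * Real.pi * Complex.I * m) * torusTest n m z := by
  have h := dy_fourier (-m) (0, (z.1 : UnitAddCircle))
  have h1 := ((IsSmoothFun.fourier (-m)).hasDerivAt_dy 0 z.1).mul_const
    (fourier (-n) z.2 : ℂ)
  rw [h] at h1
  refine h1.deriv.trans ?_
  rw [torusTest]
  push_cast
  ring

theorem dy_torusTest (n m : ℤ) (z : ℝ × UnitAddCircle) :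
    dy (torusTest n m) z = -(2 * Real.pi * Complex.I * n) * torusTest n m z := by
  have h2 := (IsSmoothFun.of_fst (contDiff_fourier (-m))).dy_mul (IsSmoothFun.fourier (-n)) z
  rw [dy_fourier, dy_of_fst (fun x : ℝ => (fourier (-m) (x : UnitAddCircle) : ℂ))] at h2
  refine h2.trans ?_
  simp only [torusTest]
  push_cast
  ring

theorem torusTest_mul_conj (n m n' m' : ℤ) (z : ℝ × UnitAddCircle) :
    torusTest n m z * conj (torusTest n' m' z) = torusTest (n - n') (m - m') z := by
  simp only [torusTest, map_mul, ← fourier_neg, neg_neg]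
  rw [show -(m - m') = -m + m' by ring, show -(n - n') = -n + n' by ring, fourier_add, fourier_add]
  ring

theorem integral_torusTest (n m : ℤ) :
    ∫ z, torusTest n m z ∂cylMeasure = if n = 0 ∧ m = 0 then 1 else 0 := by
  by_cases hn : n = 0
  · by_cases hm : m = 0
    · simp [hn, hm, torusTest]
    · have h := integral_dx (isSmoothFun_torusTest n m)
      have hper : ∀ y, torusTest n m (1, y) = torusTest n m (0, y) := fun y => by
        rw [(isDualTest_torusTest 0 0 n m).2 y]
        simp [twist]
      simp only [dx_torusTest, hper, sub_self, integral_const_mul] at h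
      have hm' : (m : ℂ) ≠ 0 := by exact_mod_cast hm
      rw [if_neg (by tauto)]
      simpa [hm', Real.pi_ne_zero] using h
  · rw [if_neg (by tauto)]
    exact integral_mul_fourier (contDiff_fourier (-m)) (neg_ne_zero.2 hn)

/-- The character `e(mx) e(ny)` in the slice of `0`, with spin `s`. -/
def torusVec (n m : ℤ) (s : Fin 2) : Hilb := testVec 0 (isSmoothFun_torusTest n m) s

theorem inner_torusVec_torusVec (n m n' m' : ℤ) (s t : Fin 2) :
    ⟪torusVec n m s, torusVec n' m' t⟫_ℂ = if n = n' ∧ m = m' ∧ s = t then 1 else 0 := by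
  rw [torusVec, torusVec, inner_testVec_testVec]
  simp only [torusTest_mul_conj, integral_torusTest, sub_eq_zero]
  split_ifs <;> tauto

theorem ae_eq_zero_of_fourier_Icc {u : ℝ → Spin}
    (hu : MemLp u 2 (volume.restrict (Set.Icc (0 : ℝ) 1)))
    (h : ∀ m : ℤ, ∫ x in Set.Icc (0 : ℝ) 1, (fourier m (x : UnitAddCircle) : ℂ) • u x = 0) :
    ∀ᵐ x ∂(volume.restrict (Set.Icc (0 : ℝ) 1)), u x = 0 := by
  rw [← restrict_Ioc_eq_restrict_Icc] at hu h ⊢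
  set e : UnitAddCircle → ℝ := fun y => (AddCircle.equivIoc 1 0 y : ℝ) with he
  have h01 : Set.Ioc (0 : ℝ) (0 + 1) = Set.Ioc 0 1 := by rw [zero_add]
  have mp : MeasurePreserving e volume (volume.restrict (Set.Ioc (0 : ℝ) 1)) := by
    rw [← h01]
    exact (measurePreserving_subtype_coe measurableSet_Ioc).comp
      (AddCircle.measurePreserving_equivIoc 1)
  have emb : MeasurableEmbedding e :=
    (MeasurableEmbedding.subtype_coe measurableSet_Ioc).comp
      (AddCircle.measurableEquivIoc 1 0).measurableEmbedding
  have hinv : ∀ y, (e y : UnitAddCircle) = y := fun y => (AddCircle.equivIoc 1 0).symm_apply_apply y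
  have h1 := ae_eq_zero_of_fourier (hu.comp_measurePreserving mp) fun m => by
    have h2 := mp.integral_comp emb fun x => (fourier m (x : UnitAddCircle) : ℂ) • u x
    simp only [hinv, h] at h2
    exact h2
  rw [← mp.map_eq, emb.ae_map_iff]
  exact h1

theorem ae_eq_zero_of_torusTest {f : ℝ × UnitAddCircle → Spin} (hf : MemLp f 2 cylMeasure)
    (h : ∀ n m, ∫ z, torusTest n m z • f z ∂cylMeasure = 0) : f =ᵐ[cylMeasure] 0 := by
  refine ae_eq_zero_of_fibreCoeff hf fun n =>
    ae_eq_zero_of_fourier_Icc (memLp_fibreCoeff hf n) fun m => ?_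
  rw [← h n (-m), ← integral_smul_fibreCoeff (integrable_of_memLp hf)
    (contDiff_fourier m).continuous]
  simp only [torusTest, neg_neg]

end torus
end QHM

/-! ### The orthonormal basis of modes -/

namespace QHM

open Filter Topology Polynomial

/-- The labels of the modes: the characters of the torus in the slice of `0`, and in the slice of
`p ≠ 0` the theta functions, where `N = k c|p| + j` stands for Landau level `k` and
residue `j < c|p|`. -/
inductive Mode : Type
  | torus (n m : ℤ) : Mode
  | landau (p : {p : ℤ // p ≠ 0}) (N : ℕ) : Mode

namespace Mode

/-- The slice `p` in which a mode lives. -/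
def charge : Mode → ℤ
  | torus _ _ => 0
  | landau p _ => p

/-- The number of theta functions in each Landau level. -/
def _root_.QHM.degeneracy (c : ℕ) (p : ℤ) : ℕ := c * p.natAbs

theorem _root_.QHM.degeneracy_pos {c : ℕ} (hc : 0 < c) {p : ℤ} (hp : p ≠ 0) :
    0 < degeneracy c p := Nat.mul_pos hc (Int.natAbs_pos.2 hp)

/-- The vectors of the basis. -/
def vec (c : ℕ) (μ ν : ℝ) : Mode × Fin 2 → Hilb
  | (torus n m, s) => torusVec n m s
  | (landau p N, s) => landauVec c μ ν p ((N % degeneracy c p : ℕ) : ℤ)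
      (hermitePoly (landauFreq c p) (N / degeneracy c p)) s

variable {c : ℕ} {μ ν : ℝ}

theorem inner_torus (n m : ℤ) (s : Fin 2) (Φ : Hilb) :
    ⟪vec c μ ν (torus n m, s), Φ⟫_ℂ = (∫ z, torusTest n m z • slice Φ 0 z ∂cylMeasure) s :=
  inner_testVec 0 (isSmoothFun_torusTest n m) s Φ

theorem inner_landau (hc : 0 < c) (p : {p : ℤ // p ≠ 0}) (N : ℕ) (s : Fin 2) (Φ : Hilb) :
    ⟪vec c μ ν (landau p N, s), Φ⟫_ℂ = landauCoeff c μ ν p ((N % degeneracy c p : ℕ) : ℤ)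
      (hermitePoly (landauFreq c p) (N / degeneracy c p)) (slice Φ p) s :=
  inner_landauVec hc p.2 _ _ _

theorem inner_testVec_of_ne (hc : 0 < c) (x : Mode × Fin 2) {p : ℤ} (hp : x.1.charge ≠ p)
    {φ : ℝ × UnitAddCircle → ℂ} (hφ : IsSmoothFun φ) (s : Fin 2) :
    ⟪vec c μ ν x, testVec p hφ s⟫_ℂ = 0 := by
  obtain ⟨n | q, t⟩ := x
  · rw [vec, torusVec, inner_testVec_testVec, if_neg fun h => hp h.1]
  · exact inner_landauVec_of_ne hc q.2 _ _ (Ne.symm hp) hφ s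

theorem residue_inj (hc : 0 < c) {p : ℤ} (hp : p ≠ 0) {a b : ℕ} (ha : a < degeneracy c p)
    (hb : b < degeneracy c p) (l m : ℤ) (h : (a : ℤ) + c * p * l = b + c * p * m) :
    (a : ℤ) = b ∧ l = m := by
  have hd : ((degeneracy c p : ℕ) : ℤ) = |c * p| := by
    rw [degeneracy, abs_mul, Nat.cast_mul, Int.natCast_natAbs, Nat.abs_cast]
  have hab : (a : ℤ) = b := by
    have h1 := congrArg (· % (c * p : ℤ)) h
    simp only [Int.add_mul_emod_self_left] at h1
    rw [← Int.emod_abs, ← Int.emod_abs (b : ℤ), ← hd, Int.emod_eq_of_lt (by omega) (by omega),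
      Int.emod_eq_of_lt (by omega) (by omega)] at h1
    exact h1
  have hcp : (c * p : ℤ) ≠ 0 := mul_ne_zero (by exact_mod_cast hc.ne') hp
  exact ⟨hab, mul_left_cancel₀ hcp (by linarith)⟩

theorem orthonormal_vec (hc : 0 < c) : Orthonormal ℂ (vec c μ ν) := by
  classical
  rw [orthonormal_iff_ite]
  rintro ⟨n | ⟨p, N⟩, s⟩ ⟨n' | ⟨q, N'⟩, t⟩
  · rw [vec, vec, inner_torusVec_torusVec]
    simp [and_assoc]
  · rw [vec, torusVec, ← inner_conj_symm, inner_testVec_of_ne hc _ (by exact q.2)]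
    simp
  · rw [vec.eq_def c μ ν (torus _ _, _)]
    simp only
    rw [torusVec, inner_testVec_of_ne hc _ (by exact p.2)]
    simp
  · by_cases hpq : p = q
    · subst hpq
      have hd := degeneracy_pos hc p.2
      have hκ := landauFreq_pos hc p.2
      simp only [vec]
      rw [inner_landauVec_landauVec hc p.2
        (residue_inj hc p.2 (Nat.mod_lt _ hd) (Nat.mod_lt _ hd)), gaussInner_hermitePoly hκ]
      have h : N = N' ↔ N % degeneracy c p = N' % degeneracy c p ∧
          N / degeneracy c p = N' / degeneracy c p := by
        refine ⟨fun h => by rw [h]; exact ⟨rfl, rfl⟩, fun h => ?_⟩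
        rw [← Nat.mod_add_div N (degeneracy c p), h.1, h.2, Nat.mod_add_div]
      simp only [Prod.mk.injEq, landau.injEq, true_and, h, Nat.cast_inj]
      split_ifs <;> first | rfl | tauto
    · simp only [vec]
      rw [inner_landauVec_landauVec_of_ne hc p.2 _ _ q.2 fun h => hpq (Subtype.ext h.symm)]
      simp [hpq]

theorem orthogonal_vec (hc : 0 < c) :
    (Submodule.span ℂ (Set.range (vec c μ ν)))ᗮ = ⊥ := by
  refine (Submodule.eq_bot_iff _).2 fun Φ hΦ => ?_
  have h : ∀ x, ⟪vec c μ ν x, Φ⟫_ℂ = 0 := fun x =>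
    (Submodule.mem_orthogonal _ _).1 hΦ _ (Submodule.subset_span ⟨x, rfl⟩)
  refine hilb_ext fun p => ?_
  have h0 : slice Φ p =ᵐ[cylMeasure] 0 := by
    by_cases hp : p = 0
    · subst hp
      refine ae_eq_zero_of_torusTest (Hilb.memLp_slice Φ 0) fun n m => PiLp.ext fun s => ?_
      rw [← inner_torus (c := c) (μ := μ) (ν := ν), h]
      rfl
    · refine ae_eq_zero_of_landauCoeff (μ := μ) (ν := ν) hc hp (Hilb.memLp_slice Φ p)
        fun j hj0 hj k => PiLp.ext fun s => ?_
      lift j to ℕ using hj0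
      have hj' : j < degeneracy c p := by
        rw [degeneracy]
        zify
        exact hj
      have := inner_landau (μ := μ) (ν := ν) hc ⟨p, hp⟩ (j + degeneracy c p * k) s Φ
      rw [h, Nat.add_mul_mod_self_left, Nat.mod_eq_of_lt hj', Nat.add_mul_div_left _ _
        (degeneracy_pos hc hp), Nat.div_eq_of_lt hj', zero_add] at this
      rw [← this]
      rfl
  exact h0.trans (slice_congr (Lp.coeFn_zero Spin 2 hilbMeasure) p).symm

/-- The orthonormal basis of modes. -/
def basis (hc : 0 < c) (μ ν : ℝ) : HilbertBasis (Mode × Fin 2) ℂ Hilb :=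
  HilbertBasis.mkOfOrthogonalEqBot (orthonormal_vec (μ := μ) (ν := ν) hc) (orthogonal_vec hc)

theorem basis_apply (hc : 0 < c) (x : Mode × Fin 2) : basis hc μ ν x = vec c μ ν x := by
  rw [basis, HilbertBasis.coe_mkOfOrthogonalEqBot]

/-- The sign of the charge, with value `1` at `0`. -/
def _root_.QHM.chargeSign (p : ℤ) : ℝ := if p < 0 then -1 else 1

theorem _root_.QHM.chargeSign_mul_self (p : ℤ) : chargeSign p * chargeSign p = 1 := by
  unfold chargeSign; split_ifs <;> norm_num

theorem _root_.QHM.chargeSign_mul (p : ℤ) : chargeSign p * p = |(p : ℝ)| := by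
  unfold chargeSign
  split_ifs with h
  · rw [abs_of_neg (by exact_mod_cast h)]; ring
  · rw [abs_of_nonneg (by exact_mod_cast not_lt.1 h)]; ring

/-- Up one Landau level. -/
def next (c : ℕ) : Mode → Mode
  | torus n m => torus n m
  | landau p N => landau p (N + degeneracy c p)

/-- Down one Landau level (only meaningful above the lowest one). -/
def prev (c : ℕ) : Mode → Mode
  | torus n m => torus n m
  | landau p N => landau p (N - degeneracy c p)

/-- There is a lower Landau level. -/
def HasPrev (c : ℕ) : Mode → Prop
  | torus _ _ => True
  | landau p N => degeneracy c p ≤ N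

/-- The coefficient of the annihilation operator. -/
def low (c : ℕ) : Mode → ℂ
  | torus n m => 2 * Real.pi * (Complex.I * m - n)
  | landau p N => (√(2 * landauFreq c p * ((N / degeneracy c p : ℕ) + 1)) : ℝ)

/-- The coefficient of the creation operator. -/
def raise (c : ℕ) : Mode → ℂ
  | torus n m => 2 * Real.pi * (-Complex.I * m - n)
  | landau p N => (√(2 * landauFreq c p * (N / degeneracy c p : ℕ)) : ℝ)

@[simp] theorem charge_next (i : Mode) : (next c i).charge = i.charge := by cases i <;> rfl

@[simp] theorem charge_prev (i : Mode) : (prev c i).charge = i.charge := by cases i <;> rfl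

theorem prev_next (i : Mode) : prev c (next c i) = i := by cases i <;> simp [next, prev]

theorem next_injective : Function.Injective (next c) :=
  Function.LeftInverse.injective prev_next

theorem hasPrev_next (i : Mode) : HasPrev c (next c i) := by cases i <;> simp [next, HasPrev]

theorem next_prev {i : Mode} (h : HasPrev c i) : next c (prev c i) = i := by
  cases i with
  | torus => rfl
  | landau p N => simp only [next, prev]; rw [Nat.sub_add_cancel h]

theorem raise_next (hc : 0 < c) (i : Mode) : raise c (next c i) = conj (low c i) := by
  cases i with
  | torus n m => simp [next, raise, low, Complex.conj_ofNat]
  | landau p N =>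
    rw [next, raise, low, Nat.add_div_right _ (degeneracy_pos hc p.2), Complex.conj_ofReal]
    push_cast
    rfl

theorem raise_of_not_hasPrev {i : Mode} (h : ¬HasPrev c i) : raise c i = 0 := by
  cases i with
  | torus => exact (h trivial).elim
  | landau p N => simp [raise, Nat.div_eq_of_lt (not_le.1 h)]

end Mode

/-- The weak operators: `Φx = ∂Φ/∂x` for the quasi-periodic extension of `Φ` to the line,
`ΦM = 2πcp(x - pμ)Φ + i ∂Φ/∂y`, and `ΦZ = pΦ`. -/
structure WeakDom (c : ℕ) (μ ν : ℝ) (Φ Φx ΦM ΦZ : Hilb) : Prop where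
  dx : ∀ p, WeakQP c ν p (slice Φ p) (slice Φx p)
  gauge : ∀ p, WeakM c μ p (slice Φ p) (slice ΦM p)
  charge : ∀ p, slice ΦZ p =ᵐ[cylMeasure] fun z => (p : ℂ) • slice Φ p z

/-- The action of the weak operators on the coefficients with respect to the modes: the combinations
`±ΦM ± Φx` are annihilation and creation operators. -/
structure CoefDom (c : ℕ) (μ ν : ℝ) (Φ Φx ΦM ΦZ : Hilb) : Prop where
  low : ∀ i s, chargeSign i.charge * ⟪Mode.vec c μ ν (i, s), ΦM⟫_ℂ +
    ⟪Mode.vec c μ ν (i, s), Φx⟫_ℂ = i.low c * ⟪Mode.vec c μ ν (i.next c, s), Φ⟫_ℂ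
  raise : ∀ i s, chargeSign i.charge * ⟪Mode.vec c μ ν (i, s), ΦM⟫_ℂ -
    ⟪Mode.vec c μ ν (i, s), Φx⟫_ℂ = i.raise c * ⟪Mode.vec c μ ν (i.prev c, s), Φ⟫_ℂ
  charge : ∀ i s, ⟪Mode.vec c μ ν (i, s), ΦZ⟫_ℂ = i.charge * ⟪Mode.vec c μ ν (i, s), Φ⟫_ℂ

section ladder

variable {c : ℕ} {μ ν : ℝ} {Φ Φx ΦM ΦZ : Hilb}

theorem landauCoeff_congr {p j : ℤ} {P : ℝ[X]} {f g : ℝ × UnitAddCircle → Spin}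
    (h : f =ᵐ[cylMeasure] g) : landauCoeff c μ ν p j P f = landauCoeff c μ ν p j P g := by
  refine tsum_congr fun l => integral_congr_ae ?_
  filter_upwards [h] with z hz
  rw [hz]

theorem landauCoeff_smul (p j : ℤ) (P : ℝ[X]) (a : ℂ) (f : ℝ × UnitAddCircle → Spin) :
    landauCoeff c μ ν p j P (fun z => a • f z) = a • landauCoeff c μ ν p j P f := by
  rw [landauCoeff, landauCoeff, ← tsum_const_smul'']
  refine tsum_congr fun l => ?_
  rw [← integral_smul]
  simp only [smul_comm a]

theorem WeakDom.landau (hc : 0 < c) (h : WeakDom c μ ν Φ Φx ΦM ΦZ) {p : ℤ} (hp : p ≠ 0) (j : ℤ)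
    (P : ℝ[X]) :
    (chargeSign p : ℂ) • landauCoeff c μ ν p j P (slice ΦM p) +
        landauCoeff c μ ν p j P (slice Φx p) =
      landauCoeff c μ ν p j (creation (landauFreq c p) P) (slice Φ p) ∧
    (chargeSign p : ℂ) • landauCoeff c μ ν p j P (slice ΦM p) -
        landauCoeff c μ ν p j P (slice Φx p) =
      landauCoeff c μ ν p j (derivative P) (slice Φ p) := by
  have hf := Hilb.memLp_slice Φ p
  have h1 := (h.dx p).landauCoeff_eq (μ := μ) (j := j) hc hp hf P
  have h2 : (chargeSign p : ℂ) • landauCoeff c μ ν p j P (slice ΦM p) =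
      landauCoeff c μ ν p j (C (landauFreq c p) * X * P) (slice Φ p) := by
    rw [(h.gauge p).landauCoeff_eq hc hp P, ← landauCoeff_C_mul, ← mul_assoc (C _), ← C_mul,
      ← mul_assoc (C _), landauFreq, ← chargeSign_mul]
    congr 4
    ring
  have h3 := landauCoeff_add (μ := μ) (ν := ν) (j := j) hc hp
    (derivative P - C (landauFreq c p) * X * P) (C (landauFreq c p) * X * P) hf
  have h4 := landauCoeff_add (μ := μ) (ν := ν) (j := j) hc hp
    (derivative P - C (landauFreq c p) * X * P) (creation (landauFreq c p) P) hf
  have e1 : derivative P - C (landauFreq c p) * X * P + C (landauFreq c p) * X * P =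
      derivative P := by ring
  have e2 : derivative P - C (landauFreq c p) * X * P + creation (landauFreq c p) P =
      C (landauFreq c p) * X * P := by
    rw [creation, C_mul]
    have : (C 2 : ℝ[X]) = 2 := rfl
    rw [this]
    ring
  rw [e1] at h3
  rw [e2] at h4
  rw [h1, h2, h3]
  constructor
  · rw [h4]; abel
  · abel

theorem WeakDom.torus (h : WeakDom c μ ν Φ Φx ΦM ΦZ) (n m : ℤ) :
    ∫ z, torusTest n m z • slice ΦM 0 z ∂cylMeasure =
        (-(2 * Real.pi * n) : ℂ) • ∫ z, torusTest n m z • slice Φ 0 z ∂cylMeasure ∧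
    ∫ z, torusTest n m z • slice Φx 0 z ∂cylMeasure =
        (2 * Real.pi * Complex.I * m : ℂ) • ∫ z, torusTest n m z • slice Φ 0 z ∂cylMeasure := by
  have hs := isSmoothFun_torusTest n m
  constructor
  · rw [← (h.gauge 0).2 _ hs, ← integral_smul]
    refine integral_congr_ae (Eventually.of_forall fun z => ?_)
    simp only [dy_torusTest, smul_smul, Int.cast_zero, mul_zero, zero_mul, zero_sub]
    congr 1
    linear_combination (2 * Real.pi * n * torusTest n m z) * Complex.I_mul_I
  · have h1 := (h.dx 0).2 _ (isDualTest_torusTest c ν n m)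
    rw [integral_add (integrable_smul_smooth (Hilb.memLp_slice Φ 0) hs.dx)
      (integrable_smul_smooth (Hilb.memLp_slice Φx 0) hs)] at h1
    rw [eq_neg_of_add_eq_zero_right h1, ← integral_smul, ← integral_neg]
    refine integral_congr_ae (Eventually.of_forall fun z => ?_)
    simp only [dx_torusTest, smul_smul, ← neg_smul]
    congr 1
    ring

theorem WeakDom.coefDom (hc : 0 < c) (h : WeakDom c μ ν Φ Φx ΦM ΦZ) :
    CoefDom c μ ν Φ Φx ΦM ΦZ := by
  constructor
  · rintro (⟨n, m⟩ | ⟨p, N⟩) s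
    · simp only [Mode.next, Mode.low, Mode.inner_torus, (h.torus n m).1, (h.torus n m).2,
        Mode.charge, chargeSign, PiLp.smul_apply, smul_eq_mul, lt_irrefl, if_false]
      push_cast
      ring
    · have hd := degeneracy_pos hc p.2
      simp only [Mode.next, Mode.low, Mode.inner_landau hc, Mode.charge]
      have := congrArg (fun v : Spin => v s) (h.landau hc p.2 ((N % degeneracy c p : ℕ) : ℤ)
        (hermitePoly (landauFreq c p) (N / degeneracy c p))).1
      rw [creation_hermitePoly (landauFreq_pos hc p.2), landauCoeff_C_mul] at this
      rw [Nat.add_div_right _ hd, Nat.add_mod_right]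
      exact this
  · rintro (⟨n, m⟩ | ⟨p, N⟩) s
    · simp only [Mode.prev, Mode.raise, Mode.inner_torus, (h.torus n m).1, (h.torus n m).2,
        Mode.charge, chargeSign, PiLp.smul_apply, smul_eq_mul, lt_irrefl, if_false]
      push_cast
      ring
    · have hd := degeneracy_pos hc p.2
      simp only [Mode.prev, Mode.raise, Mode.inner_landau hc, Mode.charge]
      have := congrArg (fun v : Spin => v s) (h.landau hc p.2 ((N % degeneracy c p : ℕ) : ℤ)
        (hermitePoly (landauFreq c p) (N / degeneracy c p))).2
      refine Eq.trans this ?_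
      by_cases hN : degeneracy c p ≤ N
      · obtain ⟨M, rfl⟩ := Nat.exists_eq_add_of_le' hN
        rw [Nat.add_sub_cancel, Nat.add_div_right _ hd, Nat.add_mod_right,
          derivative_hermitePoly_succ (landauFreq_pos hc p.2),
          landauCoeff_C_mul]
        push_cast
        rfl
      · rw [Nat.div_eq_of_lt (not_le.1 hN), derivative_hermitePoly_zero]
        have := landauCoeff_C_mul (c := c) (μ := μ) (ν := ν) (p := p)
          (j := ((N % degeneracy c p : ℕ) : ℤ)) 0 0 (slice Φ p)
        simp only [map_zero, zero_mul, Complex.ofReal_zero, zero_smul] at this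
        rw [this, Nat.cast_zero, mul_zero, Real.sqrt_zero, Complex.ofReal_zero, zero_mul]
        rfl
  · rintro (⟨n, m⟩ | ⟨p, N⟩) s
    · rw [Mode.inner_torus, Mode.inner_torus]
      have : ∫ z, torusTest n m z • slice ΦZ 0 z ∂cylMeasure = 0 := by
        rw [← integral_zero (ℝ × UnitAddCircle) Spin]
        refine integral_congr_ae ?_
        filter_upwards [h.charge 0] with z hz
        simp [hz]
      simp [this, Mode.charge]
    · rw [Mode.inner_landau hc, Mode.inner_landau hc, landauCoeff_congr (h.charge p),
        landauCoeff_smul]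
      rfl

end ladder

end QHM

/-! ### Weak derivatives and coefficients -/

namespace QHM

open Filter Topology

/-- The function `2πcp(x - pμ)`. -/
def gaugePot (c : ℕ) (μ : ℝ) (p : ℤ) (z : ℝ × UnitAddCircle) : ℂ :=
  2 * Real.pi * c * p * (z.1 - p * μ)

/-- The operator `2πcp(x - pμ) - i ∂/∂y` on test functions. -/
def gaugeFun (c : ℕ) (μ : ℝ) (p : ℤ) (φ : ℝ × UnitAddCircle → ℂ) (z : ℝ × UnitAddCircle) : ℂ :=
  gaugePot c μ p z * φ z - Complex.I * dy φ z

section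

variable {c : ℕ} {μ ν : ℝ} {p : ℤ} {f g h : ℝ × UnitAddCircle → Spin}
  {φ : ℝ × UnitAddCircle → ℂ}

theorem isSmoothFun_gaugePot : IsSmoothFun (gaugePot c μ p) := by
  refine IsSmoothFun.of_fst (g := fun x : ℝ => (2 * Real.pi * c * p * (x - p * μ) : ℂ)) ?_
  exact contDiff_const.mul (Complex.ofRealCLM.contDiff.sub contDiff_const)

theorem IsSmoothFun.gaugeFun (hφ : IsSmoothFun φ) : IsSmoothFun (gaugeFun c μ p φ) :=
  (isSmoothFun_gaugePot.mul hφ).sub ((IsSmoothFun.const _).mul hφ.dy)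

theorem HasWeakDy.weakM (hf : MemLp f 2 cylMeasure) (hg : HasWeakDy f g) :
    WeakM c μ p f fun z => gaugePot c μ p z • f z + Complex.I • g z := by
  refine ⟨(memLp_smul_smooth hf isSmoothFun_gaugePot).add (hg.1.const_smul Complex.I),
    fun φ hφ => ?_⟩
  have h1 := hg.integral_smooth hf hφ
  have i1 := integrable_smul_smooth hf (isSmoothFun_gaugePot (c := c) (μ := μ) (p := p) |>.mul hφ)
  have i2 := (integrable_smul_smooth hf hφ.dy).smul Complex.I
  have i3 := (integrable_smul_smooth hg.1 hφ).smul Complex.I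
  have e1 : ∫ z, (2 * Real.pi * c * p * (z.1 - p * μ) * φ z - Complex.I * dy φ z : ℂ) • f z
      ∂cylMeasure = (∫ z, (gaugePot c μ p z * φ z) • f z ∂cylMeasure) -
        ∫ z, (Complex.I • fun z => dy φ z • f z) z ∂cylMeasure := by
    rw [← integral_sub i1 i2]
    refine integral_congr_ae (Eventually.of_forall fun z => ?_)
    simp only [gaugePot, sub_smul, Pi.smul_apply, smul_smul]
  have e2 : ∫ z, φ z • (gaugePot c μ p z • f z + Complex.I • g z) ∂cylMeasure =
      (∫ z, (gaugePot c μ p z * φ z) • f z ∂cylMeasure) +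
        ∫ z, (Complex.I • fun z => φ z • g z) z ∂cylMeasure := by
    rw [← integral_add i1 i3]
    refine integral_congr_ae (Eventually.of_forall fun z => ?_)
    simp only [smul_add, Pi.smul_apply, smul_smul]
    rw [mul_comm (φ z), mul_comm (φ z)]
  rw [e1, e2]
  simp only [Pi.smul_apply, integral_smul]
  rw [h1, smul_neg, sub_neg_eq_add]

theorem hasWeakDy_of_gauge (hf : MemLp f 2 cylMeasure) (hh : MemLp h 2 cylMeasure)
    (H : ∀ φ, IsTestFun φ →
      ∫ z, gaugeFun c μ p φ z • f z ∂cylMeasure = ∫ z, φ z • h z ∂cylMeasure) :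
    HasWeakDy f fun z => -Complex.I • (h z - gaugePot c μ p z • f z) := by
  have hpot := isSmoothFun_gaugePot (c := c) (μ := μ) (p := p)
  refine ⟨(hh.sub (memLp_smul_smooth hf hpot)).const_smul (-Complex.I), fun φ hφ => ?_⟩
  have h1 := H φ hφ
  have i1 := integrable_smul_smooth hf (hpot.mul hφ.1)
  have i2 := (integrable_smul_smooth hf hφ.1.dy).smul Complex.I
  have e1 : ∫ z, gaugeFun c μ p φ z • f z
      ∂cylMeasure = (∫ z, (gaugePot c μ p z * φ z) • f z ∂cylMeasure) -
        ∫ z, (Complex.I • fun z => dy φ z • f z) z ∂cylMeasure := by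
    rw [← integral_sub i1 i2]
    refine integral_congr_ae (Eventually.of_forall fun z => ?_)
    simp only [gaugeFun, sub_smul, Pi.smul_apply, smul_smul]
  have e2 : ∫ z, φ z • (-Complex.I • (h z - gaugePot c μ p z • f z)) ∂cylMeasure =
      -Complex.I • ((∫ z, φ z • h z ∂cylMeasure) -
        ∫ z, (gaugePot c μ p z * φ z) • f z ∂cylMeasure) := by
    rw [← integral_sub (integrable_smul_smooth hh hφ.1) i1, ← integral_smul]
    refine integral_congr_ae (Eventually.of_forall fun z => ?_)
    simp only [smul_sub, smul_smul]
    congr 2 <;> ring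
  simp only [Pi.smul_apply, integral_smul] at e1
  rw [e2, ← h1, e1, sub_sub_cancel_left, smul_neg, neg_smul, neg_neg, smul_smul,
    Complex.I_mul_I, neg_one_smul, neg_neg]

theorem WeakM.hasWeakDy (hf : MemLp f 2 cylMeasure) (hh : WeakM c μ p f h) :
    HasWeakDy f fun z => -Complex.I • (h z - gaugePot c μ p z • f z) :=
  hasWeakDy_of_gauge hf hh.1 fun φ hφ => hh.2 φ hφ.1

theorem weakM_of_test (hf : MemLp f 2 cylMeasure) (hh : MemLp h 2 cylMeasure)
    (H : ∀ φ, IsTestFun φ →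
      ∫ z, gaugeFun c μ p φ z • f z ∂cylMeasure = ∫ z, φ z • h z ∂cylMeasure) :
    WeakM c μ p f h := by
  have h1 := (hasWeakDy_of_gauge hf hh H).weakM (c := c) (μ := μ) (p := p) hf
  have e : (fun z => gaugePot c μ p z • f z + Complex.I • -Complex.I •
      (h z - gaugePot c μ p z • f z)) = h := by
    funext z
    simp only [smul_smul, mul_neg, Complex.I_mul_I, neg_neg, one_smul, add_sub_cancel]
  rwa [e] at h1

theorem integral_dx_mul_conj {φ χ : ℝ × UnitAddCircle → ℂ} (hφ : IsDualTest c ν p φ)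
    (hχ : IsDualTest c ν p χ) :
    (∫ z, dx χ z * conj (φ z) ∂cylMeasure) + ∫ z, χ z * conj (dx φ z) ∂cylMeasure = 0 := by
  have h := integral_dx (hχ.1.mul hφ.1.star)
  have e : ∀ z, dx (fun z => χ z * conj (φ z)) z = dx χ z * conj (φ z) + χ z * conj (dx φ z) :=
    fun z => by rw [hχ.1.dx_mul hφ.1.star, hφ.1.dx_conj]
  simp only [e] at h
  rw [integral_add (hχ.1.dx.mul hφ.1.star).integrable (hχ.1.mul hφ.1.dx.star).integrable] at h
  rw [h, sub_eq_zero]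
  refine integral_congr_ae (Eventually.of_forall fun y => ?_)
  simp only
  rw [hχ.2 y, hφ.2 y, map_mul]
  linear_combination (-(χ (1, y) * conj (φ (1, y)))) * conj_twist_mul c ν p y

theorem integral_gaugeFun_mul_conj {φ χ : ℝ × UnitAddCircle → ℂ} (hφ : IsSmoothFun φ)
    (hχ : IsSmoothFun χ) :
    ∫ z, gaugeFun c μ p χ z * conj (φ z) ∂cylMeasure =
      ∫ z, χ z * conj (gaugeFun c μ p φ z) ∂cylMeasure := by
  rw [← sub_eq_zero, ← integral_sub ((hχ.gaugeFun).mul hφ.star).integrable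
    (hχ.mul hφ.gaugeFun.star).integrable]
  have h := integral_dy (hχ.mul hφ.star)
  have e : ∀ z, gaugeFun c μ p χ z * conj (φ z) - χ z * conj (gaugeFun c μ p φ z) =
      -Complex.I * dy (fun z => χ z * conj (φ z)) z := by
    intro z
    rw [hχ.dy_mul hφ.star, hφ.dy_conj]
    have h1 : conj (gaugePot c μ p z) = gaugePot c μ p z := by
      simp [gaugePot, Complex.conj_ofNat]
    simp only [gaugeFun, map_sub, map_mul, h1, Complex.conj_I]
    ring
  simp only [e, integral_const_mul, h, mul_zero]

/-- Test vectors lie in the domain of the weak operators, which are therefore symmetric on them. -/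
theorem weakDom_testVec (hφ : IsDualTest c ν p φ) (s : Fin 2) :
    WeakDom c μ ν (testVec p hφ.1 s) (testVec p hφ.1.dx s)
      (testVec p (hφ.1.gaugeFun (c := c) (μ := μ) (p := p)) s)
      ((p : ℂ) • testVec p hφ.1 s) := by
  have hi : ∀ (q : ℤ) {χ ψ : ℝ × UnitAddCircle → ℂ} (hχ : IsSmoothFun χ) (hψ : IsSmoothFun ψ),
      Integrable (fun z => χ z • slice (testVec p hψ s) q z) cylMeasure := fun q χ ψ hχ hψ =>
    integrable_smul_smooth (Hilb.memLp_slice _ q) hχ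
  refine ⟨fun q => ⟨Hilb.memLp_slice _ _, fun χ hχ => ?_⟩,
    fun q => ⟨Hilb.memLp_slice _ _, fun χ hχ => ?_⟩, fun q => ?_⟩
  · rw [integral_add (hi q hχ.1.dx _) (hi q hχ.1 _), integral_smul_slice_testVec,
      integral_smul_slice_testVec]
    by_cases hq : q = p
    · subst hq
      rw [if_pos rfl, if_pos rfl, ← add_smul, integral_dx_mul_conj hφ hχ, zero_smul]
    · rw [if_neg hq, if_neg hq, add_zero]
  · refine Eq.trans (integral_smul_slice_testVec (φ := gaugeFun c μ q χ) q p hφ.1 s) ?_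
    rw [integral_smul_slice_testVec]
    by_cases hq : q = p
    · subst hq
      rw [if_pos rfl, if_pos rfl, integral_gaugeFun_mul_conj hφ.1 hχ]
    · rw [if_neg hq, if_neg hq]
  · have h1 := slice_ofSlice (p := p) (memLp_smul_smooth
      (memLp_const (EuclideanSpace.single s (1 : ℂ))) hφ.1.star) q
    filter_upwards [slice_congr (Lp.coeFn_smul (p : ℂ) (testVec p hφ.1 s)) q, h1] with z hz hz1
    rw [hz]
    change (p : ℂ) • slice (testVec p hφ.1 s) q z = _
    by_cases hq : q = p
    · rw [hq]
    · rw [testVec, hz1, if_neg hq, Pi.zero_apply, smul_zero, smul_zero]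

/-- Annihilation and creation operators are adjoint to each other. -/
theorem Mode.inner_ladder (hc : 0 < c) {u u' v v' : Hilb}
    (h : ∀ i s, ⟪vec c μ ν (i, s), v⟫_ℂ = 0 ∨
      ⟪vec c μ ν (i, s), u'⟫_ℂ = low c i * ⟪vec c μ ν (next c i, s), u⟫_ℂ)
    (h' : ∀ i s, ⟪vec c μ ν (i, s), u⟫_ℂ = 0 ∨
      ⟪vec c μ ν (i, s), v'⟫_ℂ = raise c i * ⟪vec c μ ν (prev c i, s), v⟫_ℂ) :
    ⟪u', v⟫_ℂ = ⟪u, v'⟫_ℂ := by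
  rw [← (basis hc μ ν).tsum_inner_mul_inner, ← (basis hc μ ν).tsum_inner_mul_inner u v']
  simp only [basis_apply]
  set G : Mode × Fin 2 → ℂ := fun x =>
    ⟪u, vec c μ ν x⟫_ℂ * (raise c x.1 * ⟪vec c μ ν (prev c x.1, x.2), v⟫_ℂ) with hG
  have e1 : ∀ x, ⟪u, vec c μ ν x⟫_ℂ * ⟪vec c μ ν x, v'⟫_ℂ = G x := by
    rintro ⟨i, s⟩
    rcases h' i s with h0 | h0
    · simp only [hG]
      rw [← inner_conj_symm u, h0, map_zero, zero_mul, zero_mul]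
    · rw [hG, h0]
  have e2 : ∀ x : Mode × Fin 2, ⟪u', vec c μ ν x⟫_ℂ * ⟪vec c μ ν x, v⟫_ℂ =
      G (next c x.1, x.2) := by
    rintro ⟨i, s⟩
    simp only [hG, raise_next hc, prev_next]
    rcases h i s with h0 | h0
    · rw [h0, mul_zero, mul_zero, mul_zero]
    · rw [← inner_conj_symm u', h0, map_mul, inner_conj_symm]
      ring
  simp only [e1, e2]
  have hinj : Function.Injective fun x : Mode × Fin 2 => (next c x.1, x.2) := by
    rintro ⟨i, s⟩ ⟨i', s'⟩ hx
    rw [Prod.mk.injEq] at hx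
    exact Prod.ext (next_injective hx.1) hx.2
  refine hinj.tsum_eq (f := G) fun x hx => ?_
  refine ⟨(prev c x.1, x.2), Prod.ext (next_prev ?_) rfl⟩
  by_contra h0
  exact hx (by simp [hG, raise_of_not_hasPrev h0])

end

section

variable {c : ℕ} {μ ν : ℝ} {Φ Φx ΦM ΦZ : Hilb}

/-- The relations between the coefficients of `Φ` imply the weak equations, since those hold for the
coefficients of the test vector as well and annihilation and creation operators are adjoint. -/
theorem CoefDom.inner_testVec (hc : 0 < c) (h : CoefDom c μ ν Φ Φx ΦM ΦZ) {p : ℤ}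
    {φ : ℝ × UnitAddCircle → ℂ} (hφ : IsDualTest c ν p φ) (s : Fin 2) :
    ⟪testVec p hφ.1.dx s, Φ⟫_ℂ = -⟪testVec p hφ.1 s, Φx⟫_ℂ ∧
    ⟪testVec p (hφ.1.gaugeFun (c := c) (μ := μ) (p := p)) s, Φ⟫_ℂ =
      ⟪testVec p hφ.1 s, ΦM⟫_ℂ ∧
    ⟪testVec p hφ.1 s, ΦZ⟫_ℂ = p * ⟪testVec p hφ.1 s, Φ⟫_ℂ := by
  have hΨ := (weakDom_testVec (μ := μ) hφ s).coefDom hc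
  set Ψ := testVec p hφ.1 s
  set Ψx := testVec p hφ.1.dx s with hΨx
  set ΨM := testVec p (hφ.1.gaugeFun (c := c) (μ := μ) (p := p)) s with hΨM
  set ε : ℂ := (chargeSign p : ℂ) with hε
  have hεε : conj ε * ε = 1 := by
    rw [hε, Complex.conj_ofReal, ← Complex.ofReal_mul, chargeSign_mul_self, Complex.ofReal_one]
  have h0 : ∀ i : Mode, i.charge ≠ p → ∀ t {ψ : ℝ × UnitAddCircle → ℂ} (hψ : IsSmoothFun ψ),
      ⟪Mode.vec c μ ν (i, t), testVec p hψ s⟫_ℂ = 0 := fun i hi t ψ hψ =>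
    Mode.inner_testVec_of_ne hc (i, t) hi hψ s
  have k1 : ⟪ε • ΨM + Ψx, Φ⟫_ℂ = ⟪Ψ, ε • ΦM - Φx⟫_ℂ := by
    refine Mode.inner_ladder (μ := μ) (ν := ν) hc (fun i t => Or.inr ?_) fun i t => ?_
    · by_cases hi : i.charge = p
      · rw [inner_add_right, inner_smul_right, ← hΨ.low i t, hi]
      · rw [inner_add_right, inner_smul_right, h0 i hi, h0 i hi, h0 _ (by simpa using hi)]
        simp
    · by_cases hi : i.charge = p
      · right
        rw [inner_sub_right, inner_smul_right, ← h.raise i t, hi]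
      · exact Or.inl (h0 i hi t _)
  have k2 : ⟪ε • ΦM + Φx, Ψ⟫_ℂ = ⟪Φ, ε • ΨM - Ψx⟫_ℂ := by
    refine Mode.inner_ladder (μ := μ) (ν := ν) hc (fun i t => ?_) fun i t => Or.inr ?_
    · by_cases hi : i.charge = p
      · right
        rw [inner_add_right, inner_smul_right, ← h.low i t, hi]
      · exact Or.inl (h0 i hi t _)
    · by_cases hi : i.charge = p
      · rw [inner_sub_right, inner_smul_right, ← hΨ.raise i t, hi]
      · rw [inner_sub_right, inner_smul_right, h0 i hi, h0 i hi, h0 _ (by simpa using hi)]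
        simp
  have k2' := congrArg conj k2
  rw [inner_conj_symm, inner_conj_symm] at k2'
  rw [inner_add_left, inner_sub_right, inner_smul_left, inner_smul_right] at k1
  rw [inner_add_right, inner_sub_left, inner_smul_left, inner_smul_right] at k2'
  have hε' : conj ε = ε := Complex.conj_ofReal _
  rw [hε'] at k1 k2' hεε
  refine ⟨by linear_combination (k1 + k2') / 2, ?_, ?_⟩
  · linear_combination ε * (k1 - k2') / 2 - (⟪ΨM, Φ⟫_ℂ - ⟪Ψ, ΦM⟫_ℂ) * hεε
  · rw [← (Mode.basis hc μ ν).tsum_inner_mul_inner, ← (Mode.basis hc μ ν).tsum_inner_mul_inner Ψ Φ,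
      ← tsum_mul_left]
    refine tsum_congr fun x => ?_
    obtain ⟨i, t⟩ := x
    rw [Mode.basis_apply]
    by_cases hi : i.charge = p
    · rw [h.charge, hi]
      ring
    · rw [← inner_conj_symm Ψ, h0 i hi]
      simp

theorem CoefDom.weakDom (hc : 0 < c) (h : CoefDom c μ ν Φ Φx ΦM ΦZ) :
    WeakDom c μ ν Φ Φx ΦM ΦZ := by
  refine ⟨fun p => ⟨Hilb.memLp_slice _ _, fun φ hφ => PiLp.ext fun s => ?_⟩,
    fun p => weakM_of_test (Hilb.memLp_slice _ _) (Hilb.memLp_slice _ _)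
      fun φ hφ => PiLp.ext fun s => ?_, fun p => ?_⟩
  · rw [integral_add (integrable_smul_smooth (Hilb.memLp_slice _ _) hφ.1.dx)
      (integrable_smul_smooth (Hilb.memLp_slice _ _) hφ.1), PiLp.add_apply,
      ← QHM.inner_testVec p hφ.1.dx, ← QHM.inner_testVec p hφ.1, (h.inner_testVec hc hφ s).1]
    simp
  · rw [← QHM.inner_testVec p hφ.1.gaugeFun, ← QHM.inner_testVec p hφ.1,
      (h.inner_testVec hc hφ.isDualTest s).2.1]
  · have hm : MemLp (fun z => (p : ℂ) • slice Φ p z) 2 cylMeasure :=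
      (Hilb.memLp_slice Φ p).const_smul (p : ℂ)
    have h1 := ae_eq_zero_of_test ((Hilb.memLp_slice ΦZ p).sub hm) fun φ hφ => by
      have i1 := integrable_smul_smooth (Hilb.memLp_slice ΦZ p) hφ.1
      have i2 := integrable_smul_smooth hm hφ.1
      simp only [Pi.sub_apply, smul_sub]
      rw [integral_sub i1 i2, sub_eq_zero]
      refine PiLp.ext fun s => ?_
      simp only [smul_comm _ (p : ℂ), integral_smul]
      rw [PiLp.smul_apply, ← QHM.inner_testVec p hφ.1, ← QHM.inner_testVec p hφ.1,
        (h.inner_testVec hc hφ.isDualTest s).2.2, smul_eq_mul]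
    filter_upwards [h1] with z hz
    exact sub_eq_zero.1 hz

end

end QHM

/-! ### The Dirac operator in the basis of modes -/

namespace QHM

open Filter Topology

/-- The component of the Dirac operator in which the annihilation operator appears: it is applied
to the other spin component. For `p < 0` the annihilation operator is `-M + ∂/∂x`, where
`M = 2πcp(x - pμ) + i ∂/∂y`, which exchanges the roles of the components. -/
def lowSpin (p : ℤ) : Fin 2 := if p < 0 then 1 else 0

theorem rev_eq_iff : ∀ {s t : Fin 2}, s.rev = t ↔ s ≠ t := by decide

theorem abs_chargeSign (p : ℤ) : ‖(chargeSign p : ℂ)‖ = 1 := by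
  unfold chargeSign; split_ifs <;> simp

open Classical in
/-- The `2 × 2` blocks of the Dirac operator in the basis of modes: the diagonal entries come from
`2πpσ_Z`, the others from the annihilation and creation operators. -/
def diracBlock {c : ℕ} (hc : 0 < c) : BlockData (Mode × Fin 2) where
  α x := if x.2 = lowSpin x.1.charge then -(2 * Real.pi * |(x.1.charge : ℝ)|)
    else 2 * Real.pi * |(x.1.charge : ℝ)|
  β x := -chargeSign x.1.charge *
    if x.2 = lowSpin x.1.charge then x.1.low c else x.1.raise c
  τ x := if x.2 = lowSpin x.1.charge then (x.1.next c, x.2.rev)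
    else if x.1.HasPrev c then (x.1.prev c, x.2.rev) else x
  invol := by
    rintro ⟨i, s⟩
    by_cases hs : s = lowSpin i.charge
    · have h1 : s.rev ≠ lowSpin i.charge := fun h => rev_eq_iff.1 h hs
      simp [if_pos hs, h1, Mode.hasPrev_next, Mode.prev_next]
    · by_cases hp : i.HasPrev c
      · have h1 : s.rev = lowSpin i.charge := rev_eq_iff.2 hs
        simp [if_neg hs, hp, h1, Mode.next_prev hp]
        rw [← h1, Fin.rev_rev]
      · simp [if_neg hs, hp]
  herm := by
    rintro ⟨i, s⟩
    by_cases hs : s = lowSpin i.charge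
    · have h1 : s.rev ≠ lowSpin i.charge := fun h => rev_eq_iff.1 h hs
      simp [if_pos hs, h1, Mode.raise_next hc]
    · by_cases hp : i.HasPrev c
      · have h1 : s.rev = lowSpin i.charge := rev_eq_iff.2 hs
        have h2 := Mode.raise_next hc (i.prev c)
        rw [Mode.next_prev hp] at h2
        simp [if_neg hs, hp, h1, h2]
      · simp [if_neg hs, hp, Mode.raise_of_not_hasPrev hp]
  cancel := by
    rintro ⟨i, s⟩
    by_cases hs : s = lowSpin i.charge
    · have h1 : s.rev ≠ lowSpin i.charge := fun h => rev_eq_iff.1 h hs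
      simp [if_pos hs, h1]
    · by_cases hp : i.HasPrev c
      · have h1 : s.rev = lowSpin i.charge := rev_eq_iff.2 hs
        simp [if_neg hs, hp, h1]
      · simp [if_neg hs, Mode.raise_of_not_hasPrev hp]
  sq_eq := by
    rintro ⟨i, s⟩
    by_cases hs : s = lowSpin i.charge
    · simp only [if_pos hs, Mode.charge_next]
      split_ifs <;> ring
    · by_cases hp : i.HasPrev c
      · simp only [if_neg hs, if_pos hp, Mode.charge_prev]
        split_ifs <;> ring
      · simp only [if_neg hs, if_neg hp]

section

variable {c : ℕ} (hc : 0 < c)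

theorem Mode.norm_low_torus (n m : ℤ) :
    ‖low c (torus n m)‖ ^ 2 = 4 * Real.pi ^ 2 * ((n : ℝ) ^ 2 + (m : ℝ) ^ 2) := by
  rw [low, ← Complex.normSq_eq_norm_sq]
  simp [Complex.normSq_apply]
  ring

theorem Mode.norm_low_landau (p : {p : ℤ // p ≠ 0}) (N : ℕ) :
    ‖low c (landau p N)‖ ^ 2 = 2 * landauFreq c p * ((N / degeneracy c p : ℕ) + 1) := by
  have : 0 ≤ landauFreq c p := by unfold landauFreq; positivity
  rw [low, Complex.norm_real, Real.norm_eq_abs, sq_abs, Real.sq_sqrt (by positivity)]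

theorem Mode.norm_raise_landau (p : {p : ℤ // p ≠ 0}) (N : ℕ) :
    ‖raise c (landau p N)‖ ^ 2 = 2 * landauFreq c p * (N / degeneracy c p : ℕ) := by
  have : 0 ≤ landauFreq c p := by unfold landauFreq; positivity
  rw [raise, Complex.norm_real, Real.norm_eq_abs, sq_abs, Real.sq_sqrt (by positivity)]

theorem Mode.norm_raise_le {c : ℕ} (hc : 0 < c) (i : Mode) : ‖raise c i‖ ≤ ‖low c i‖ := by
  cases i with
  | torus n m => rw [show torus n m = next c (torus n m) from rfl, raise_next hc]; simp [next]
  | landau p N =>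
    refine abs_le_of_sq_le_sq (?_ : _ ^ 2 ≤ _ ^ 2) (norm_nonneg _) |> (le_abs_self _).trans
    rw [norm_low_landau, norm_raise_landau]
    have : 0 ≤ landauFreq c p := by unfold landauFreq; positivity
    nlinarith

/-- The eigenvalues `±λ` of a block satisfy `λ² ≥ 4π²p² + 4πc|p|k` in Landau level `k`. -/
theorem lam_diracBlock_sq (x : Mode × Fin 2) :
    4 * Real.pi ^ 2 * (x.1.charge : ℝ) ^ 2 + ‖x.1.raise c‖ ^ 2 ≤ (diracBlock hc).lam x ^ 2 := by
  rw [BlockData.lam_sq]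
  have h1 : (diracBlock hc).α x ^ 2 = 4 * Real.pi ^ 2 * (x.1.charge : ℝ) ^ 2 := by
    simp only [diracBlock]
    split_ifs
    · rw [neg_sq, mul_pow, sq_abs]; ring
    · rw [mul_pow, sq_abs]; ring
  have h2 : ‖x.1.raise c‖ ≤ ‖(diracBlock hc).β x‖ := by
    simp only [diracBlock]
    rw [norm_mul, norm_neg, abs_chargeSign, one_mul]
    split_ifs
    · exact Mode.norm_raise_le hc _
    · exact le_rfl
  rw [h1]
  gcongr

theorem norm_raise_le_lam (x : Mode × Fin 2) : ‖x.1.raise c‖ ≤ (diracBlock hc).lam x := by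
  have h := lam_diracBlock_sq hc x
  exact le_of_sq_le_sq (by nlinarith [sq_nonneg (Real.pi * (x.1.charge : ℝ))])
    ((diracBlock hc).lam_nonneg x)

theorem abs_charge_le_lam (x : Mode × Fin 2) : |(x.1.charge : ℝ)| ≤ (diracBlock hc).lam x := by
  have h := lam_diracBlock_sq hc x
  refine le_of_sq_le_sq ?_ ((diracBlock hc).lam_nonneg x)
  rw [sq_abs]
  nlinarith [Real.pi_gt_three, sq_nonneg (x.1.charge : ℝ), sq_nonneg ‖x.1.raise c‖,
    mul_nonneg (sq_nonneg (x.1.charge : ℝ)) (by nlinarith [Real.pi_gt_three] :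
      (0 : ℝ) ≤ 4 * Real.pi ^ 2 - 1)]

/-- On the lowest Landau level of a nonzero charge, where there is no creation term, the
annihilation coefficient is bounded by the charge. -/
theorem norm_low_le_lam (x : Mode × Fin 2) : ‖x.1.low c‖ ≤ (1 + c) * (diracBlock hc).lam x := by
  have hl := (diracBlock hc).lam_nonneg x
  obtain ⟨⟨n, m⟩ | ⟨p, N⟩, s⟩ := x
  · have h : ‖(Mode.torus n m).low c‖ = ‖(Mode.torus n m).raise c‖ := by
      rw [show Mode.torus n m = (Mode.torus n m).next c from rfl, Mode.raise_next hc]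
      simp [Mode.next]
    have h1 := norm_raise_le_lam hc (Mode.torus n m, s)
    simp only [h]
    refine h1.trans (le_mul_of_one_le_left hl ?_)
    linarith [(Nat.cast_nonneg c : (0 : ℝ) ≤ c)]
  · have h := lam_diracBlock_sq hc (Mode.landau p N, s)
    refine le_of_sq_le_sq ?_ (by positivity)
    simp only [Mode.norm_raise_landau, Mode.charge] at h
    rw [Mode.norm_low_landau]
    have hp : 1 ≤ |((p : ℤ) : ℝ)| := by
      rw [← Int.cast_abs]
      exact_mod_cast Int.one_le_abs p.2
    have h1 : 2 * landauFreq c p ≤ c * (4 * Real.pi ^ 2 * ((p : ℤ) : ℝ) ^ 2) := by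
      rw [landauFreq, ← sq_abs ((p : ℤ) : ℝ)]
      have h2 : |((p : ℤ) : ℝ)| ≤ Real.pi * |((p : ℤ) : ℝ)| ^ 2 := by
        nlinarith [Real.pi_gt_three]
      have h3 : 0 ≤ 4 * Real.pi * c := by positivity
      nlinarith [mul_le_mul_of_nonneg_left h2 h3]
    have h4 : 0 ≤ 2 * landauFreq c p * (N / degeneracy c p : ℕ) := by
      have : 0 ≤ landauFreq c p := by unfold landauFreq; positivity
      positivity
    have hc0 : (0 : ℝ) ≤ c := Nat.cast_nonneg c
    have h5 : 2 * landauFreq c p ≤ c * (diracBlock hc).lam (Mode.landau p N, s) ^ 2 :=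
      h1.trans (mul_le_mul_of_nonneg_left (by linarith) hc0)
    have h6 : 0 ≤ 4 * Real.pi ^ 2 * ((p : ℤ) : ℝ) ^ 2 := by positivity
    nlinarith [sq_nonneg ((diracBlock hc).lam (Mode.landau p N, s)),
      mul_nonneg hc0 (sq_nonneg ((diracBlock hc).lam (Mode.landau p N, s))),
      mul_nonneg (mul_nonneg hc0 hc0) (sq_nonneg ((diracBlock hc).lam (Mode.landau p N, s)))]

/-- Labels of the modes by integers. -/
def Mode.code : Mode × Fin 2 → (ℤ × ℤ × Fin 2) ⊕ (ℤ × ℕ × Fin 2)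
  | (torus n m, s) => Sum.inl (n, m, s)
  | (landau p N, s) => Sum.inr (p, N, s)

theorem Mode.code_injective : Function.Injective code := by
  rintro ⟨⟨n, m⟩ | ⟨p, N⟩, s⟩ ⟨⟨n', m'⟩ | ⟨p', N'⟩, s'⟩ h <;> simp_all [code, Subtype.ext_iff]

instance : Infinite (Mode × Fin 2) :=
  Infinite.of_injective (fun n : ℤ => (Mode.torus n 0, (0 : Fin 2))) fun n n' h => by simpa using h

theorem mem_Icc_floor {n : ℤ} {R : ℝ} (h : |(n : ℝ)| ≤ R) :
    n ∈ Finset.Icc (-(⌊R⌋₊ : ℤ)) ⌊R⌋₊ := by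
  have h1 : n.natAbs ≤ ⌊R⌋₊ := Nat.le_floor (by rw [Nat.cast_natAbs, Int.cast_abs]; exact h)
  rw [Finset.mem_Icc]
  omega

/-- In a bounded part of the spectrum, the label `N` of a theta function is `O(R²)`: its level `k`
satisfies `c|p|k ≤ R²`, and `N < c|p|(k + 1)` with `|p| ≤ R`. -/
theorem code_mem_box {R : ℝ} (hR : 1 ≤ R) {x : Mode × Fin 2} (hx : (diracBlock hc).lam x ≤ R) :
    Mode.code x ∈ (Finset.Icc (-(⌊R⌋₊ : ℤ)) ⌊R⌋₊ ×ˢ Finset.Icc (-(⌊R⌋₊ : ℤ)) ⌊R⌋₊ ×ˢ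
      (Finset.univ : Finset (Fin 2))).disjSum (Finset.Icc (-(⌊R⌋₊ : ℤ)) ⌊R⌋₊ ×ˢ
        Finset.range (⌊R ^ 2 + c * R⌋₊ + 1) ×ˢ (Finset.univ : Finset (Fin 2))) := by
  have hR0 : 0 ≤ R := by linarith
  have hl := (diracBlock hc).lam_nonneg x
  have h1 := lam_diracBlock_sq hc x
  have hxR : (diracBlock hc).lam x ^ 2 ≤ R ^ 2 := pow_le_pow_left₀ hl hx 2
  have hch := (abs_charge_le_lam hc x).trans hx
  have hpi : (1 : ℝ) ≤ 4 * Real.pi ^ 2 := by nlinarith [Real.pi_gt_three]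
  obtain ⟨⟨n, m⟩ | ⟨p, N⟩, s⟩ := x
  · have h : ‖(Mode.torus n m).raise c‖ = ‖(Mode.torus n m).low c‖ := by
      rw [show Mode.torus n m = (Mode.torus n m).next c from rfl, Mode.raise_next hc]
      simp [Mode.next]
    simp only [h, Mode.norm_low_torus, Mode.charge] at h1
    have h2 : (n : ℝ) ^ 2 + (m : ℝ) ^ 2 ≤ R ^ 2 := by
      have : 0 ≤ (n : ℝ) ^ 2 + (m : ℝ) ^ 2 := by positivity
      push_cast at h1
      nlinarith
    simp only [Mode.code, Finset.inl_mem_disjSum, Finset.mem_product, Finset.mem_univ, and_true]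
    exact ⟨mem_Icc_floor (abs_le_of_sq_le_sq (by nlinarith) hR0),
      mem_Icc_floor (abs_le_of_sq_le_sq (by nlinarith) hR0)⟩
  · simp only [Mode.norm_raise_landau, Mode.charge] at h1 hch
    simp only [Mode.code, Finset.inr_mem_disjSum, Finset.mem_product, Finset.mem_univ, and_true,
      Finset.mem_range]
    refine ⟨mem_Icc_floor hch, Nat.lt_succ_of_le (Nat.le_floor ?_)⟩
    set d := degeneracy c p with hd
    set k := N / d with hk
    have hdR : (d : ℝ) = c * |((p : ℤ) : ℝ)| := by
      rw [hd, degeneracy, Nat.cast_mul, Nat.cast_natAbs, Int.cast_abs]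
    have h2 : (N : ℝ) ≤ d * k + d := by
      have := Nat.lt_div_mul_add (a := N) (degeneracy_pos hc p.2)
      rw [← hd, ← hk] at this
      exact_mod_cast (by linarith : N ≤ d * k + d)
    have h3 : (d : ℝ) * k ≤ R ^ 2 := by
      rw [landauFreq] at h1
      have h4 : (d : ℝ) * k ≤ 2 * (2 * Real.pi * (c * |((p : ℤ) : ℝ)|)) * k := by
        rw [← hdR]
        have : 0 ≤ (d : ℝ) * k := by positivity
        nlinarith [Real.pi_gt_three]
      have h5 : 0 ≤ 4 * Real.pi ^ 2 * ((p : ℤ) : ℝ) ^ 2 := by positivity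
      nlinarith
    have h6 : (d : ℝ) ≤ c * R := by
      rw [hdR]
      exact mul_le_mul_of_nonneg_left hch (Nat.cast_nonneg c)
    linarith

/-- There are `O(R³)` eigenvalues of modulus at most `R`. -/
theorem card_lam_le (R : ℝ) (hR : 1 ≤ R) (F : Finset (Mode × Fin 2))
    (hF : ∀ x ∈ F, (diracBlock hc).lam x ≤ R) : (F.card : ℝ) ≤ (6 * c + 30) * R ^ 3 := by
  have h1 := Finset.card_le_card_of_injOn Mode.code (fun x hx => code_mem_box hc hR (hF x hx))
    Mode.code_injective.injOn
  rw [Finset.card_disjSum, Finset.card_product, Finset.card_product, Finset.card_product,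
    Finset.card_product, Int.card_Icc, Finset.card_range, Finset.card_univ, Fintype.card_fin] at h1
  have h2 : ((⌊R⌋₊ : ℤ) + 1 - -(⌊R⌋₊ : ℤ)).toNat = 2 * ⌊R⌋₊ + 1 := by omega
  rw [h2] at h1
  have h3 : (⌊R⌋₊ : ℝ) ≤ R := Nat.floor_le (by linarith)
  have h4 : (⌊R ^ 2 + c * R⌋₊ : ℝ) ≤ R ^ 2 + c * R := Nat.floor_le (by positivity)
  have h5 : (F.card : ℝ) ≤ (2 * ⌊R⌋₊ + 1) * ((2 * ⌊R⌋₊ + 1) * 2) +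
      (2 * ⌊R⌋₊ + 1) * ((⌊R ^ 2 + c * R⌋₊ + 1) * 2) := by exact_mod_cast h1
  have h6 : (2 * ⌊R⌋₊ + 1 : ℝ) ≤ 3 * R := by linarith
  have hR2 : R ≤ R ^ 2 := by nlinarith
  have hR3 : R ^ 2 ≤ R ^ 3 := by nlinarith [sq_nonneg R]
  have hc0 : (0 : ℝ) ≤ c := Nat.cast_nonneg c
  have h7 : (⌊R ^ 2 + c * R⌋₊ + 1 : ℝ) ≤ (c + 2) * R ^ 2 := by nlinarith
  calc (F.card : ℝ) ≤ _ := h5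
    _ ≤ 3 * R * (3 * R * 2) + 3 * R * ((c + 2) * R ^ 2 * 2) := by gcongr
    _ = 18 * R ^ 2 + (6 * c + 12) * R ^ 3 := by ring
    _ ≤ (6 * c + 30) * R ^ 3 := by nlinarith

variable (μ ν : ℝ)

/-- The Dirac operator, defined as the self-adjoint operator with the blocks `diracBlock` in the
basis of modes. -/
def diracOp : Hilb →ₗ.[ℂ] Hilb := (diracBlock hc).op (Mode.basis hc μ ν)

theorem memℓp_two_iff {I : Type*} {f : I → ℂ} : Memℓp f 2 ↔ Summable fun i => ‖f i‖ ^ 2 := by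
  rw [memℓp_gen_iff (by norm_num)]
  simp

variable {μ ν}

/-- The elements of the domain have weak derivatives: the eigenvalues of the Dirac operator
dominate the coefficients of the annihilation and creation operators. -/
theorem exists_coefDom {Φ : Hilb} (hΦ : Φ ∈ (diracOp hc μ ν).domain) :
    ∃ Φx ΦM ΦZ, CoefDom c μ ν Φ Φx ΦM ΦZ := by
  set b := Mode.basis hc μ ν with hb
  obtain ⟨y, hy⟩ := ((diracBlock hc).mem_op_domain b).1 hΦ
  set f : Mode × Fin 2 → ℂ := fun x => ⟪b x, Φ⟫_ℂ with hf
  have hlam : Summable fun x => ((diracBlock hc).lam x * ‖f x‖) ^ 2 := by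
    refine (memℓp_two_iff.1 ((diracBlock hc).memℓp_lam_mul b
      (((diracBlock hc).mem_op_graph b).2 hy))).congr fun x => ?_
    rw [norm_mul, Complex.norm_real, Real.norm_of_nonneg ((diracBlock hc).lam_nonneg x)]
  set nx : Mode × Fin 2 → Mode × Fin 2 := fun x => (x.1.next c, x.2) with hnx
  have hinj : Function.Injective nx := by
    rintro ⟨i, s⟩ ⟨i', s'⟩ hx
    rw [Prod.mk.injEq] at hx
    exact Prod.ext (Mode.next_injective hx.1) hx.2
  have hA : Memℓp (fun x : Mode × Fin 2 => x.1.low c * f (nx x)) 2 := by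
    refine memℓp_two_iff.2 (Summable.of_nonneg_of_le (fun x => by positivity) (fun x => ?_)
      (hlam.comp_injective hinj))
    have h1 := norm_raise_le_lam hc (nx x)
    simp only [hnx, Mode.raise_next hc, RCLike.norm_conj] at h1
    rw [Function.comp_apply, norm_mul]
    exact pow_le_pow_left₀ (by positivity) (mul_le_mul_of_nonneg_right h1 (norm_nonneg _)) 2
  have hB : Memℓp (fun x : Mode × Fin 2 => x.1.raise c * f (x.1.prev c, x.2)) 2 := by
    rw [memℓp_two_iff, ← hinj.summable_iff]
    · refine Summable.of_nonneg_of_le (fun x => sq_nonneg _) (fun x => ?_)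
        (hlam.mul_left ((1 + c : ℝ) ^ 2))
      have h1 := norm_low_le_lam hc x
      simp only [Function.comp_apply, hnx, Mode.raise_next hc, Mode.prev_next, norm_mul,
        RCLike.norm_conj]
      rw [← mul_pow, ← mul_assoc]
      gcongr
    · intro x hx
      have h0 : ¬x.1.HasPrev c := fun h =>
        hx ⟨(x.1.prev c, x.2), Prod.ext (Mode.next_prev h) rfl⟩
      rw [Mode.raise_of_not_hasPrev h0, zero_mul, norm_zero, sq, mul_zero]
  have hZ : Memℓp (fun x : Mode × Fin 2 => (x.1.charge : ℂ) * f x) 2 := by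
    refine memℓp_two_iff.2 (Summable.of_nonneg_of_le (fun x => by positivity) (fun x => ?_) hlam)
    have h1 := abs_charge_le_lam hc x
    rw [norm_mul, Complex.norm_intCast]
    gcongr
  have hM : Memℓp (fun x : Mode × Fin 2 => (chargeSign x.1.charge : ℂ) * (1 / 2 *
      (x.1.low c * f (nx x) + x.1.raise c * f (x.1.prev c, x.2)))) 2 := by
    refine memℓp_two_iff.2 ?_
    have := memℓp_two_iff.1 ((hA.add hB).const_mul (1 / 2 : ℂ))
    simpa only [norm_mul, abs_chargeSign, one_mul, Pi.add_apply] using this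
  obtain ⟨Φx, hx⟩ := BlockData.exists_coef b ((hA.sub hB).const_mul (1 / 2 : ℂ))
  obtain ⟨ΦM, hM'⟩ := BlockData.exists_coef b hM
  obtain ⟨ΦZ, hZ'⟩ := BlockData.exists_coef b hZ
  simp only [hb, hf, Mode.basis_apply, Pi.sub_apply] at hx hM' hZ'
  have hε : ∀ p, ((chargeSign p : ℂ)) * chargeSign p = 1 := fun p => by
    rw [← Complex.ofReal_mul, chargeSign_mul_self, Complex.ofReal_one]
  refine ⟨Φx, ΦM, ΦZ, fun i s => ?_, fun i s => ?_, fun i s => hZ' (i, s)⟩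
  · rw [hM', hx, ← mul_assoc, hε]
    ring
  · rw [hM', hx, ← mul_assoc, hε]
    ring

end

end QHM

/-! ### The domain and the formula of the Dirac operator -/

namespace QHM

open Filter Topology Polynomial

/-- Families of functions that are continuous and uniformly bounded on `[0,1] × 𝕋`. -/
structure IsMultiplier (m : ℤ → ℝ × UnitAddCircle → ℂ) (C : ℝ) : Prop where
  continuous : ∀ p, Continuous (m p)
  bound : ∀ p z, z.1 ∈ Set.Icc (0 : ℝ) 1 → ‖m p z‖ ≤ C

theorem ae_hilb_mem : ∀ᵐ w ∂hilbMeasure, w.1 ∈ Set.Icc (0 : ℝ) 1 :=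
  ae_hilb_iff.2 fun _ => ae_cyl_mem

section multiplier

variable {m : ℤ → ℝ × UnitAddCircle → ℂ} {C : ℝ}

theorem IsMultiplier.memLp_smul (hm : IsMultiplier m C) {f : ℝ × UnitAddCircle × ℤ → Spin}
    (hf : MemLp f 2 hilbMeasure) :
    MemLp (fun w => m w.2.2 (w.1, w.2.1) • f w) 2 hilbMeasure := by
  have h1 : Continuous fun u : (ℝ × UnitAddCircle) × ℤ => m u.2 u.1 :=
    continuous_prod_of_discrete_right.2 hm.continuous
  have h2 : Continuous fun w : ℝ × UnitAddCircle × ℤ => m w.2.2 (w.1, w.2.1) :=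
    h1.comp (f := fun w : ℝ × UnitAddCircle × ℤ => ((w.1, w.2.1), w.2.2)) (by fun_prop)
  refine hf.smul (memLp_top_of_bound h2.aestronglyMeasurable C ?_)
  filter_upwards [ae_hilb_mem] with w hw
  exact hm.bound _ _ hw

/-- Multiplication by a multiplier. -/
def mulOp (hm : IsMultiplier m C) : Hilb →L[ℂ] Hilb :=
  LinearMap.mkContinuous
    { toFun := fun ξ => (hm.memLp_smul (Lp.memLp ξ)).toLp
      map_add' := fun ξ η => by
        refine Lp.ext ?_
        filter_upwards [(hm.memLp_smul (Lp.memLp (ξ + η))).coeFn_toLp,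
          (hm.memLp_smul (Lp.memLp ξ)).coeFn_toLp, (hm.memLp_smul (Lp.memLp η)).coeFn_toLp,
          Lp.coeFn_add ξ η, Lp.coeFn_add (hm.memLp_smul (Lp.memLp ξ)).toLp
            (hm.memLp_smul (Lp.memLp η)).toLp] with w h1 h2 h3 h4 h5
        rw [h1, h5, Pi.add_apply, h2, h3, h4, Pi.add_apply, smul_add]
      map_smul' := fun r ξ => by
        refine Lp.ext ?_
        filter_upwards [(hm.memLp_smul (Lp.memLp (r • ξ))).coeFn_toLp,
          (hm.memLp_smul (Lp.memLp ξ)).coeFn_toLp, Lp.coeFn_smul r ξ,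
          Lp.coeFn_smul r (hm.memLp_smul (Lp.memLp ξ)).toLp] with w h1 h2 h3 h4
        rw [h1, RingHom.id_apply, h4, Pi.smul_apply, h2, h3, Pi.smul_apply, smul_comm] }
    C fun ξ => by
      refine Lp.norm_le_mul_norm_of_ae_le_mul ?_
      filter_upwards [(hm.memLp_smul (Lp.memLp ξ)).coeFn_toLp, ae_hilb_mem] with w h1 hw
      simp only [LinearMap.coe_mk, AddHom.coe_mk]
      rw [h1, norm_smul]
      gcongr
      exact hm.bound _ _ hw

theorem mulOp_apply (hm : IsMultiplier m C) (ξ : Hilb) :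
    mulOp hm ξ =ᵐ[hilbMeasure] fun w => m w.2.2 (w.1, w.2.1) • ξ w :=
  (hm.memLp_smul (Lp.memLp ξ)).coeFn_toLp

theorem slice_mulOp (hm : IsMultiplier m C) (ξ : Hilb) (p : ℤ) :
    slice (mulOp hm ξ) p =ᵐ[cylMeasure] fun z => m p z • slice ξ p z :=
  slice_congr (mulOp_apply hm ξ) p

end multiplier

/-- The action of a matrix on the spin space. -/
def actCLM (σ : Matrix (Fin 2) (Fin 2) ℂ) : Spin →L[ℂ] Spin :=
  LinearMap.toContinuousLinearMap
    { toFun := act σ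
      map_add' := fun u v => by
        simp only [act, WithLp.ofLp_add, Matrix.mulVec_add, WithLp.toLp_add]
      map_smul' := fun r v => by
        simp only [act, WithLp.ofLp_smul, Matrix.mulVec_smul, WithLp.toLp_smul, RingHom.id_apply] }

theorem actCLM_apply (σ : Matrix (Fin 2) (Fin 2) ℂ) (v : Spin) : actCLM σ v = act σ v := rfl

theorem act_apply (σ : Matrix (Fin 2) (Fin 2) ℂ) (v : Spin) (s : Fin 2) :
    act σ v s = σ s 0 * v 0 + σ s 1 * v 1 := by
  change σ.mulVec v.ofLp s = _
  simp only [Matrix.mulVec, dotProduct, Fin.sum_univ_two]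

/-- The action of a matrix on the Hilbert space. -/
def hilbAct (σ : Matrix (Fin 2) (Fin 2) ℂ) : Hilb →L[ℂ] Hilb := (actCLM σ).compLpL 2 hilbMeasure

theorem hilbAct_apply (σ : Matrix (Fin 2) (Fin 2) ℂ) (ξ : Hilb) :
    hilbAct σ ξ =ᵐ[hilbMeasure] fun w => act σ (ξ w) := (actCLM σ).coeFn_compLpL ξ

theorem slice_hilbAct (σ : Matrix (Fin 2) (Fin 2) ℂ) (ξ : Hilb) (p : ℤ) :
    slice (hilbAct σ ξ) p =ᵐ[cylMeasure] fun z => actCLM σ (slice ξ p z) :=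
  slice_congr (hilbAct_apply σ ξ) p

section

variable {c : ℕ} {μ ν : ℝ}

theorem integral_smul_hilbAct (σ : Matrix (Fin 2) (Fin 2) ℂ) (Ψ : Hilb) (p : ℤ)
    {φ : ℝ × UnitAddCircle → ℂ} (hφ : IsSmoothFun φ) :
    ∫ z, φ z • slice (hilbAct σ Ψ) p z ∂cylMeasure =
      actCLM σ (∫ z, φ z • slice Ψ p z ∂cylMeasure) := by
  rw [← ContinuousLinearMap.integral_comp_comm _
    (integrable_smul_smooth (Hilb.memLp_slice Ψ p) hφ)]
  refine integral_congr_ae ?_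
  filter_upwards [slice_hilbAct σ Ψ p] with z hz
  rw [hz, map_smul]

theorem inner_vec_hilbAct (hc : 0 < c) (σ : Matrix (Fin 2) (Fin 2) ℂ) (Ψ : Hilb) (i : Mode)
    (s : Fin 2) :
    ⟪Mode.vec c μ ν (i, s), hilbAct σ Ψ⟫_ℂ =
      σ s 0 * ⟪Mode.vec c μ ν (i, 0), Ψ⟫_ℂ + σ s 1 * ⟪Mode.vec c μ ν (i, 1), Ψ⟫_ℂ := by
  cases i with
  | torus n m =>
    rw [Mode.inner_torus, Mode.inner_torus, Mode.inner_torus,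
      integral_smul_hilbAct _ _ _ (isSmoothFun_torusTest n m), actCLM_apply, act_apply]
  | landau p N =>
    have h : landauCoeff c μ ν p ((N % degeneracy c p : ℕ) : ℤ)
        (hermitePoly (landauFreq c p) (N / degeneracy c p)) (slice (hilbAct σ Ψ) p) =
        actCLM σ (landauCoeff c μ ν p ((N % degeneracy c p : ℕ) : ℤ)
        (hermitePoly (landauFreq c p) (N / degeneracy c p)) (slice Ψ p)) := by
      rw [landauCoeff, landauCoeff, ContinuousLinearMap.map_tsum _ (summable_landauTest hc p.2 _
        (integrable_of_memLp (Hilb.memLp_slice Ψ p)))]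
      exact tsum_congr fun l => integral_smul_hilbAct _ _ _ (isSmoothFun_landauTest _ l)
    rw [Mode.inner_landau hc, Mode.inner_landau hc, Mode.inner_landau hc, h, actCLM_apply,
      act_apply]

/-- The value `-(σ_X ΦM + i σ_Y Φx + 2π σ_Z ΦZ)` of the Dirac operator in terms of the weak
derivatives of `WeakDom`. -/
def diracVec (Φx ΦM ΦZ : Hilb) : Hilb :=
  -(hilbAct sigmaX ΦM + Complex.I • hilbAct sigmaY Φx + (2 * Real.pi : ℂ) • hilbAct sigmaZ ΦZ)

theorem diracBlock_seq_low (hc : 0 < c) (f : Mode × Fin 2 → ℂ) {i : Mode} {s : Fin 2}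
    (hs : s = lowSpin i.charge) :
    (diracBlock hc).seq f (i, s) = -(2 * Real.pi * |(i.charge : ℝ)| : ℝ) * f (i, s) -
      chargeSign i.charge * (i.low c * f (i.next c, s.rev)) := by
  simp only [BlockData.seq, diracBlock, if_pos hs, Complex.ofReal_neg]
  ring

theorem diracBlock_seq_high (hc : 0 < c) (f : Mode × Fin 2 → ℂ) {i : Mode} {s : Fin 2}
    (hs : s ≠ lowSpin i.charge) :
    (diracBlock hc).seq f (i, s) = (2 * Real.pi * |(i.charge : ℝ)| : ℝ) * f (i, s) -
      chargeSign i.charge * (i.raise c * f (i.prev c, s.rev)) := by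
  simp only [BlockData.seq, diracBlock, if_neg hs]
  by_cases hP : i.HasPrev c
  · rw [if_pos hP]
    ring
  · rw [Mode.raise_of_not_hasPrev hP]
    ring

/-- The blocks of the Dirac operator are the formula `-(σ_X M + i σ_Y ∂/∂x + 2π σ_Z p)`, with
`M = 2πcp(x - pμ) + i ∂/∂y`, in the basis of modes. -/
theorem CoefDom.mem_graph (hc : 0 < c) {Φ Φx ΦM ΦZ : Hilb} (h : CoefDom c μ ν Φ Φx ΦM ΦZ) :
    (Φ, diracVec Φx ΦM ΦZ) ∈ (diracOp hc μ ν).graph := by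
  rw [diracOp, BlockData.mem_op_graph]
  rintro ⟨i, s⟩
  have hl := h.low i s.rev
  have hr := h.raise i s.rev
  have hz := h.charge i s
  have hII := Complex.I_mul_I
  by_cases hs : s = lowSpin i.charge
  · rw [diracBlock_seq_low hc _ hs, ← chargeSign_mul]
    simp only [Mode.basis_apply, diracVec, inner_neg_right, inner_add_right,
      inner_smul_right, inner_vec_hilbAct hc]
    rw [← hl]
    by_cases hp : i.charge < 0
    · have hs1 : s = 1 := by simpa [lowSpin, hp] using hs
      subst hs1
      simp only [chargeSign, if_pos hp, sigmaX, sigmaY, sigmaZ, Matrix.of_apply, Matrix.cons_val',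
        Matrix.cons_val_zero, Matrix.cons_val_one, Matrix.cons_val_fin_one, hz,
        show (1 : Fin 2).rev = 0 from rfl]
      push_cast
      linear_combination (-⟪Mode.vec c μ ν (i, 0), Φx⟫_ℂ) * hII
    · have hs0 : s = 0 := by simpa [lowSpin, hp] using hs
      subst hs0
      simp only [chargeSign, if_neg hp, sigmaX, sigmaY, sigmaZ, Matrix.of_apply, Matrix.cons_val',
        Matrix.cons_val_zero, Matrix.cons_val_one, Matrix.cons_val_fin_one, hz,
        show (0 : Fin 2).rev = 1 from rfl]
      push_cast
      linear_combination (⟪Mode.vec c μ ν (i, 1), Φx⟫_ℂ) * hII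
  · rw [diracBlock_seq_high hc _ hs, ← chargeSign_mul]
    simp only [Mode.basis_apply, diracVec, inner_neg_right, inner_add_right,
      inner_smul_right, inner_vec_hilbAct hc]
    rw [← hr]
    by_cases hp : i.charge < 0
    · have hs0 : s = 0 := by
        rcases Fin.exists_fin_two.1 ⟨s, rfl⟩ with h0 | h0
        · exact h0
        · exact (hs (by simp [lowSpin, hp, h0])).elim
      subst hs0
      simp only [chargeSign, if_pos hp, sigmaX, sigmaY, sigmaZ, Matrix.of_apply, Matrix.cons_val',
        Matrix.cons_val_zero, Matrix.cons_val_one, Matrix.cons_val_fin_one, hz,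
        show (0 : Fin 2).rev = 1 from rfl]
      push_cast
      linear_combination (⟪Mode.vec c μ ν (i, 1), Φx⟫_ℂ) * hII
    · have hs1 : s = 1 := by
        rcases Fin.exists_fin_two.1 ⟨s, rfl⟩ with h0 | h0
        · exact (hs (by simp [lowSpin, hp, h0])).elim
        · exact h0
      subst hs1
      simp only [chargeSign, if_neg hp, sigmaX, sigmaY, sigmaZ, Matrix.of_apply, Matrix.cons_val',
        Matrix.cons_val_zero, Matrix.cons_val_one, Matrix.cons_val_fin_one, hz,
        show (1 : Fin 2).rev = 0 from rfl]
      push_cast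
      linear_combination (-⟪Mode.vec c μ ν (i, 0), Φx⟫_ℂ) * hII

/-- The maximal domain of the block diagonal operator consists of the elements with weak
derivatives in the Hilbert space. -/
theorem mem_diracOp_domain_iff (hc : 0 < c) {Φ : Hilb} :
    Φ ∈ (diracOp hc μ ν).domain ↔ ∃ Φx ΦM ΦZ, WeakDom c μ ν Φ Φx ΦM ΦZ := by
  constructor
  · intro h
    obtain ⟨Φx, ΦM, ΦZ, h'⟩ := exists_coefDom hc h
    exact ⟨Φx, ΦM, ΦZ, h'.weakDom hc⟩
  · rintro ⟨Φx, ΦM, ΦZ, h⟩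
    exact LinearPMap.mem_domain_iff.2 ⟨_, (h.coefDom hc).mem_graph hc⟩

theorem WeakDom.diracOp_eq (hc : 0 < c) {Φ Φx ΦM ΦZ : Hilb} (h : WeakDom c μ ν Φ Φx ΦM ΦZ)
    (hΦ : Φ ∈ (diracOp hc μ ν).domain) :
    diracOp hc μ ν ⟨Φ, hΦ⟩ = diracVec Φx ΦM ΦZ :=
  LinearPMap.mem_graph_snd_inj _ ((diracOp hc μ ν).mem_graph ⟨Φ, hΦ⟩)
    ((h.coefDom hc).mem_graph hc) rfl

end

section memDomain

variable {c : ℕ} {μ ν : ℝ}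

theorem HasWeakDy.congr {f g g' : ℝ × UnitAddCircle → Spin} (h : HasWeakDy f g)
    (hg : g =ᵐ[cylMeasure] g') : HasWeakDy f g' := by
  refine ⟨h.1.ae_eq hg, fun φ hφ => (h.2 φ hφ).trans ?_⟩
  congr 1
  refine integral_congr_ae ?_
  filter_upwards [hg] with z hz
  rw [hz]

theorem HasWeakDy.fourier_smul {f g : ℝ × UnitAddCircle → Spin} (hf : MemLp f 2 cylMeasure)
    (h : HasWeakDy f g) (n : ℤ) :
    HasWeakDy (fun z => (fourier n z.2 : ℂ) • f z)
      fun z => (fourier n z.2 : ℂ) • (g z + (2 * Real.pi * Complex.I * n : ℂ) • f z) := by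
  have hfn := IsSmoothFun.fourier n
  have hm : MemLp (fun z => g z + (2 * Real.pi * Complex.I * n : ℂ) • f z) 2 cylMeasure :=
    h.1.add (hf.const_smul (2 * Real.pi * Complex.I * n : ℂ))
  refine ⟨memLp_smul_smooth hm hfn, fun φ hφ => ?_⟩
  have h1 := h.integral_smooth hf (hφ.1.mul hfn)
  have i1 := integrable_smul_smooth hf (hφ.1.dy.mul hfn)
  have i2 := integrable_smul_smooth hf ((IsSmoothFun.const (2 * Real.pi * Complex.I * n)).mul
    (hφ.1.mul hfn))
  have i3 := integrable_smul_smooth h.1 (hφ.1.mul hfn)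
  have e1 : ∫ z, dy (fun z => φ z * (fourier n z.2 : ℂ)) z • f z ∂cylMeasure =
      (∫ z, (dy φ z * (fourier n z.2 : ℂ)) • f z ∂cylMeasure) +
      ∫ z, ((2 * Real.pi * Complex.I * n) * (φ z * (fourier n z.2 : ℂ))) • f z ∂cylMeasure := by
    rw [← integral_add i1 i2]
    refine integral_congr_ae (Eventually.of_forall fun z => ?_)
    simp only [hφ.1.dy_mul hfn, dy_fourier, ← add_smul]
    congr 1
    ring
  have e2 : ∫ z, φ z • ((fourier n z.2 : ℂ) • (g z + (2 * Real.pi * Complex.I * n : ℂ) • f z))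
      ∂cylMeasure = (∫ z, (φ z * (fourier n z.2 : ℂ)) • g z ∂cylMeasure) +
      ∫ z, ((2 * Real.pi * Complex.I * n) * (φ z * (fourier n z.2 : ℂ))) • f z ∂cylMeasure := by
    rw [← integral_add i3 i2]
    refine integral_congr_ae (Eventually.of_forall fun z => ?_)
    simp only [smul_add, smul_smul]
    congr 2
    ring
  rw [e2, neg_add, ← h1, e1]
  simp only [smul_smul]
  abel

theorem isMultiplier_fst : IsMultiplier (fun _ z => (z.1 : ℂ)) 1 :=
  ⟨fun _ => by fun_prop, fun _ z hz => by
    rw [Complex.norm_real, Real.norm_eq_abs, abs_of_nonneg hz.1]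
    exact hz.2⟩

theorem isMultiplier_fract (t : ℤ → ℝ) : IsMultiplier (fun p _ => ((Int.fract (t p) : ℝ) : ℂ)) 1 :=
  ⟨fun _ => continuous_const, fun p _ _ => by
    rw [Complex.norm_real, Real.norm_eq_abs, abs_of_nonneg (Int.fract_nonneg _)]
    exact (Int.fract_lt_one _).le⟩

theorem isMultiplier_fourier (n : ℤ → ℤ) : IsMultiplier (fun p z => (fourier (n p) z.2 : ℂ)) 1 :=
  ⟨fun _ => by fun_prop, fun _ _ _ => (norm_fourier _ _).le⟩

/-- The condition on `∂/∂y (e(⌊cp²μ⌋y) Φ)` in the domain amounts to `ΦM` being in the Hilbert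
space: the two expressions differ by the bounded multiples `2πcx` of `pΦ` and
`2π(cp²μ - ⌊cp²μ⌋)` of `Φ`. -/
theorem memDomain_of_weakDom {Φ Φx ΦM ΦZ : Hilb} (h : WeakDom c μ ν Φ Φx ΦM ΦZ) :
    MemDomain c μ ν Φ where
  sobolev p := ⟨Hilb.memLp_slice Φ p, ⟨_, (h.dx p).hasWeakDx (Hilb.memLp_slice Φ p)⟩,
    ⟨_, (h.gauge p).hasWeakDy (Hilb.memLp_slice Φ p)⟩⟩
  boundary p := ⟨_, _, ((h.dx p).hasWeakDx (Hilb.memLp_slice Φ p)).hasTraces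
    (Hilb.memLp_slice Φ p), (h.dx p).traces_eq (Hilb.memLp_slice Φ p)⟩
  growth := by
    refine (Lp.memLp ΦZ).ae_eq (ae_hilb_iff.2 fun p => ?_)
    exact h.charge p
  growth_dx := ⟨Φx, fun p => (h.dx p).hasWeakDx (Hilb.memLp_slice Φ p)⟩
  growth_dy := by
    set G : Hilb := mulOp (isMultiplier_fourier fun p => ⌊c * (p : ℝ) ^ 2 * μ⌋)
      (-Complex.I • ΦM + ((2 * Real.pi * Complex.I * c : ℂ) • mulOp isMultiplier_fst ΦZ -
        (2 * Real.pi * Complex.I : ℂ) • mulOp (isMultiplier_fract fun p => c * (p : ℝ) ^ 2 * μ) Φ))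
      with hG
    refine ⟨G, fun p => ?_⟩
    refine (((h.gauge p).hasWeakDy (Hilb.memLp_slice Φ p)).fourier_smul (Hilb.memLp_slice Φ p)
      ⌊c * (p : ℝ) ^ 2 * μ⌋).congr ?_
    have e1 := slice_mulOp (isMultiplier_fourier fun p => ⌊c * (p : ℝ) ^ 2 * μ⌋)
      (-Complex.I • ΦM + ((2 * Real.pi * Complex.I * c : ℂ) • mulOp isMultiplier_fst ΦZ -
        (2 * Real.pi * Complex.I : ℂ) •
          mulOp (isMultiplier_fract fun p => c * (p : ℝ) ^ 2 * μ) Φ)) p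
    rw [← hG] at e1
    filter_upwards [e1, slice_congr (Lp.coeFn_add (-Complex.I • ΦM)
      ((2 * Real.pi * Complex.I * c : ℂ) • mulOp isMultiplier_fst ΦZ -
        (2 * Real.pi * Complex.I : ℂ) •
          mulOp (isMultiplier_fract fun p => c * (p : ℝ) ^ 2 * μ) Φ)) p,
      slice_congr (Lp.coeFn_sub ((2 * Real.pi * Complex.I * c : ℂ) • mulOp isMultiplier_fst ΦZ)
        ((2 * Real.pi * Complex.I : ℂ) •
          mulOp (isMultiplier_fract fun p => c * (p : ℝ) ^ 2 * μ) Φ)) p,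
      slice_congr (Lp.coeFn_smul (-Complex.I) ΦM) p,
      slice_congr (Lp.coeFn_smul (2 * Real.pi * Complex.I * c : ℂ)
        (mulOp isMultiplier_fst ΦZ)) p,
      slice_congr (Lp.coeFn_smul (2 * Real.pi * Complex.I : ℂ)
          (mulOp (isMultiplier_fract fun p => c * (p : ℝ) ^ 2 * μ) Φ)) p,
      slice_mulOp isMultiplier_fst ΦZ p,
      slice_mulOp (isMultiplier_fract fun p => c * (p : ℝ) ^ 2 * μ) Φ p, h.charge p]
      with z h1 h2 h3 h4 h5 h6 h7 h8 h9
    rw [h1]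
    congr 1
    rw [h2]
    simp only [slice, Pi.add_apply, Pi.sub_apply, Pi.smul_apply] at h3 h4 h5 h6 h7 h8 h9 ⊢
    rw [h3, h4, h5, h6, h7, h8, h9]
    have hfr : ((Int.fract (c * (p : ℝ) ^ 2 * μ) : ℝ) : ℂ) =
        c * (p : ℂ) ^ 2 * μ - ⌊c * (p : ℝ) ^ 2 * μ⌋ := by
      rw [Int.fract]
      push_cast
      rfl
    rw [hfr]
    simp only [gaugePot]
    module

theorem exists_weakDom_of_memDomain {Φ : Hilb} (h : MemDomain c μ ν Φ) :
    ∃ Φx ΦM ΦZ, WeakDom c μ ν Φ Φx ΦM ΦZ := by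
  obtain ⟨Φx, hx⟩ := h.growth_dx
  obtain ⟨G, hG⟩ := h.growth_dy
  set ΦZ : Hilb := h.growth.toLp with hΦZ
  have hZ : ∀ p, slice ΦZ p =ᵐ[cylMeasure] fun z => (p : ℂ) • slice Φ p z := fun p =>
    slice_congr h.growth.coeFn_toLp p
  set A : Hilb := mulOp (isMultiplier_fourier fun p => -⌊c * (p : ℝ) ^ 2 * μ⌋) G with hA
  set ΦM : Hilb := Complex.I • A + ((2 * Real.pi * c : ℂ) • mulOp isMultiplier_fst ΦZ -
    (2 * Real.pi : ℂ) • mulOp (isMultiplier_fract fun p => c * (p : ℝ) ^ 2 * μ) Φ) with hΦM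
  refine ⟨Φx, ΦM, ΦZ, fun p => ?_, fun p => ?_, hZ⟩
  · obtain ⟨u₀, u₁, hu, hu'⟩ := h.boundary p
    exact hu.weakQP hu' (hx p)
  · have hf := Hilb.memLp_slice Φ p
    set n := ⌊c * (p : ℝ) ^ 2 * μ⌋ with hn
    have h1 := (hG p).fourier_smul (memLp_smul_smooth hf (IsSmoothFun.fourier n)) (-n)
    have e0 : ∀ y : UnitAddCircle, (fourier (-n) y * fourier n y : ℂ) = 1 := fun y => by
      rw [← fourier_add]; simp
    have e : (fun z : ℝ × UnitAddCircle => (fourier (-n) z.2 : ℂ) •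
        (fourier n z.2 : ℂ) • slice Φ p z) = slice Φ p := by
      funext z
      rw [smul_smul, e0, one_smul]
    rw [e] at h1
    have h2 := h1.weakM (c := c) (μ := μ) (p := p) hf
    refine ⟨Hilb.memLp_slice _ _, fun φ hφ => (h2.2 φ hφ).trans (integral_congr_ae ?_)⟩
    filter_upwards [slice_mulOp (isMultiplier_fourier fun p => -⌊c * (p : ℝ) ^ 2 * μ⌋) G p,
      slice_congr (Lp.coeFn_add (Complex.I • A) ((2 * Real.pi * c : ℂ) •
        mulOp isMultiplier_fst ΦZ - (2 * Real.pi : ℂ) •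
          mulOp (isMultiplier_fract fun p => c * (p : ℝ) ^ 2 * μ) Φ)) p,
      slice_congr (Lp.coeFn_sub ((2 * Real.pi * c : ℂ) •
        mulOp isMultiplier_fst ΦZ) ((2 * Real.pi : ℂ) •
          mulOp (isMultiplier_fract fun p => c * (p : ℝ) ^ 2 * μ) Φ)) p,
      slice_congr (Lp.coeFn_smul Complex.I A) p,
      slice_congr (Lp.coeFn_smul (2 * Real.pi * c : ℂ) (mulOp isMultiplier_fst ΦZ)) p,
      slice_congr (Lp.coeFn_smul (2 * Real.pi : ℂ)
          (mulOp (isMultiplier_fract fun p => c * (p : ℝ) ^ 2 * μ) Φ)) p,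
      slice_mulOp isMultiplier_fst ΦZ p,
      slice_mulOp (isMultiplier_fract fun p => c * (p : ℝ) ^ 2 * μ) Φ p, hZ p]
      with z h1 h2 h3 h4 h5 h6 h7 h8 h9
    congr 1
    rw [hΦM, h2]
    simp only [slice, Pi.add_apply, Pi.sub_apply, Pi.smul_apply] at h1 h3 h4 h5 h6 h7 h8 h9 ⊢
    rw [h3, h4, h5, h6, h7, h8, h9, hA, h1]
    have hfr : ((Int.fract (c * (p : ℝ) ^ 2 * μ) : ℝ) : ℂ) =
        c * (p : ℂ) ^ 2 * μ - n := by
      rw [Int.fract, hn]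
      push_cast
      rfl
    have e3 : (fourier (-n) z.2 : ℂ) • (G (z.1, z.2, p) + (2 * Real.pi * Complex.I * (-n : ℤ) : ℂ) •
        (fourier n z.2 : ℂ) • Φ (z.1, z.2, p)) = (fourier (-n) z.2 : ℂ) • G (z.1, z.2, p) -
        (2 * Real.pi * Complex.I * n : ℂ) • Φ (z.1, z.2, p) := by
      rw [smul_add, smul_comm _ (2 * Real.pi * Complex.I * (-n : ℤ) : ℂ), smul_smul _ _ (Φ _), e0]
      push_cast
      module
    rw [e3, hfr, ← hn]
    simp only [gaugePot, smul_sub, smul_smul]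
    have e4 : Complex.I * (2 * Real.pi * Complex.I * n) = -(2 * Real.pi * n : ℂ) := by
      linear_combination (2 * Real.pi * n : ℂ) * Complex.I_mul_I
    rw [e4]
    module

theorem memDomain_iff (hc : 0 < c) {Φ : Hilb} :
    Φ ∈ (diracOp hc μ ν).domain ↔ MemDomain c μ ν Φ := by
  rw [mem_diracOp_domain_iff]
  exact ⟨fun ⟨_, _, _, h⟩ => memDomain_of_weakDom h, exists_weakDom_of_memDomain⟩

theorem isDirac_diracOp (hc : 0 < c) : IsDirac c μ ν (diracOp hc μ ν) := by
  refine ⟨fun Φ => memDomain_iff hc, fun Φ Φx Φy hx hy => ?_⟩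
  obtain ⟨Φ, hΦ⟩ := Φ
  obtain ⟨Φx', ΦM, ΦZ, h⟩ := (mem_diracOp_domain_iff hc).1 hΦ
  simp only at hx hy ⊢
  rw [h.diracOp_eq hc hΦ]
  have hf := fun p => Hilb.memLp_slice Φ p
  have e1 : Φx' =ᵐ[hilbMeasure] Φx := ae_hilb_iff.2 fun p =>
    ((h.dx p).hasWeakDx (hf p)).unique (hx p)
  have e2 : (fun w : ℝ × UnitAddCircle × ℤ => -Complex.I • (ΦM w -
      gaugePot c μ w.2.2 (w.1, w.2.1) • Φ w)) =ᵐ[hilbMeasure] Φy := ae_hilb_iff.2 fun p =>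
    ((h.gauge p).hasWeakDy (hf p)).unique (hy p)
  have e3 : ΦZ =ᵐ[hilbMeasure] fun w => (w.2.2 : ℂ) • Φ w := ae_hilb_iff.2 h.charge
  rw [diracVec]
  filter_upwards [e1, e2, e3, Lp.coeFn_neg (hilbAct sigmaX ΦM + Complex.I • hilbAct sigmaY Φx' +
    (2 * Real.pi : ℂ) • hilbAct sigmaZ ΦZ), Lp.coeFn_add (hilbAct sigmaX ΦM +
    Complex.I • hilbAct sigmaY Φx') ((2 * Real.pi : ℂ) • hilbAct sigmaZ ΦZ),
    Lp.coeFn_add (hilbAct sigmaX ΦM) (Complex.I • hilbAct sigmaY Φx'),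
    Lp.coeFn_smul Complex.I (hilbAct sigmaY Φx'),
    Lp.coeFn_smul (2 * Real.pi : ℂ) (hilbAct sigmaZ ΦZ), hilbAct_apply sigmaX ΦM,
    hilbAct_apply sigmaY Φx', hilbAct_apply sigmaZ ΦZ] with w h1 h2 h3 h4 h5 h6 h7 h8 h9 h10 h11
  rw [h4, Pi.neg_apply, h5, Pi.add_apply, h6, Pi.add_apply, h7, h8, Pi.smul_apply, Pi.smul_apply,
    h9, h10, h11, h1, h3]
  have hX : deltaX c μ Φ Φy w = Complex.I • ΦM w := by
    rw [deltaX, ← h2, gaugePot]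
    module
  rw [hX, deltaY, deltaZ]
  simp only [← actCLM_apply, map_smul, map_neg, smul_add, smul_smul, smul_neg, Complex.I_mul_I]
  have e4 : Complex.I * (2 * Real.pi * Complex.I * w.2.2) = -(2 * Real.pi * w.2.2 : ℂ) := by
    linear_combination (2 * Real.pi * w.2.2 : ℂ) * Complex.I_mul_I
  rw [e4]
  module

end memDomain

end QHM

/-! ### The representation of the quantum Heisenberg manifold -/

namespace QHM

open Filter Topology

/-- Translation of the slices: `p ↦ p - q`. -/
def shiftEquiv (q : ℤ) : ℝ × UnitAddCircle × ℤ ≃ᵐ ℝ × UnitAddCircle × ℤ :=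
  (MeasurableEquiv.refl ℝ).prodCongr
    ((MeasurableEquiv.refl UnitAddCircle).prodCongr (MeasurableEquiv.subRight q))

theorem shiftEquiv_apply (q : ℤ) (w : ℝ × UnitAddCircle × ℤ) :
    shiftEquiv q w = (w.1, w.2.1, w.2.2 - q) := rfl

theorem measurePreserving_shiftEquiv (q : ℤ) :
    MeasurePreserving (shiftEquiv q) hilbMeasure hilbMeasure := by
  have h : MeasurePreserving (fun p : ℤ => p - q) Measure.count Measure.count := by
    refine ⟨measurable_of_countable _, ?_⟩
    refine Measure.ext_of_singleton fun a => ?_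
    have e : (fun p : ℤ => p - q) ⁻¹' {a} = {a + q} := by
      ext p
      simp [sub_eq_iff_eq_add]
    rw [Measure.map_apply (measurable_of_countable _) (measurableSet_singleton a), e,
      Measure.count_singleton, Measure.count_singleton]
  exact (MeasurePreserving.id _).prod ((MeasurePreserving.id _).prod h)

/-- The unitary operator `(S_q ξ)(x, y, p) = ξ(x, y, p - q)`. -/
def shiftOp (q : ℤ) : Hilb →L[ℂ] Hilb :=
  (Lp.compMeasurePreservingₗᵢ ℂ (shiftEquiv q)
    (measurePreserving_shiftEquiv q)).toContinuousLinearMap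

theorem shiftOp_apply (q : ℤ) (ξ : Hilb) :
    shiftOp q ξ =ᵐ[hilbMeasure] fun w => ξ (w.1, w.2.1, w.2.2 - q) :=
  Lp.coeFn_compMeasurePreserving ξ (measurePreserving_shiftEquiv q)

section

variable {c : ℕ} {μ ν : ℝ}

/-- The function `a(x - 2pμ, y - 2pν, q)`. -/
def coefFun (a : Smooth c (-μ) (-ν)) (q p : ℤ) (z : ℝ × UnitAddCircle) : ℂ :=
  a.1 (z.1 - 2 * p * μ) (z.2 - ((2 * p * ν : ℝ) : UnitAddCircle)) q

theorem Smooth.isSmoothFun (a : Smooth c (-μ) (-ν)) (q : ℤ) :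
    IsSmoothFun fun z => a.1 z.1 z.2 q := a.2.1 q

theorem isSmoothFun_coefFun (a : Smooth c (-μ) (-ν)) (q p : ℤ) : IsSmoothFun (coefFun a q p) :=
  (a.isSmoothFun q).translate (2 * p * μ) (2 * p * ν)

theorem Smooth.exists_bound (a : Smooth c (-μ) (-ν)) (q : ℤ) :
    ∃ C : ℝ, ∀ x y, ‖a.1 x y q‖ ≤ C := by
  obtain ⟨C, -, hC⟩ := (a.isSmoothFun q).bounded
  refine ⟨C, fun x y => ?_⟩
  have h := a.shift ⌊x⌋ (Int.fract x) y q
  rw [Int.fract_add_floor] at h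
  rw [h, norm_mul, norm_fourier, one_mul]
  exact hC (Int.fract x, y) ⟨Int.fract_nonneg x, (Int.fract_lt_one x).le⟩

theorem isMultiplier_coefFun (a : Smooth c (-μ) (-ν)) (q : ℤ) :
    IsMultiplier (coefFun a q) (a.exists_bound q).choose :=
  ⟨fun p => (isSmoothFun_coefFun a q p).continuous, fun _ _ _ => (a.exists_bound q).choose_spec _ _⟩

/-- The summands of the representation. -/
def piTerm (a : Smooth c (-μ) (-ν)) (q : ℤ) : Hilb →L[ℂ] Hilb :=
  mulOp (isMultiplier_coefFun a q) ∘L shiftOp q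

theorem piTerm_apply (a : Smooth c (-μ) (-ν)) (q : ℤ) (ξ : Hilb) :
    piTerm a q ξ =ᵐ[hilbMeasure]
      fun w => coefFun a q w.2.2 (w.1, w.2.1) • ξ (w.1, w.2.1, w.2.2 - q) := by
  filter_upwards [mulOp_apply (isMultiplier_coefFun a q) (shiftOp q ξ), shiftOp_apply q ξ]
    with w h1 h2
  rw [← h2]
  exact h1

theorem slice_piTerm (a : Smooth c (-μ) (-ν)) (q : ℤ) (ξ : Hilb) (p : ℤ) :
    slice (piTerm a q ξ) p =ᵐ[cylMeasure] fun z => coefFun a q p z • slice ξ (p - q) z :=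
  slice_congr (piTerm_apply a q ξ) p

/-- The representation by bounded operators. -/
def piOp (a : Smooth c (-μ) (-ν)) : Hilb →L[ℂ] Hilb := ∑ q ∈ a.supp, piTerm a q

theorem piTerm_of_notMem (a : Smooth c (-μ) (-ν)) {q : ℤ} (hq : q ∉ a.supp) : piTerm a q = 0 := by
  refine ContinuousLinearMap.ext fun ξ => Lp.ext ?_
  filter_upwards [piTerm_apply a q ξ, Lp.coeFn_zero Spin 2 hilbMeasure] with w h1 h2
  rw [h1, coefFun, a.eq_zero_of_notMem hq, zero_smul]
  exact h2.symm

theorem piOp_eq_sum (a : Smooth c (-μ) (-ν)) {S : Finset ℤ} (hS : a.supp ⊆ S) :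
    piOp a = ∑ q ∈ S, piTerm a q :=
  Finset.sum_subset hS fun _ _ hq => piTerm_of_notMem a hq

theorem coeFn_sum_piTerm (a : Smooth c (-μ) (-ν)) (S : Finset ℤ) (ξ : Hilb) :
    ((∑ q ∈ S, piTerm a q) ξ : Hilb) =ᵐ[hilbMeasure] fun w =>
      ∑ q ∈ S, coefFun a q w.2.2 (w.1, w.2.1) • ξ (w.1, w.2.1, w.2.2 - q) := by
  induction S using Finset.cons_induction with
  | empty =>
    filter_upwards [Lp.coeFn_zero Spin 2 hilbMeasure] with w h
    simpa using h
  | cons q S hq ih =>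
    simp only [Finset.sum_cons]
    filter_upwards [Lp.coeFn_add (piTerm a q ξ) ((∑ q ∈ S, piTerm a q) ξ), piTerm_apply a q ξ, ih]
      with w h1 h2 h3
    rw [← h2, ← h3]
    exact h1

theorem piOp_apply (a : Smooth c (-μ) (-ν)) {S : Finset ℤ} (hS : a.supp ⊆ S) (ξ : Hilb) :
    piOp a ξ =ᵐ[hilbMeasure] fun w =>
      ∑ q ∈ S, coefFun a q w.2.2 (w.1, w.2.1) • ξ (w.1, w.2.1, w.2.2 - q) := by
  rw [piOp_eq_sum a hS]
  exact coeFn_sum_piTerm a S ξ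

theorem piOp_add (a b : Smooth c (-μ) (-ν)) : piOp (a + b) = piOp a + piOp b := by
  set S := (a + b).supp ∪ (a.supp ∪ b.supp) with hS
  refine ContinuousLinearMap.ext fun ξ => Lp.ext ?_
  filter_upwards [piOp_apply (a + b) (S := S) Finset.subset_union_left ξ,
    piOp_apply a (S := S) (Finset.subset_union_left.trans Finset.subset_union_right) ξ,
    piOp_apply b (S := S) (Finset.subset_union_right.trans Finset.subset_union_right) ξ,
    Lp.coeFn_add (piOp a ξ) (piOp b ξ)] with w h1 h2 h3 h4
  rw [h1, add_apply, h4, Pi.add_apply, h2, h3, ← Finset.sum_add_distrib]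
  exact Finset.sum_congr rfl fun q _ => add_smul _ _ _

theorem piOp_smul (r : ℂ) (a : Smooth c (-μ) (-ν)) : piOp (r • a) = r • piOp a := by
  set S := (r • a).supp ∪ a.supp with hS
  refine ContinuousLinearMap.ext fun ξ => Lp.ext ?_
  filter_upwards [piOp_apply (r • a) (S := S) Finset.subset_union_left ξ,
    piOp_apply a (S := S) Finset.subset_union_right ξ,
    Lp.coeFn_smul r (piOp a ξ)] with w h1 h2 h4
  rw [h1, smul_apply, h4, Pi.smul_apply, h2, Finset.smul_sum]
  exact Finset.sum_congr rfl fun q _ => mul_smul _ _ _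

theorem piOp_one : piOp (1 : Smooth c (-μ) (-ν)) = 1 := by
  have hS : (1 : Smooth c (-μ) (-ν)).supp ⊆ {0} := by
    intro q hq
    obtain ⟨x, y, h⟩ : ∃ x y, (1 : Smooth c (-μ) (-ν)).1 x y q ≠ 0 := by
      simpa [Smooth.supp] using hq
    by_contra h0
    exact h (if_neg (by simpa using h0))
  refine ContinuousLinearMap.ext fun ξ => Lp.ext ?_
  filter_upwards [piOp_apply 1 hS ξ] with w h1
  rw [h1]
  simp [coefFun, Smooth.one_apply, oneFun]

theorem coefFun_mul (a b : Smooth c (-μ) (-ν)) {S : Finset ℤ} (hS : a.supp ⊆ S)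
    (r p : ℤ) (z : ℝ × UnitAddCircle) :
    coefFun (a * b) r p z = ∑ q ∈ S, coefFun a q p z * coefFun b (r - q) (p - q) z := by
  rw [coefFun, Smooth.mul_apply, convFun_eq_sum a b.1 S hS]
  refine Finset.sum_congr rfl fun q _ => ?_
  have e1 : z.1 - 2 * p * μ - 2 * q * -μ = z.1 - 2 * ((p - q : ℤ) : ℝ) * μ := by push_cast; ring
  have e2 : z.2 - ((2 * p * ν : ℝ) : UnitAddCircle) - ((2 * q * -ν : ℝ) : UnitAddCircle) =
      z.2 - ((2 * ((p - q : ℤ) : ℝ) * ν : ℝ) : UnitAddCircle) := by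
    rw [sub_sub, ← AddCircle.coe_add]
    congr 3
    push_cast
    ring
  rw [coefFun, coefFun, e1, e2]

theorem piOp_mul (a b : Smooth c (-μ) (-ν)) : piOp (a * b) = piOp a * piOp b := by
  set S := (a * b).supp ∪ (a.supp ×ˢ b.supp).image fun u => u.1 + u.2 with hS
  refine ContinuousLinearMap.ext fun ξ => Lp.ext ?_
  have hb : ∀ q : ℤ, ∀ᵐ w ∂hilbMeasure, piOp b ξ (w.1, w.2.1, w.2.2 - q) =
      ∑ r ∈ b.supp, coefFun b r (w.2.2 - q) (w.1, w.2.1) • ξ (w.1, w.2.1, w.2.2 - q - r) := fun q =>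
    (measurePreserving_shiftEquiv q).quasiMeasurePreserving.ae (piOp_apply b subset_rfl ξ)
  filter_upwards [piOp_apply (a * b) (S := S) Finset.subset_union_left ξ,
    piOp_apply a subset_rfl (piOp b ξ), ae_all_iff.2 hb] with w h1 h2 h3
  change _ = (piOp a (piOp b ξ) : Hilb) w
  rw [h1, h2]
  simp only [h3, Finset.smul_sum, smul_smul,
    coefFun_mul a b subset_rfl, Finset.sum_smul]
  rw [Finset.sum_comm]
  refine Finset.sum_congr rfl fun q hq => ?_
  set f : ℤ → Spin := fun s => (coefFun a q w.2.2 (w.1, w.2.1) *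
    coefFun b (s - q) (w.2.2 - q) (w.1, w.2.1)) • ξ (w.1, w.2.1, w.2.2 - s) with hf
  have e1 : ∑ s ∈ S, f s = ∑ s ∈ b.supp.image (fun r => q + r), f s := by
    symm
    refine Finset.sum_subset ?_ ?_
    · intro s hs
      obtain ⟨r, hr, rfl⟩ := Finset.mem_image.1 hs
      exact Finset.mem_union_right _
        (Finset.mem_image.2 ⟨(q, r), Finset.mem_product.2 ⟨hq, hr⟩, rfl⟩)
    · intro s _ hs
      have hb : s - q ∉ b.supp := fun h => hs (Finset.mem_image.2 ⟨s - q, h, by ring⟩)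
      simp only [hf, coefFun, b.eq_zero_of_notMem hb, mul_zero, zero_smul]
  rw [e1, Finset.sum_image (by intro r _ r' _ h; simpa using h)]
  refine Finset.sum_congr rfl fun r _ => ?_
  simp only [hf, add_sub_cancel_left, sub_sub]

theorem coefFun_star (a : Smooth c (-μ) (-ν)) (q p : ℤ) (z : ℝ × UnitAddCircle) :
    coefFun (star a) (-q) (p - q) z = conj (coefFun a q p z) := by
  have e1 : z.1 - 2 * ((p - q : ℤ) : ℝ) * μ - 2 * ((-q : ℤ) : ℝ) * -μ = z.1 - 2 * p * μ := by
    push_cast; ring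
  have e2 : z.2 - ((2 * ((p - q : ℤ) : ℝ) * ν : ℝ) : UnitAddCircle) -
      ((2 * ((-q : ℤ) : ℝ) * -ν : ℝ) : UnitAddCircle) =
      z.2 - ((2 * p * ν : ℝ) : UnitAddCircle) := by
    rw [sub_sub, ← AddCircle.coe_add]
    congr 3
    push_cast
    ring
  rw [coefFun, Smooth.star_apply, starFun, e1, e2, neg_neg]
  rfl

theorem inner_piTerm_star (a : Smooth c (-μ) (-ν)) (q : ℤ) (ξ η : Hilb) :
    ⟪piTerm (star a) (-q) ξ, η⟫_ℂ = ⟪ξ, piTerm a q η⟫_ℂ := by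
  rw [L2.inner_def, L2.inner_def, ← (measurePreserving_shiftEquiv q).integral_comp
    (shiftEquiv q).measurableEmbedding]
  refine integral_congr_ae ?_
  filter_upwards [(measurePreserving_shiftEquiv q).quasiMeasurePreserving.ae
    (piTerm_apply (star a) (-q) ξ), piTerm_apply a q η] with w h1 h2
  rw [h1, h2]
  simp only [shiftEquiv_apply, coefFun_star, inner_smul_left, inner_smul_right, Complex.conj_conj,
    sub_neg_eq_add, sub_add_cancel]

theorem piOp_star (a : Smooth c (-μ) (-ν)) : piOp (star a) = star (piOp a) := by
  rw [ContinuousLinearMap.star_eq_adjoint, ContinuousLinearMap.eq_adjoint_iff]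
  intro ξ η
  have hS : (star a).supp ⊆ a.supp.image fun q => -q := by
    intro q hq
    obtain ⟨x, y, h⟩ : ∃ x y, (star a).1 x y q ≠ 0 := by simpa [Smooth.supp] using hq
    refine Finset.mem_image.2 ⟨-q, ?_, neg_neg q⟩
    by_contra hp
    exact h (by simp [Smooth.star_apply, starFun, a.eq_zero_of_notMem hp])
  rw [piOp_eq_sum (star a) hS, Finset.sum_image (by intro r _ r' _ h; simpa using h), piOp,
    sum_apply, sum_apply, sum_inner, inner_sum]
  exact Finset.sum_congr rfl fun q _ => inner_piTerm_star a q ξ η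

theorem piOp_zero : piOp (0 : Smooth c (-μ) (-ν)) = 0 := by
  have h := piOp_smul 0 (0 : Smooth c (-μ) (-ν))
  rwa [zero_smul, zero_smul] at h

theorem piOp_algebraMap (r : ℂ) :
    piOp (algebraMap ℂ (Smooth c (-μ) (-ν)) r) = algebraMap ℂ (Hilb →L[ℂ] Hilb) r := by
  rw [Algebra.algebraMap_eq_smul_one, Algebra.algebraMap_eq_smul_one, piOp_smul, piOp_one]

/-- The representation of the algebra of smooth elements. -/
def piRep (c : ℕ) (μ ν : ℝ) : Smooth c (-μ) (-ν) →⋆ₐ[ℂ] (Hilb →L[ℂ] Hilb) where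
  toFun := piOp
  map_one' := piOp_one
  map_mul' := piOp_mul
  map_zero' := piOp_zero
  map_add' := piOp_add
  commutes' := piOp_algebraMap
  map_star' := piOp_star

theorem piRep_apply (a : Smooth c (-μ) (-ν)) : piRep c μ ν a = piOp a := rfl

theorem isPiTilde_piRep : IsPiTilde μ ν (piRep c μ ν) := by
  intro a ξ
  filter_upwards [piOp_apply a subset_rfl ξ] with w h
  rw [piRep_apply, h]
  refine (finsum_eq_sum_of_support_subset _ fun q hq => ?_).symm
  by_contra h'
  have h0 : coefFun a q w.2.2 (w.1, w.2.1) = 0 := a.eq_zero_of_notMem (by simpa using h') _ _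
  exact hq ((congrArg (· • ξ (w.1, w.2.1, w.2.2 - q)) h0).trans (zero_smul _ _))

/-- An element with vanishing coefficients almost everywhere on the fundamental domain is zero, by
continuity and quasi-periodicity. -/
theorem Smooth.eq_zero_of_ae {a : Smooth c (-μ) (-ν)}
    (h : ∀ q, coefFun a q q =ᵐ[cylMeasure] 0) : a = 0 := by
  refine Smooth.ext_fun fun x y q => ?_
  have hc := (isSmoothFun_coefFun a q q).continuous
  have h1 : coefFun a q q =ᵐ[((volume : Measure ℝ).prod
      (volume : Measure UnitAddCircle)).restrict (Set.Ioo 0 1 ×ˢ Set.univ)] 0 := by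
    rw [← Measure.prod_restrict, Measure.restrict_univ, restrict_Ioo_eq_restrict_Icc]
    exact h q
  have h2 := Measure.eqOn_open_of_ae_eq h1 (isOpen_Ioo.prod isOpen_univ) hc.continuousOn
    continuousOn_const
  have h3 := h2.closure hc continuous_const
  rw [closure_prod_eq, closure_Ioo (by norm_num), closure_univ] at h3
  have h4 : ∀ u v, a.1 u v q = 0 := by
    intro u v
    have h5 := a.shift ⌊u + 2 * q * μ⌋ (Int.fract (u + 2 * q * μ) - 2 * q * μ) v q
    have h6 : coefFun a q q (Int.fract (u + 2 * q * μ), v + ((2 * q * ν : ℝ) : UnitAddCircle)) =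
        0 := h3 ⟨⟨Int.fract_nonneg _, (Int.fract_lt_one _).le⟩, trivial⟩
    simp only [coefFun, add_sub_cancel_right] at h6
    have e : Int.fract (u + 2 * q * μ) - 2 * q * μ + ⌊u + 2 * q * μ⌋ = u := by
      linarith [Int.fract_add_floor (u + 2 * q * μ)]
    rwa [h6, mul_zero, e] at h5
  exact h4 x y

theorem piRep_injective : Function.Injective (piRep c μ ν) := by
  refine (injective_iff_map_eq_zero _).2 fun a ha => Smooth.eq_zero_of_ae fun q => ?_
  rw [piRep_apply] at ha
  set ξ : Hilb := testVec 0 (IsSmoothFun.const 1) 0 with hξ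
  have hs : ∀ p, slice ξ p =ᵐ[cylMeasure] if p = 0 then
      (fun _ => conj (1 : ℂ) • EuclideanSpace.single (0 : Fin 2) (1 : ℂ)) else 0 := fun p =>
    slice_ofSlice (p := 0) _ p
  have h1 := slice_congr (piOp_apply a (S := insert q a.supp) (Finset.subset_insert _ _) ξ) q
  rw [ha] at h1
  filter_upwards [h1, slice_congr (Lp.coeFn_zero Spin 2 hilbMeasure) q,
    ae_all_iff.2 fun r => hs (q - r)] with z h1 h2 h3
  simp only [slice] at h1 h2 h3
  rw [zero_apply, h2] at h1
  simp only [h3] at h1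
  rw [Finset.sum_eq_single q] at h1
  · have h4 := congrArg (fun v : Spin => v 0) h1
    simpa using h4.symm
  · intro r _ hr
    rw [if_neg (sub_ne_zero.2 hr.symm), Pi.zero_apply, smul_zero]
  · intro hq
    exact (hq (Finset.mem_insert_self _ _)).elim

end

end QHM

/-! ### Derivations of the algebra and commutators with the Dirac operator -/

namespace QHM

open Filter Topology

section

variable {c : ℕ} {μ ν : ℝ}

theorem dy_fourier_sub (n : ℤ) (θ : UnitAddCircle) (z : ℝ × UnitAddCircle) :
    dy (fun z => (fourier n (z.2 - θ) : ℂ)) z =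
      2 * Real.pi * Complex.I * n * fourier n (z.2 - θ) := by
  rw [← dy_fourier n (z.1, z.2 - θ), dy, dy]
  simp only [add_sub_right_comm]

theorem Smooth.slice_eq_zero (a : Smooth c (-μ) (-ν)) {q : ℤ} (hq : q ∉ a.supp) :
    (fun z : ℝ × UnitAddCircle => a.1 z.1 z.2 q) = fun _ => 0 :=
  funext fun _ => a.eq_zero_of_notMem hq _ _

/-- The derivation `∂a/∂x`, the commutator with `∂/∂x`. -/
def derX (a : Smooth c (-μ) (-ν)) : Smooth c (-μ) (-ν) :=
  ⟨fun x y q => dx (fun z => a.1 z.1 z.2 q) (x, y), by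
    refine ⟨fun q => (a.isSmoothFun q).dx, a.supp.finite_toSet.subset ?_, fun k x y q => ?_⟩
    · rintro q ⟨x, y, h⟩
      by_contra hq
      exact h (by beta_reduce; rw [a.slice_eq_zero hq]; simp [dx])
    · beta_reduce
      have h1 : dx (fun z => a.1 z.1 z.2 q) (x + k, y) = fourier (c * k * q)
          (y - ((q * -ν : ℝ) : UnitAddCircle)) * dx (fun z => a.1 z.1 z.2 q) (x, y) := by
        rw [dx, dx, ← deriv_comp_add_const (f := fun s => a.1 s y q) (a := (k : ℝ))]
        simp only [a.shift]
        exact deriv_const_mul _ ((a.isSmoothFun q).hasDerivAt_dx x y).differentiableAt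
      rw [h1, ← mul_assoc, conj_fourier_mul_self, one_mul]⟩

/-- The derivation `2πcq(x + qμ)a + i ∂a/∂y`, the commutator with `2πcp(x - pμ) + i ∂/∂y`. -/
def derM (a : Smooth c (-μ) (-ν)) : Smooth c (-μ) (-ν) :=
  ⟨fun x y q => 2 * Real.pi * c * q * (x + q * μ) * a.1 x y q +
      Complex.I * dy (fun z => a.1 z.1 z.2 q) (x, y), by
    refine ⟨fun q => ?_, a.supp.finite_toSet.subset ?_, fun k x y q => ?_⟩
    · have h1 : IsSmoothFun fun z : ℝ × UnitAddCircle =>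
          (2 * Real.pi * c * q * (z.1 + q * μ) : ℂ) :=
        IsSmoothFun.of_fst (g := fun x : ℝ => (2 * Real.pi * c * q * (x + q * μ) : ℂ))
          (contDiff_const.mul (Complex.ofRealCLM.contDiff.add contDiff_const))
      exact (h1.mul (a.isSmoothFun q)).add ((IsSmoothFun.const _).mul (a.isSmoothFun q).dy)
    · rintro q ⟨x, y, h⟩
      by_contra hq
      exact h (by beta_reduce; rw [a.slice_eq_zero hq, a.eq_zero_of_notMem hq]; simp [dy])
    · set E : ℂ := fourier (c * k * q) (y - ((q * -ν : ℝ) : UnitAddCircle)) with hE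
      have h1 : dy (fun z => a.1 z.1 z.2 q) (x + k, y) =
          2 * Real.pi * Complex.I * (c * k * q : ℤ) * E * a.1 x y q +
            E * dy (fun z => a.1 z.1 z.2 q) (x, y) := by
        have hs : IsSmoothFun fun z : ℝ × UnitAddCircle => (fourier (c * k * q)
            (z.2 - ((q * -ν : ℝ) : UnitAddCircle)) : ℂ) :=
          (IsSmoothFun.fourier (c * k * q)).translate 0 (q * -ν)
        have h2 := hs.dy_mul (a.isSmoothFun q) (x, y)
        rw [dy_fourier_sub] at h2
        rw [← h2]
        simp only [dy, a.shift]
      have hE1 : conj E * E = 1 := conj_fourier_mul_self _ _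
      simp only [h1, a.shift, ← hE]
      push_cast
      linear_combination (2 * Real.pi * c * q * (x + q * μ) * a.1 x y q +
        Complex.I * dy (fun z => a.1 z.1 z.2 q) (x, y)) * hE1 +
        (2 * Real.pi * c * k * q * conj E * E * a.1 x y q) * Complex.I_mul_I⟩

/-- The derivation `q a`, the commutator with `p`. -/
def derZ (a : Smooth c (-μ) (-ν)) : Smooth c (-μ) (-ν) :=
  ⟨fun x y q => q * a.1 x y q, by
    refine ⟨fun q => contDiff_const.mul (a.2.1 q), a.supp.finite_toSet.subset ?_,
      fun k x y q => ?_⟩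
    · rintro q ⟨x, y, h⟩
      by_contra hq
      exact h (by beta_reduce; rw [a.eq_zero_of_notMem hq, mul_zero])
    · rw [mul_left_comm, a.2.2.2]⟩

theorem supp_subset_of_imp {a b : Smooth c (-μ) (-ν)}
    (h : ∀ q ∉ a.supp, ∀ x y, b.1 x y q = 0) : b.supp ⊆ a.supp := by
  intro q hq
  by_contra hq'
  obtain ⟨x, y, h'⟩ : ∃ x y, b.1 x y q ≠ 0 := by simpa [Smooth.supp] using hq
  exact h' (h q hq' x y)

theorem supp_derX (a : Smooth c (-μ) (-ν)) : (derX a).supp ⊆ a.supp :=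
  supp_subset_of_imp fun q hq x y => by
    change dx (fun z => a.1 z.1 z.2 q) (x, y) = 0
    rw [a.slice_eq_zero hq]; simp [dx]

theorem supp_derM (a : Smooth c (-μ) (-ν)) : (derM a).supp ⊆ a.supp :=
  supp_subset_of_imp fun q hq x y => by
    change _ * a.1 x y q + Complex.I * dy (fun z => a.1 z.1 z.2 q) (x, y) = 0
    rw [a.slice_eq_zero hq, a.eq_zero_of_notMem hq]; simp [dy]

theorem supp_derZ (a : Smooth c (-μ) (-ν)) : (derZ a).supp ⊆ a.supp :=
  supp_subset_of_imp fun q hq x y => by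
    change _ * a.1 x y q = 0
    rw [a.eq_zero_of_notMem hq, mul_zero]

theorem dx_coefFun (a : Smooth c (-μ) (-ν)) (q p : ℤ) (z : ℝ × UnitAddCircle) :
    dx (coefFun a q p) z = coefFun (derX a) q p z := by
  simp only [dx, coefFun, derX]
  exact deriv_comp_sub_const (f := fun s => a.1 s (z.2 - ((2 * p * ν : ℝ) : UnitAddCircle)) q)
    (2 * p * μ) z.1

/-- The factor `2πcq(x + qμ)` in `derM` is the difference of the potentials in the slices of `p` and
`p - q` after the translation by `(2pμ, 2pν)`. -/
theorem coefFun_derM (a : Smooth c (-μ) (-ν)) (q p : ℤ) (z : ℝ × UnitAddCircle) :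
    coefFun (derM a) q p z = (gaugePot c μ p z - gaugePot c μ (p - q) z) * coefFun a q p z +
      Complex.I * dy (coefFun a q p) z := by
  have h : dy (coefFun a q p) z = dy (fun z => a.1 z.1 z.2 q)
      (z.1 - 2 * p * μ, z.2 - ((2 * p * ν : ℝ) : UnitAddCircle)) := by
    simp only [dy, coefFun, add_sub_right_comm]
  rw [h]
  simp only [coefFun, derM, gaugePot]
  push_cast
  ring

/-- The coefficients of `a` are sections of the line bundle with the transition function that takes
the boundary condition in the slice of `p - q` to that of `p`. -/
theorem isDualTest_coefFun_mul (a : Smooth c (-μ) (-ν)) (q p : ℤ) {φ : ℝ × UnitAddCircle → ℂ}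
    (hφ : IsDualTest c ν p φ) : IsDualTest c ν (p - q) fun z => coefFun a q p z * φ z := by
  refine ⟨(isSmoothFun_coefFun a q p).mul hφ.1, fun y => ?_⟩
  have h1 := a.shift 1 (0 - 2 * p * μ) (y - ((2 * p * ν : ℝ) : UnitAddCircle)) q
  rw [show (0 : ℝ) - 2 * p * μ + (1 : ℤ) = 1 - 2 * p * μ by push_cast; ring] at h1
  have h2 : (fourier (c * (p - q)) (y - (((p - q : ℤ) * ν : ℝ) : UnitAddCircle)) *
      fourier (c * 1 * q) (y - ((2 * p * ν : ℝ) : UnitAddCircle) -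
        ((q * -ν : ℝ) : UnitAddCircle)) : ℂ) =
      fourier (c * p) (y - ((p * ν : ℝ) : UnitAddCircle)) := by
    refine fourier_mul_fourier _ _ _ _ _ _ ?_
    simp only [coe_int_mul, coe_two_mul, AddCircle.coe_neg]
    module
  simp only
  rw [hφ.2 y, twist, twist, ← h2]
  simp only [coefFun, h1]
  ring

variable {p q : ℤ} {f g h : ℝ × UnitAddCircle → Spin}

theorem WeakQP.congr {f' g' : ℝ × UnitAddCircle → Spin} (H : WeakQP c ν p f g)
    (hf : f =ᵐ[cylMeasure] f') (hg : g =ᵐ[cylMeasure] g') : WeakQP c ν p f' g' := by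
  refine ⟨H.1.ae_eq hg, fun φ hφ => (integral_congr_ae ?_).trans (H.2 φ hφ)⟩
  filter_upwards [hf, hg] with z h1 h2
  rw [h1, h2]

theorem WeakM.congr {f' h' : ℝ × UnitAddCircle → Spin} (H : WeakM c μ p f h)
    (hf : f =ᵐ[cylMeasure] f') (hh : h =ᵐ[cylMeasure] h') : WeakM c μ p f' h' := by
  refine ⟨H.1.ae_eq hh, fun φ hφ => ?_⟩
  refine Eq.trans (integral_congr_ae ?_) ((H.2 φ hφ).trans (integral_congr_ae ?_))
  · filter_upwards [hf] with z h1
    rw [h1]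
  · filter_upwards [hh] with z h1
    rw [h1]

theorem WeakQP.coefFun_smul (hf : MemLp f 2 cylMeasure) (H : WeakQP c ν (p - q) f g)
    (a : Smooth c (-μ) (-ν)) :
    WeakQP c ν p (fun z => coefFun a q p z • f z)
      fun z => coefFun a q p z • g z + coefFun (derX a) q p z • f z := by
  have ha := isSmoothFun_coefFun a q p
  refine ⟨(memLp_smul_smooth H.1 ha).add
    (memLp_smul_smooth hf (isSmoothFun_coefFun (derX a) q p)), fun φ hφ => ?_⟩
  rw [← H.2 _ (isDualTest_coefFun_mul a q p hφ)]
  refine integral_congr_ae (Eventually.of_forall fun z => ?_)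
  simp only [ha.dx_mul hφ.1, dx_coefFun]
  module

theorem WeakM.coefFun_smul (hf : MemLp f 2 cylMeasure) (H : WeakM c μ (p - q) f h)
    (a : Smooth c (-μ) (-ν)) :
    WeakM c μ p (fun z => coefFun a q p z • f z)
      fun z => coefFun a q p z • h z + coefFun (derM a) q p z • f z := by
  have ha := isSmoothFun_coefFun a q p
  have hM := isSmoothFun_coefFun (derM a) q p
  refine ⟨(memLp_smul_smooth H.1 ha).add (memLp_smul_smooth hf hM), fun φ hφ => ?_⟩
  have h1 := H.2 _ (ha.mul hφ)
  have i1 := integrable_smul_smooth H.1 (ha.mul hφ)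
  have i2 := integrable_smul_smooth hf (hM.mul hφ)
  have i3 := integrable_smul_smooth hf ((ha.mul hφ).gaugeFun (c := c) (μ := μ) (p := p - q))
  have e2 : ∫ z, φ z • (coefFun a q p z • h z + coefFun (derM a) q p z • f z) ∂cylMeasure =
      (∫ z, gaugeFun c μ (p - q) (fun z => coefFun a q p z * φ z) z • f z ∂cylMeasure) +
        ∫ z, (coefFun (derM a) q p z * φ z) • f z ∂cylMeasure := by
    rw [show (∫ z, gaugeFun c μ (p - q) (fun z => coefFun a q p z * φ z) z • f z ∂cylMeasure) =
      ∫ z, (coefFun a q p z * φ z) • h z ∂cylMeasure from h1, ← integral_add i1 i2]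
    refine integral_congr_ae (Eventually.of_forall fun z => ?_)
    simp only
    module
  rw [e2, ← integral_add i3 i2]
  refine integral_congr_ae (Eventually.of_forall fun z => ?_)
  simp only [gaugeFun, ha.dy_mul hφ, coefFun_derM, gaugePot]
  module

end

section

variable {c : ℕ} {μ ν : ℝ} {Φ Φx ΦM ΦZ : Hilb}

theorem WeakDom.piTerm (h : WeakDom c μ ν Φ Φx ΦM ΦZ) (a : Smooth c (-μ) (-ν)) (q : ℤ) :
    WeakDom c μ ν (piTerm a q Φ) (piTerm a q Φx + piTerm (derX a) q Φ)
      (piTerm a q ΦM + piTerm (derM a) q Φ) (piTerm a q ΦZ + piTerm (derZ a) q Φ) := by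
  have hs : ∀ (b : Smooth c (-μ) (-ν)) (ξ : Hilb) (p : ℤ),
      (fun z => coefFun a q p z • slice ξ (p - q) z + coefFun b q p z • slice Φ (p - q) z)
        =ᵐ[cylMeasure] slice (QHM.piTerm a q ξ + QHM.piTerm b q Φ : Hilb) p := by
    intro b ξ p
    filter_upwards [slice_congr (Lp.coeFn_add (QHM.piTerm a q ξ) (QHM.piTerm b q Φ)) p,
      slice_piTerm a q ξ p, slice_piTerm b q Φ p] with z h1 h2 h3
    rw [← h2, ← h3]
    exact h1.symm
  refine ⟨fun p => ?_, fun p => ?_, fun p => ?_⟩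
  · exact ((h.dx (p - q)).coefFun_smul (Hilb.memLp_slice _ _) a).congr
      (slice_piTerm a q Φ p).symm (hs _ _ p)
  · exact ((h.gauge (p - q)).coefFun_smul (Hilb.memLp_slice _ _) a).congr
      (slice_piTerm a q Φ p).symm (hs _ _ p)
  · filter_upwards [hs (derZ a) ΦZ p, slice_piTerm a q Φ p, h.charge (p - q)] with z h1 h2 h3
    rw [← h1, h2, h3]
    have : coefFun (derZ a) q p z = q * coefFun a q p z := rfl
    rw [this]
    push_cast
    module

theorem CoefDom.sum {ι : Type*} (S : Finset ι) {Φ Φx ΦM ΦZ : ι → Hilb}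
    (h : ∀ q ∈ S, CoefDom c μ ν (Φ q) (Φx q) (ΦM q) (ΦZ q)) :
    CoefDom c μ ν (∑ q ∈ S, Φ q) (∑ q ∈ S, Φx q) (∑ q ∈ S, ΦM q) (∑ q ∈ S, ΦZ q) := by
  refine ⟨fun i s => ?_, fun i s => ?_, fun i s => ?_⟩
  · simp only [inner_sum, Finset.mul_sum, ← Finset.sum_add_distrib]
    exact Finset.sum_congr rfl fun q hq => (h q hq).low i s
  · simp only [inner_sum, Finset.mul_sum, ← Finset.sum_sub_distrib]
    exact Finset.sum_congr rfl fun q hq => (h q hq).raise i s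
  · simp only [inner_sum, Finset.mul_sum]
    exact Finset.sum_congr rfl fun q hq => (h q hq).charge i s

/-- The weak operators satisfy the Leibniz rule with respect to the representation. -/
theorem WeakDom.piOp (hc : 0 < c) (h : WeakDom c μ ν Φ Φx ΦM ΦZ) (a : Smooth c (-μ) (-ν)) :
    WeakDom c μ ν (piOp a Φ) (piOp a Φx + piOp (derX a) Φ)
      (piOp a ΦM + piOp (derM a) Φ) (piOp a ΦZ + piOp (derZ a) Φ) := by
  rw [piOp_eq_sum (derX a) (supp_derX a), piOp_eq_sum (derM a) (supp_derM a),
    piOp_eq_sum (derZ a) (supp_derZ a), piOp_eq_sum a subset_rfl]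
  simp only [sum_apply, ← Finset.sum_add_distrib]
  exact (CoefDom.sum a.supp fun q _ => (h.piTerm a q).coefDom hc).weakDom hc

theorem hilbAct_piOp (σ : Matrix (Fin 2) (Fin 2) ℂ) (a : Smooth c (-μ) (-ν)) (ξ : Hilb) :
    hilbAct σ (piOp a ξ) = piOp a (hilbAct σ ξ) := by
  have h : ∀ q : ℤ, ∀ᵐ w ∂hilbMeasure, hilbAct σ ξ (w.1, w.2.1, w.2.2 - q) =
      act σ (ξ (w.1, w.2.1, w.2.2 - q)) := fun q =>
    (measurePreserving_shiftEquiv q).quasiMeasurePreserving.ae (hilbAct_apply σ ξ)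
  refine Lp.ext ?_
  filter_upwards [hilbAct_apply σ (QHM.piOp a ξ), piOp_apply a subset_rfl ξ,
    piOp_apply a subset_rfl (hilbAct σ ξ), ae_all_iff.2 h] with w h1 h2 h3 h4
  rw [h1, h2, h3]
  simp only [h4, ← actCLM_apply, map_sum, map_smul]

theorem piOp_diracVec (a : Smooth c (-μ) (-ν)) :
    QHM.piOp a (diracVec Φx ΦM ΦZ) =
      diracVec (QHM.piOp a Φx) (QHM.piOp a ΦM) (QHM.piOp a ΦZ) := by
  simp only [diracVec, map_neg, map_add, map_smul, hilbAct_piOp]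

theorem diracVec_add (Φx ΦM ΦZ Ψx ΨM ΨZ : Hilb) :
    diracVec (Φx + Ψx) (ΦM + ΨM) (ΦZ + ΨZ) = diracVec Φx ΦM ΦZ + diracVec Ψx ΨM ΨZ := by
  simp only [diracVec, map_add, smul_add]
  abel

theorem exists_diracVec_bound (a : Smooth c (-μ) (-ν)) : ∃ C : ℝ, ∀ Φ : Hilb,
    ‖diracVec (QHM.piOp (derX a) Φ) (QHM.piOp (derM a) Φ) (QHM.piOp (derZ a) Φ)‖ ≤ C * ‖Φ‖ := by
  refine ⟨‖-(hilbAct sigmaX ∘L QHM.piOp (derM a) + Complex.I • hilbAct sigmaY ∘L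
    QHM.piOp (derX a) + (2 * Real.pi : ℂ) • hilbAct sigmaZ ∘L QHM.piOp (derZ a))‖, fun Φ => ?_⟩
  exact ContinuousLinearMap.le_opNorm (-(hilbAct sigmaX ∘L QHM.piOp (derM a) +
    Complex.I • hilbAct sigmaY ∘L QHM.piOp (derX a) +
    (2 * Real.pi : ℂ) • hilbAct sigmaZ ∘L QHM.piOp (derZ a))) Φ

theorem isOddSpectralTriple (hc : 0 < c) :
    IsOddSpectralTriple (piRep c μ ν) (diracOp hc μ ν) where
  faithful := piRep_injective
  dense := (diracBlock hc).op_dense _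
  selfAdjoint := (diracBlock hc).op_isSelfAdjoint _
  commutator a := by
    have hdom : ∀ ξ : (diracOp hc μ ν).domain, piRep c μ ν a ξ ∈ (diracOp hc μ ν).domain := by
      rintro ⟨Φ, hΦ⟩
      obtain ⟨Φx, ΦM, ΦZ, h⟩ := (mem_diracOp_domain_iff hc).1 hΦ
      exact (mem_diracOp_domain_iff hc).2 ⟨_, _, _, h.piOp hc a⟩
    obtain ⟨C, hC⟩ := exists_diracVec_bound a
    refine ⟨hdom, C, ?_⟩
    rintro ⟨Φ, hΦ⟩
    obtain ⟨Φx, ΦM, ΦZ, h⟩ := (mem_diracOp_domain_iff hc).1 hΦ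
    have h1 := (h.piOp hc a).diracOp_eq hc (hdom ⟨Φ, hΦ⟩)
    rw [diracVec_add] at h1
    have h2 := h.diracOp_eq hc hΦ
    simp only [piRep_apply] at h1 ⊢
    rw [h1, h2, piOp_diracVec, add_sub_cancel_left]
    exact hC Φ
  compact_resolvent _ hz := (diracBlock hc).exists_resolvent _
    ((diracBlock hc).exists_absNegPow (Mode.basis hc μ ν) three_ne_zero (card_lam_le hc)).1 hz

end

end QHM

end

/-- For a positive integer `c` and real `μ, ν`, the smooth algebra of the quantum Heisenberg
manifold, the representation `π̃` and the Dirac operator `D` form an odd spectral triple of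
dimension `3`. -/
theorem theorem3p1 (c : ℕ) (hc : 0 < c) (μ ν : ℝ) :
    ∃ (π : QHM.Smooth c (-μ) (-ν) →⋆ₐ[ℂ] (QHM.Hilb →L[ℂ] QHM.Hilb))
      (D : QHM.Hilb →ₗ.[ℂ] QHM.Hilb),
      QHM.IsPiTilde μ ν π ∧ QHM.IsDirac c μ ν D ∧
      IsOddSpectralTriple π D ∧ HasSpectralDimension D 3 ∧
      ∃ K, IsAbsNegPow D 3 K ∧ MemL1Infty K := by
  obtain ⟨-, K, hK, hK', s, hs, C, hC⟩ := (QHM.diracBlock hc).exists_absNegPow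
    (QHM.Mode.basis hc μ ν) three_ne_zero (QHM.card_lam_le hc)
  exact ⟨QHM.piRep c μ ν, QHM.diracOp hc μ ν, QHM.isPiTilde_piRep, QHM.isDirac_diracOp hc,
    QHM.isOddSpectralTriple hc, ⟨three_pos, K, hK, hK', s, hs, C, hC⟩, K, hK,
    QHM.memL1Infty_of_le hK' hs hC⟩
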